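/- Setting. Let $\mathcal T$ be a finite-dimensional smooth manifold (Hausdorff, $\sigma$-compact) and $M$ a compact smooth manifold, both without boundary. Write $C^\infty(M)$ for the smooth complex-valued functions on $M$, $\mathcal D(M)$ for the algebra of (finite order, smooth) differential operators on $C^\infty(M)$, $C^\infty_h(M)=C^\infty(M)[[h]]$ and $\mathcal D_h(M)=\mathcal D(M)[[h]]$, with the $h$-linear action of $\mathcal D_h(M)$ on $C^\infty_h(M)$. Let $C_h$ be the trivial bundle over $\mathcal T$ with fibre $C_h^\infty(M)$; its smooth sections are the formal power series in $h$ whose coefficients are smooth functions on $\mathcal T\times M$. Smoothness of maps from $\mathcal T$ (or an open subset of it) to $\mathcal D(M)$ means that locally on $\mathcal T$ the order is bounded and that the coefficients depend smoothly on the point of $\mathcal T\times M$; a one-form $\alpha$ with values in $\mathcal D(M)$ is smooth if $\alpha(V)$ is smooth for all smooth vector fields $V$; for $\mathcal D_h(M)$ smoothness is understood coefficientwise in $h$. A formal connection $D$ is an operation of the form $D_Vf=V[f]+\tilde D(V)(f)$ for smooth vector fields $V$ on $\mathcal T$ and smooth sections $f$ of $C_h$, where $\tilde D=\sum_{l\ge0}\tilde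 D^{(l)}h^l$ is a smooth one-form on $\mathcal T$ with values in $\mathcal D_h(M)$. It is flat if $[D_V,D_W]=D_{[V,W]}$ for all smooth vector fields $V,W$. A formal trivialization of $D$ over an open set $U\subseteq\mathcal T$ is a smooth map $P:U\to\mathcal D_h(M)$ such that for all $\sigma\in U$ the operator $P_\sigma$ mod $h$ is an isomorphism $C^\infty(M)\to C^\infty(M)$, and such that $D_V(P(f))=0$ over $U$ for all vector fields $V$ and all $f\in C^\infty_h(M)$. Let $\Gamma$ be a group acting by diffeomorphisms on $\mathcal T$ and on $M$. It acts on $\mathcal D(M)$ by $\gamma\cdot A=(\gamma^{-1})^*\circ A\circ\gamma^*$. A one-form $\alpha$ on $\mathcal T$ with values in $\mathcal D(M)$ is $\Gamma$-invariant if $\alpha_{\gamma\sigma}(d\gamma\, v)=\gamma\cdot\alpha_\sigma(v)$, a map $A:\mathcal T\to\mathcal D(M)$ is $\Gamma$-equivariant if $A_{\gamma\sigma}=\gamma\cdot A_\sigma$, and both notions are extended coefficientwise to $\mathcal D_h(M)$; $D$ is $\Gamma$-invariant if $\tilde D$ is. Let $H^1(\mathcal T,\mathbb R)$ be the first de Rham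 cohomology of $\mathcal T$, and let $H^1_\Gamma(\mathcal T,\mathcal D(M))$ be the $\Gamma$-equivariant first de Rham cohomology with coefficients in $\mathcal D(M)$, i.e. the smooth closed $\Gamma$-invariant one-forms on $\mathcal T$ with values in $\mathcal D(M)$ modulo the differentials of smooth $\Gamma$-equivariant maps $\mathcal T\to\mathcal D(M)$. Proposition. Let $D$ be a flat formal connection with $\tilde D=0$ mod $h$ (that is, $\tilde D^{(0)}=0$). (1) Every point of $\mathcal T$ has an open neighbourhood over which there exists a formal trivialization of $D$. (2) If $H^1(\mathcal T,\mathbb R)=0$, then there exists a formal trivialization of $D$ over all of $\mathcal T$. (3) If $D$ is $\Gamma$-invariant and $H^1_\Gamma(\mathcal T,\mathcal D(M))=0$, then there exists a $\Gamma$-equivariant formal trivialization of $D$ over all of $\mathcal T$. -/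

import Mathlib

open scoped Manifold ContDiff Topology

noncomputable section

namespace FormalConnection

instance instContMDiffRingComplex : ContMDiffRing 𝓘(ℝ, ℂ) ∞ ℂ where
  contMDiff_mul := by
    rw [← modelWithCornersSelf_prod, chartedSpaceSelf_prod]
    exact contDiff_mul.contMDiff

section Operators

variable (F : Type*) [NormedAddCommGroup F] [NormedSpace ℝ F]
  (M : Type*) [TopologicalSpace M] [ChartedSpace F M]

/-- `C^∞(M)`: smooth complex valued functions on `M`. -/
abbrev SmoothFun : Type _ := C^∞⟮𝓘(ℝ, F), M; 𝓘(ℝ, ℂ), ℂ⟯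

variable {F M}

/-- Multiplication by the function `g`, as an operator on `C^∞(M)`. -/
abbrev mulOp (g : SmoothFun F M) : Module.End ℝ (SmoothFun F M) := LinearMap.mulLeft ℝ g

/-- `HasOrderLT n A`: `A` is a differential operator of order `< n`, i.e. all `n`-fold iterated
commutators of `A` with multiplications by smooth functions vanish. -/
def HasOrderLT : ℕ → Module.End ℝ (SmoothFun F M) → Prop
  | 0, A => A = 0
  | n + 1, A => ∀ g : SmoothFun F M, HasOrderLT n (A * mulOp g - mulOp g * A)

/-- `A` is a differential operator of order at most `n`. The complex constants are among the
functions that `A` is commuted with, and so such an `A` is complex linear, see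
`HasOrderLE.map_const_mul`. -/
def HasOrderLE (n : ℕ) (A : Module.End ℝ (SmoothFun F M)) : Prop := HasOrderLT (n + 1) A

theorem HasOrderLT.zero (n : ℕ) : HasOrderLT n (0 : Module.End ℝ (SmoothFun F M)) := by
  induction n with
  | zero => rfl
  | succ n ih => intro g; simpa using ih

theorem HasOrderLT.succ {n : ℕ} {A : Module.End ℝ (SmoothFun F M)} (h : HasOrderLT n A) :
    HasOrderLT (n + 1) A := by
  induction n generalizing A with
  | zero =>
    have h0 : A = 0 := h
    subst h0
    exact HasOrderLT.zero _
  | succ n ih => exact fun g => ih (h g)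

theorem HasOrderLT.mono {m n : ℕ} (hmn : m ≤ n) {A : Module.End ℝ (SmoothFun F M)}
    (h : HasOrderLT m A) : HasOrderLT n A := by
  induction hmn with
  | refl => exact h
  | step _ ih => exact ih.succ

theorem HasOrderLT.add {n : ℕ} {A B : Module.End ℝ (SmoothFun F M)} (hA : HasOrderLT n A)
    (hB : HasOrderLT n B) : HasOrderLT n (A + B) := by
  induction n generalizing A B with
  | zero =>
    have h1 : A = 0 := hA
    have h2 : B = 0 := hB
    change A + B = 0
    rw [h1, h2, add_zero]
  | succ n ih =>
    intro g
    have := ih (hA g) (hB g)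
    rwa [show (A + B) * mulOp g - mulOp g * (A + B)
      = (A * mulOp g - mulOp g * A) + (B * mulOp g - mulOp g * B) by noncomm_ring]

theorem HasOrderLT.smul {n : ℕ} {A : Module.End ℝ (SmoothFun F M)} (hA : HasOrderLT n A)
    (r : ℝ) : HasOrderLT n (r • A) := by
  induction n generalizing A with
  | zero =>
    have h1 : A = 0 := hA
    change r • A = 0
    rw [h1, smul_zero]
  | succ n ih =>
    intro g
    have := ih (hA g)
    rwa [smul_sub, ← smul_mul_assoc, ← mul_smul_comm] at this

theorem HasOrderLT.mul {m n : ℕ} {A B : Module.End ℝ (SmoothFun F M)}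
    (hA : HasOrderLT m A) (hB : HasOrderLT (n + 1) B) : HasOrderLT (m + n) (A * B) := by
  induction h : m + n generalizing m n A B with
  | zero =>
    obtain ⟨rfl, rfl⟩ : m = 0 ∧ n = 0 := by omega
    have h1 : A = 0 := hA
    change A * B = 0
    rw [h1, zero_mul]
  | succ k ih =>
    intro g
    have e : A * B * mulOp g - mulOp g * (A * B)
      = A * (B * mulOp g - mulOp g * B) + (A * mulOp g - mulOp g * A) * B := by
      simp only [mul_sub, sub_mul, mul_assoc]
      abel
    rw [e]
    refine HasOrderLT.add ?_ ?_
    · rcases n with _ | n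
      · have h0 : B * mulOp g - mulOp g * B = 0 := hB g
        rw [h0, mul_zero]
        exact HasOrderLT.zero _
      · exact ih hA (hB g) (by omega)
    · rcases m with _ | m
      · have h0 : A = 0 := hA
        rw [h0]
        simpa using HasOrderLT.zero _
      · exact ih (hA g) hB (by omega)

theorem hasOrderLE_mulOp (g : SmoothFun F M) : HasOrderLE 0 (mulOp g) := by
  intro f
  change mulOp g * mulOp f - mulOp f * mulOp g = 0
  ext1 u
  simp [mul_left_comm]

/-- Differential operators are complex linear. -/
theorem HasOrderLE.map_const_mul {n : ℕ} {A : Module.End ℝ (SmoothFun F M)}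
    (hA : HasOrderLE n A) (c : ℂ) (f : SmoothFun F M) :
    A (ContMDiffMap.const c * f) = ContMDiffMap.const c * A f := by
  set J : Module.End ℝ (SmoothFun F M) := mulOp (ContMDiffMap.const Complex.I) with hJ
  have hJJ : J * J = (-1 : ℝ) • 1 := by
    ext u x
    simp only [hJ, Module.End.mul_apply, LinearMap.mulLeft_apply]
    change Complex.I * (Complex.I * u x) = (-1 : ℝ) • u x
    rw [← mul_assoc, Complex.I_mul_I, neg_one_mul, neg_one_smul]
  have key : ∀ (n : ℕ) (B : Module.End ℝ (SmoothFun F M)), HasOrderLT n B →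
      B * J - J * B = 0 := by
    intro n
    induction n with
    | zero =>
      intro B hB
      have h0 : B = 0 := hB
      simp [h0]
    | succ n ih =>
      intro B hB
      have h1 := ih _ (hB (ContMDiffMap.const Complex.I))
      rw [← hJ] at h1
      have h2 : J * ((B * J - J * B) * J - J * (B * J - J * B)) = 0 := by rw [h1, mul_zero]
      have h3 : J * ((B * J - J * B) * J - J * (B * J - J * B))
          = J * B * (J * J) - (J * J) * (B * J) - (J * J) * (B * J) + (J * J) * (J * B) := by
        simp only [mul_sub, sub_mul, mul_assoc]
        abel
      simp only [h3, hJJ, smul_mul_assoc, mul_smul_comm, one_mul, mul_one] at h2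
      have h4 : (2 : ℝ) • (B * J - J * B) = 0 := by
        rw [← h2]
        module
      exact (smul_eq_zero.1 h4).resolve_left two_ne_zero
  have hc : ∀ u : SmoothFun F M, ContMDiffMap.const c * u = c.re • u + c.im • J u := by
    intro u
    ext x
    change c * u x = (c.re : ℝ) • u x + (c.im : ℝ) • (Complex.I * u x)
    conv_lhs => rw [← Complex.re_add_im c]
    simp only [Complex.real_smul]
    ring
  have h5 : A (J f) = J (A f) := by
    have h6 := LinearMap.congr_fun (key _ A hA) f
    simpa [sub_eq_zero] using h6
  rw [hc, hc, map_add, map_smul, map_smul, h5]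

variable (F M)

/-- The algebra of differential operators on `C^∞(M)`. -/
def diffOpAlgebra : Subalgebra ℝ (Module.End ℝ (SmoothFun F M)) where
  carrier := {A | ∃ n, HasOrderLE n A}
  mul_mem' := by
    rintro A B ⟨m, hA⟩ ⟨n, hB⟩
    exact ⟨m + n, (HasOrderLT.mul hA hB).mono (by omega)⟩
  add_mem' := by
    rintro A B ⟨m, hA⟩ ⟨n, hB⟩
    exact ⟨m + n, (HasOrderLT.mono (by omega) hA).add (HasOrderLT.mono (by omega) hB)⟩
  algebraMap_mem' := by
    intro r
    refine ⟨0, ?_⟩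
    have h : algebraMap ℝ (Module.End ℝ (SmoothFun F M)) r
        = mulOp (algebraMap ℝ (SmoothFun F M) r) := by
      ext1 u
      simp [Algebra.smul_def]
    rw [h]
    exact hasOrderLE_mulOp _

/-- `𝒟(M)`: the algebra of differential operators on `C^∞(M)`. -/
def DiffOp : Type _ := diffOpAlgebra F M

instance : Ring (DiffOp F M) := inferInstanceAs (Ring (diffOpAlgebra F M))

instance : Algebra ℝ (DiffOp F M) := inferInstanceAs (Algebra ℝ (diffOpAlgebra F M))

variable {F M} in
/-- The operator on `C^∞(M)` underlying an element of `𝒟(M)`. -/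
def DiffOp.toEnd : DiffOp F M →ₐ[ℝ] Module.End ℝ (SmoothFun F M) := (diffOpAlgebra F M).val

variable {F M} in
/-- Differential operators are regarded as functions on `C^∞(M)`. -/
instance : CoeFun (DiffOp F M) (fun _ => SmoothFun F M → SmoothFun F M) where
  coe A := A.toEnd

/-- `C^∞_h(M) = C^∞(M)[[h]]`. -/
abbrev FormalFun : Type _ := PowerSeries (SmoothFun F M)

/-- `𝒟_h(M) = 𝒟(M)[[h]]`. -/
abbrev FormalDiffOp : Type _ := PowerSeries (DiffOp F M)

variable {F M}

/-- The coefficient of `h^l` in a formal differential operator. -/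
def hcoeff (l : ℕ) : FormalDiffOp F M →ₗ[ℝ] DiffOp F M where
  toFun P := PowerSeries.coeff l P
  map_add' _ _ := rfl
  map_smul' _ _ := rfl

/-- Formal differential operators act on formal functions, `h`-linearly. -/
def FormalDiffOp.app (P : FormalDiffOp F M) (f : FormalFun F M) : FormalFun F M :=
  PowerSeries.mk fun l => ∑ p ∈ Finset.HasAntidiagonal.antidiagonal l,
    hcoeff p.1 P (PowerSeries.coeff p.2 f)

end Operators

section Action

variable (F : Type*) [NormedAddCommGroup F] [NormedSpace ℝ F]
  (M : Type*) [TopologicalSpace M] [ChartedSpace F M] (Γ : Type*) [Group Γ] [MulAction Γ M]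

/-- The (discrete) group `Γ` acts on `M` by diffeomorphisms. -/
class SmoothAction : Prop where
  contMDiff_smul : ∀ γ : Γ, ContMDiff 𝓘(ℝ, F) 𝓘(ℝ, F) ∞ (fun x : M => γ • x)

variable {F M Γ} [SmoothAction F M Γ]

/-- The pull back `f ↦ f ∘ γ`. -/
def pullback (γ : Γ) : Module.End ℝ (SmoothFun F M) where
  toFun f := f.comp ⟨fun x => γ • x, SmoothAction.contMDiff_smul γ⟩
  map_add' _ _ := rfl
  map_smul' _ _ := rfl

@[simp] theorem pullback_apply (γ : Γ) (f : SmoothFun F M) (x : M) :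
    pullback γ f x = f (γ • x) := rfl

theorem pullback_mul (γ : Γ) (f g : SmoothFun F M) :
    pullback γ (f * g) = pullback γ f * pullback γ g := rfl

/-- The action of `Γ` on operators, `γ · A = (γ⁻¹)^* ∘ A ∘ γ^*`. -/
def conjEnd (γ : Γ) (A : Module.End ℝ (SmoothFun F M)) : Module.End ℝ (SmoothFun F M) :=
  pullback γ⁻¹ * A * pullback γ

theorem HasOrderLT.conjEnd {n : ℕ} (γ : Γ) {A : Module.End ℝ (SmoothFun F M)}
    (hA : HasOrderLT n A) : HasOrderLT n (conjEnd γ A) := by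
  induction n generalizing A with
  | zero =>
    have h0 : A = 0 := hA
    subst h0
    change pullback γ⁻¹ * 0 * pullback γ = 0
    simp
  | succ n ih =>
    intro g
    have h1 := ih (hA (pullback γ g))
    convert h1 using 1
    ext u x
    simp [FormalConnection.conjEnd, pullback_mul]

/-- The action of `Γ` on `𝒟(M)`. -/
def conj (γ : Γ) : DiffOp F M →ₗ[ℝ] DiffOp F M where
  toFun A := ⟨conjEnd γ A.toEnd, by
    obtain ⟨n, hn⟩ := A.2
    exact ⟨n, HasOrderLT.conjEnd γ hn⟩⟩
  map_add' A B := by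
    apply Subtype.ext
    change pullback γ⁻¹ * (A + B).toEnd * pullback γ
      = pullback γ⁻¹ * A.toEnd * pullback γ + pullback γ⁻¹ * B.toEnd * pullback γ
    rw [map_add, mul_add, add_mul]
  map_smul' r A := by
    apply Subtype.ext
    change pullback γ⁻¹ * (r • A).toEnd * pullback γ = r • (pullback γ⁻¹ * A.toEnd * pullback γ)
    rw [map_smul, mul_smul_comm, smul_mul_assoc]

end Action

section Families

variable {E : Type*} [NormedAddCommGroup E] [NormedSpace ℝ E]
  {T : Type*} [TopologicalSpace T] [ChartedSpace E T]
  {F : Type*} [NormedAddCommGroup F] [NormedSpace ℝ F]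
  {M : Type*} [TopologicalSpace M] [ChartedSpace F M]

variable (E T) in
/-- Smooth vector fields on `T`. -/
abbrev VField [IsManifold 𝓘(ℝ, E) ∞ T] : Type _ :=
  ContMDiffSection 𝓘(ℝ, E) E ∞ (fun σ : T => TangentSpace 𝓘(ℝ, E) σ)

variable (E T F M) in
/-- Smooth complex valued functions on `T × M`, i.e. smooth maps from `T` to `C^∞(M)`. -/
abbrev FamFun : Type _ := C^∞⟮(𝓘(ℝ, E)).prod 𝓘(ℝ, F), T × M; 𝓘(ℝ, ℂ), ℂ⟯

/-- The value `f_σ ∈ C^∞(M)` at `σ` of a smooth map `f` from `T` to `C^∞(M)`. -/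
def slice (f : FamFun E T F M) (σ : T) : SmoothFun F M :=
  ⟨fun x => f (σ, x), f.contMDiff.comp (contMDiff_const.prodMk contMDiff_id)⟩

variable (E) in
/-- The map `A : T → 𝒟(M)` is smooth on the open set `U`: near every point of `U` the order of
`A_σ` is bounded, and `A`, acting along the fibres of `T × M → T`, takes smooth functions to
functions that are smooth over `U`. In local coordinates this says that near each point `A` is a
finite sum `∑ a_α(σ, x) ∂_x^α` with coefficients that are smooth in `(σ, x)`. -/
def SmoothFamilyOn (U : Set T) (A : T → DiffOp F M) : Prop :=
  (∀ σ ∈ U, ∃ n, ∀ᶠ τ in 𝓝 σ, HasOrderLE n (A τ).toEnd) ∧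
  ∀ f : FamFun E T F M, ContMDiffOn ((𝓘(ℝ, E)).prod 𝓘(ℝ, F)) 𝓘(ℝ, ℂ) ∞
    (fun p : T × M => A p.1 (slice f p.1) p.2)
    (U ×ˢ Set.univ)

theorem SmoothFamilyOn.zero (U : Set T) : SmoothFamilyOn E U (fun _ => (0 : DiffOp F M)) := by
  refine ⟨fun σ _ => ⟨0, Filter.Eventually.of_forall fun τ => ?_⟩, fun f => ?_⟩
  · rw [map_zero]
    exact HasOrderLT.zero _
  · simp only [map_zero]
    exact contMDiffOn_const (c := (0 : ℂ))

theorem SmoothFamilyOn.add {U : Set T} {A B : T → DiffOp F M} (hA : SmoothFamilyOn E U A)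
    (hB : SmoothFamilyOn E U B) : SmoothFamilyOn E U (fun σ => A σ + B σ) := by
  refine ⟨fun σ hσ => ?_, fun f => ?_⟩
  · obtain ⟨m, hm⟩ := hA.1 σ hσ
    obtain ⟨n, hn⟩ := hB.1 σ hσ
    refine ⟨m + n, ?_⟩
    filter_upwards [hm, hn] with τ h1 h2
    rw [map_add]
    exact (HasOrderLT.mono (by omega) h1).add (HasOrderLT.mono (by omega) h2)
  · simp only [map_add]
    exact (hA.2 f).add (hB.2 f)

theorem SmoothFamilyOn.smul {U : Set T} {A : T → DiffOp F M} (hA : SmoothFamilyOn E U A)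
    (r : ℝ) : SmoothFamilyOn E U (fun σ => r • A σ) := by
  refine ⟨fun σ hσ => ?_, fun f => ?_⟩
  · obtain ⟨m, hm⟩ := hA.1 σ hσ
    refine ⟨m, ?_⟩
    filter_upwards [hm] with τ h1
    rw [map_smul]
    exact h1.smul r
  · simp only [map_smul]
    exact (contDiff_const_smul (F := ℂ) r).contMDiff.comp_contMDiffOn (hA.2 f)

theorem SmoothFamilyOn.mdifferentiableAt {A : T → DiffOp F M}
    (hA : SmoothFamilyOn E Set.univ A) (f : SmoothFun F M) (σ : T) (x : M) :
    MDifferentiableAt 𝓘(ℝ, E) 𝓘(ℝ, ℂ) (fun τ => A τ f x) σ := by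
  have h := hA.2 (f.comp ContMDiffMap.snd)
  rw [Set.univ_prod_univ, contMDiffOn_univ] at h
  have h2 : ContMDiff 𝓘(ℝ, E) 𝓘(ℝ, ℂ) ∞ (fun τ => A τ f x) :=
    h.comp (contMDiff_id.prodMk (contMDiff_const (c := x)))
  exact h2.mdifferentiableAt (by simp)

variable (E) in
/-- The derivative at `σ` along the tangent vector `v` of a map from `T` to `C^∞(M)`, as a function
on `M`: `V[f]_σ (x)` is the derivative of `τ ↦ f_τ(x)`. -/
def vderiv (f : T → SmoothFun F M) (σ : T) (v : TangentSpace 𝓘(ℝ, E) σ) (x : M) : ℂ :=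
  mfderiv 𝓘(ℝ, E) 𝓘(ℝ, ℂ) (fun τ => f τ x) σ v

theorem vderiv_zero (σ : T) (v : TangentSpace 𝓘(ℝ, E) σ) (x : M) :
    vderiv E (fun _ => (0 : SmoothFun F M)) σ v x = 0 := by
  unfold vderiv
  rw [mfderiv_const]
  rfl

theorem vderiv_add {f g : T → SmoothFun F M} {σ : T} {x : M}
    (hf : MDifferentiableAt 𝓘(ℝ, E) 𝓘(ℝ, ℂ) (fun τ => f τ x) σ)
    (hg : MDifferentiableAt 𝓘(ℝ, E) 𝓘(ℝ, ℂ) (fun τ => g τ x) σ) (v : TangentSpace 𝓘(ℝ, E) σ) :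
    vderiv E (fun τ => f τ + g τ) σ v x = vderiv E f σ v x + vderiv E g σ v x := by
  unfold vderiv
  have h := mfderiv_add hf hg
  exact congrArg (fun L => L v) h

theorem vderiv_smul {f : T → SmoothFun F M} {σ : T} {x : M}
    (hf : MDifferentiableAt 𝓘(ℝ, E) 𝓘(ℝ, ℂ) (fun τ => f τ x) σ) (r : ℝ)
    (v : TangentSpace 𝓘(ℝ, E) σ) :
    vderiv E (fun τ => r • f τ) σ v x = r • vderiv E f σ v x := by
  unfold vderiv
  have h := const_smul_mfderiv hf r
  exact congrArg (fun L => L v) h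

/-! ### One-forms and first de Rham cohomology -/

variable (E T F M) in
/-- One-forms on `T` with values in `𝒟(M)`, not necessarily smooth. -/
def OpOneForm : Type _ := ∀ σ : T, TangentSpace 𝓘(ℝ, E) σ →ₗ[ℝ] DiffOp F M

instance : AddCommGroup (OpOneForm E T F M) :=
  inferInstanceAs (AddCommGroup (∀ σ : T, TangentSpace 𝓘(ℝ, E) σ →ₗ[ℝ] DiffOp F M))

instance : Module ℝ (OpOneForm E T F M) :=
  inferInstanceAs (Module ℝ (∀ σ : T, TangentSpace 𝓘(ℝ, E) σ →ₗ[ℝ] DiffOp F M))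

instance : CoeFun (OpOneForm E T F M)
    (fun _ => ∀ σ : T, TangentSpace 𝓘(ℝ, E) σ →ₗ[ℝ] DiffOp F M) where
  coe α := α

/-- Smoothness of a `𝒟(M)`-valued one-form `α`: `α(V)` is smooth for all smooth fields `V`. -/
def OpOneForm.IsSmooth [IsManifold 𝓘(ℝ, E) ∞ T] (α : OpOneForm E T F M) : Prop :=
  ∀ V : VField E T, SmoothFamilyOn E Set.univ (fun σ => α σ (V σ))

/-- `dα = 0`, where `dα(V, W) = V[α(W)] - W[α(V)] - α([V, W])`. -/
def OpOneForm.IsClosed [IsManifold 𝓘(ℝ, E) ∞ T] (α : OpOneForm E T F M) : Prop :=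
  ∀ (V W : VField E T) (f : SmoothFun F M) (σ : T) (x : M),
    vderiv E (fun τ => α τ (W τ) f) σ (V σ) x
    - vderiv E (fun τ => α τ (V τ) f) σ (W σ) x
    - α σ (VectorField.mlieBracket 𝓘(ℝ, E) V W σ) f x = 0

variable (E) in
/-- `α = dA` for a map `A` from `T` to `𝒟(M)`. -/
def OpOneForm.IsDifferential (α : OpOneForm E T F M) (A : T → DiffOp F M) : Prop :=
  ∀ (σ : T) (v : TangentSpace 𝓘(ℝ, E) σ) (f : SmoothFun F M) (x : M),
    α σ v f x
      = vderiv E (fun τ => A τ f) σ v x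

section Equivariance

variable (Γ : Type*) [Group Γ] [MulAction Γ T] [MulAction Γ M] [SmoothAction F M Γ]

/-- Equivariance of a map from `T` to `𝒟(M)`, that is, `A_{γσ} = γ · A_σ`. -/
def IsEquivariant (A : T → DiffOp F M) : Prop :=
  ∀ (γ : Γ) (σ : T), A (γ • σ) = conj γ (A σ)

/-- Invariance of a `𝒟(M)`-valued one-form: `α_{γσ}(dγ v) = γ · α_σ(v)`. -/
def OpOneForm.IsInvariant (α : OpOneForm E T F M) : Prop :=
  ∀ (γ : Γ) (σ : T) (v : TangentSpace 𝓘(ℝ, E) σ),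
    α (γ • σ) (mfderiv 𝓘(ℝ, E) 𝓘(ℝ, E) (fun τ : T => γ • τ) σ v) = conj γ (α σ v)

variable (E T F M) in
/-- The space of smooth, closed, `Γ`-invariant one-forms on `T` with values in `𝒟(M)`. -/
def closedInvariantOneForms [IsManifold 𝓘(ℝ, E) ∞ T] : Submodule ℝ (OpOneForm E T F M) where
  carrier := {α | α.IsSmooth ∧ α.IsClosed ∧ α.IsInvariant Γ}
  zero_mem' := by
    refine ⟨fun V => SmoothFamilyOn.zero _, fun V W f σ x => ?_, fun γ σ v => ?_⟩
    · have h := vderiv_zero (E := E) (F := F) (M := M) σ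
      change vderiv E (fun _ => (0 : SmoothFun F M)) σ (V σ) x
        - vderiv E (fun _ => (0 : SmoothFun F M)) σ (W σ) x - 0 = 0
      rw [h, h]
      simp
    · exact (map_zero (conj γ)).symm
  add_mem' := by
    rintro α β ⟨h1, h2, h3⟩ ⟨k1, k2, k3⟩
    refine ⟨fun V => (h1 V).add (k1 V), fun V W f σ x => ?_, fun γ σ v => ?_⟩
    · have e := vderiv_add ((h1 W).mdifferentiableAt f σ x) ((k1 W).mdifferentiableAt f σ x) (V σ)
      have e' := vderiv_add ((h1 V).mdifferentiableAt f σ x) ((k1 V).mdifferentiableAt f σ x) (W σ)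
      have a := h2 V W f σ x
      have b := k2 V W f σ x
      change vderiv E (fun τ => α τ (W τ) f + β τ (W τ) f) σ (V σ) x
        - vderiv E (fun τ => α τ (V τ) f + β τ (V τ) f) σ (W σ) x
        - (α σ (VectorField.mlieBracket 𝓘(ℝ, E) V W σ) f x
          + β σ (VectorField.mlieBracket 𝓘(ℝ, E) V W σ) f x) = 0
      rw [e, e']
      linear_combination a + b
    · change α (γ • σ) _ + β (γ • σ) _ = conj γ (α σ v + β σ v)
      rw [map_add, h3, k3]
  smul_mem' := by
    rintro r α ⟨h1, h2, h3⟩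
    refine ⟨fun V => (h1 V).smul r, fun V W f σ x => ?_, fun γ σ v => ?_⟩
    · have e := vderiv_smul ((h1 W).mdifferentiableAt f σ x) r (V σ)
      have e' := vderiv_smul ((h1 V).mdifferentiableAt f σ x) r (W σ)
      have a := h2 V W f σ x
      change vderiv E (fun τ => r • α τ (W τ) f) σ (V σ) x
        - vderiv E (fun τ => r • α τ (V τ) f) σ (W σ) x
        - r • α σ (VectorField.mlieBracket 𝓘(ℝ, E) V W σ) f x = 0
      rw [e, e', ← smul_sub, ← smul_sub, a, smul_zero]
    · change r • α (γ • σ) _ = conj γ (r • α σ v)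
      rw [map_smul, h3]

variable (E T F M) in
/-- The space of differentials of smooth, `Γ`-equivariant maps from `T` to `𝒟(M)`. -/
def exactInvariantOneForms : Submodule ℝ (OpOneForm E T F M) where
  carrier := {α | ∃ A : T → DiffOp F M,
    SmoothFamilyOn E Set.univ A ∧ IsEquivariant Γ A ∧ α.IsDifferential E A}
  zero_mem' := ⟨fun _ => 0, SmoothFamilyOn.zero _, fun γ _ => (map_zero (conj γ)).symm,
    fun σ v _ x => (vderiv_zero (F := F) σ v x).symm⟩
  add_mem' := by
    rintro α β ⟨A, h1, h2, h3⟩ ⟨B, k1, k2, k3⟩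
    refine ⟨fun σ => A σ + B σ, h1.add k1, fun γ σ => ?_, fun σ v f x => ?_⟩
    · change A (γ • σ) + B (γ • σ) = conj γ (A σ + B σ)
      rw [map_add, h2, k2]
    · have e := vderiv_add (h1.mdifferentiableAt f σ x) (k1.mdifferentiableAt f σ x) v
      rw [← h3, ← k3] at e
      exact e.symm
  smul_mem' := by
    rintro r α ⟨A, h1, h2, h3⟩
    refine ⟨fun σ => r • A σ, h1.smul r, fun γ σ => ?_, fun σ v f x => ?_⟩
    · change r • A (γ • σ) = conj γ (r • A σ)
      rw [map_smul, h2]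
    · have e := vderiv_smul (h1.mdifferentiableAt f σ x) r v
      rw [← h3] at e
      exact e.symm

variable (E T F M) in
/-- `H¹_Γ(T, 𝒟(M))`, the first cohomology of the complex of smooth `Γ`-invariant differential forms
on `T` with values in `𝒟(M)`. -/
abbrev EquivariantH1 [IsManifold 𝓘(ℝ, E) ∞ T] : Type _ :=
  closedInvariantOneForms E T F M Γ ⧸
    (exactInvariantOneForms E T F M Γ).submoduleOf (closedInvariantOneForms E T F M Γ)

end Equivariance

variable (E T) in
/-- Real one-forms on `T`, not necessarily smooth. -/
def RealOneForm : Type _ := ∀ σ : T, TangentSpace 𝓘(ℝ, E) σ →ₗ[ℝ] ℝ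

instance : AddCommGroup (RealOneForm E T) :=
  inferInstanceAs (AddCommGroup (∀ σ : T, TangentSpace 𝓘(ℝ, E) σ →ₗ[ℝ] ℝ))

instance : Module ℝ (RealOneForm E T) :=
  inferInstanceAs (Module ℝ (∀ σ : T, TangentSpace 𝓘(ℝ, E) σ →ₗ[ℝ] ℝ))

instance : CoeFun (RealOneForm E T) (fun _ => ∀ σ : T, TangentSpace 𝓘(ℝ, E) σ →ₗ[ℝ] ℝ) where
  coe β := β

/-- The derivative of the real function `g` at `σ` along the tangent vector `v`. -/
def rderiv (g : T → ℝ) (σ : T) (v : TangentSpace 𝓘(ℝ, E) σ) : ℝ :=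
  mfderiv 𝓘(ℝ, E) 𝓘(ℝ, ℝ) g σ v

theorem rderiv_zero (σ : T) (v : TangentSpace 𝓘(ℝ, E) σ) : rderiv (fun _ => (0 : ℝ)) σ v = 0 := by
  unfold rderiv
  rw [mfderiv_const]
  rfl

theorem rderiv_add {f g : T → ℝ} {σ : T} (hf : MDifferentiableAt 𝓘(ℝ, E) 𝓘(ℝ, ℝ) f σ)
    (hg : MDifferentiableAt 𝓘(ℝ, E) 𝓘(ℝ, ℝ) g σ) (v : TangentSpace 𝓘(ℝ, E) σ) :
    rderiv (fun τ => f τ + g τ) σ v = rderiv f σ v + rderiv g σ v :=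
  congrArg (fun L => L v) (mfderiv_add hf hg)

theorem rderiv_smul {f : T → ℝ} {σ : T} (hf : MDifferentiableAt 𝓘(ℝ, E) 𝓘(ℝ, ℝ) f σ) (r : ℝ)
    (v : TangentSpace 𝓘(ℝ, E) σ) : rderiv (fun τ => r • f τ) σ v = r • rderiv f σ v :=
  congrArg (fun L => L v) (const_smul_mfderiv hf r)

variable (E T) in
/-- The space of smooth closed real one-forms on `T`. -/
def closedOneForms [IsManifold 𝓘(ℝ, E) ∞ T] :
    Submodule ℝ (RealOneForm E T) where
  carrier := {β | (∀ V : VField E T, ContMDiff 𝓘(ℝ, E) 𝓘(ℝ, ℝ) ∞ (fun σ => β σ (V σ))) ∧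
    ∀ (V W : VField E T) (σ : T),
      rderiv (fun τ => β τ (W τ)) σ (V σ) - rderiv (fun τ => β τ (V τ)) σ (W σ)
      - β σ (VectorField.mlieBracket 𝓘(ℝ, E) V W σ) = 0}
  zero_mem' := by
    refine ⟨fun V => contMDiff_const (c := (0 : ℝ)), fun V W σ => ?_⟩
    have h := rderiv_zero (E := E) σ
    change rderiv (fun _ => (0 : ℝ)) σ (V σ) - rderiv (fun _ => (0 : ℝ)) σ (W σ) - 0 = 0
    rw [h, h]
    simp
  add_mem' := by
    rintro α β ⟨h1, h2⟩ ⟨k1, k2⟩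
    refine ⟨fun V => (h1 V).add (k1 V), fun V W σ => ?_⟩
    have e := rderiv_add ((h1 W).mdifferentiableAt (by simp)) ((k1 W).mdifferentiableAt (by simp))
      (V σ)
    have e' := rderiv_add ((h1 V).mdifferentiableAt (by simp)) ((k1 V).mdifferentiableAt (by simp))
      (W σ)
    have a := h2 V W σ
    have b := k2 V W σ
    change rderiv (fun τ => α τ (W τ) + β τ (W τ)) σ (V σ)
        - rderiv (fun τ => α τ (V τ) + β τ (V τ)) σ (W σ)
        - (α σ (VectorField.mlieBracket 𝓘(ℝ, E) V W σ)
          + β σ (VectorField.mlieBracket 𝓘(ℝ, E) V W σ)) = 0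
    rw [e, e']
    linear_combination a + b
  smul_mem' := by
    rintro r α ⟨h1, h2⟩
    refine ⟨fun V => (contDiff_const_smul (F := ℝ) r).contMDiff.comp (h1 V), fun V W σ => ?_⟩
    have e := rderiv_smul ((h1 W).mdifferentiableAt (by simp)) r (V σ)
    have e' := rderiv_smul ((h1 V).mdifferentiableAt (by simp)) r (W σ)
    have a := h2 V W σ
    change rderiv (fun τ => r • α τ (W τ)) σ (V σ) - rderiv (fun τ => r • α τ (V τ)) σ (W σ)
        - r • α σ (VectorField.mlieBracket 𝓘(ℝ, E) V W σ) = 0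
    rw [e, e', ← smul_sub, ← smul_sub, a, smul_zero]

variable (E T) in
/-- The space of differentials of smooth real functions on `T`. -/
def exactOneForms : Submodule ℝ (RealOneForm E T) where
  carrier := {β | ∃ g : C^∞⟮𝓘(ℝ, E), T; 𝓘(ℝ, ℝ), ℝ⟯,
    ∀ (σ : T) (v : TangentSpace 𝓘(ℝ, E) σ), β σ v = rderiv g σ v}
  zero_mem' := ⟨0, fun σ v => (rderiv_zero σ v).symm⟩
  add_mem' := by
    rintro α β ⟨g, hg⟩ ⟨k, hk⟩
    refine ⟨g + k, fun σ v => ?_⟩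
    have e := rderiv_add (g.mdifferentiableAt (x := σ)) (k.mdifferentiableAt (x := σ)) v
    rw [← hg, ← hk] at e
    exact e.symm
  smul_mem' := by
    rintro r α ⟨g, hg⟩
    refine ⟨r • g, fun σ v => ?_⟩
    have e := rderiv_smul (g.mdifferentiableAt (x := σ)) r v
    rw [← hg] at e
    exact e.symm

variable (E T) in
/-- The first de Rham cohomology `H¹(T, ℝ)`. -/
abbrev DeRhamH1 [IsManifold 𝓘(ℝ, E) ∞ T] : Type _ :=
  closedOneForms E T ⧸ (exactOneForms E T).submoduleOf (closedOneForms E T)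

/-! ### Formal connections -/

variable (E T F M) in
/-- Smooth sections over `T` of the trivial bundle `C_h` with fibre `C^∞_h(M)`. -/
abbrev FormalSection : Type _ := PowerSeries (FamFun E T F M)

/-- The value at `σ` of a section of `C_h`. -/
def FormalSection.at (s : FormalSection E T F M) (σ : T) : FormalFun F M :=
  PowerSeries.mk fun l => slice (PowerSeries.coeff l s) σ

end Families

/-- A formal connection `D_V f = V[f] + D̃(V)(f)` in `C_h`, given by the smooth one-form `D̃` on `T`
with values in `𝒟_h(M)`. Smoothness is that of all coefficients `D̃⁽ˡ⁾`. -/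
structure FormalConn (E : Type*) [NormedAddCommGroup E] [NormedSpace ℝ E]
    (T : Type*) [TopologicalSpace T] [ChartedSpace E T] [IsManifold 𝓘(ℝ, E) ∞ T]
    (F : Type*) [NormedAddCommGroup F] [NormedSpace ℝ F]
    (M : Type*) [TopologicalSpace M] [ChartedSpace F M] where
  /-- The one-form `D̃`. -/
  form : ∀ σ : T, TangentSpace 𝓘(ℝ, E) σ →ₗ[ℝ] FormalDiffOp F M
  smooth : ∀ (l : ℕ) (V : VField E T),
    SmoothFamilyOn E Set.univ (fun σ => hcoeff l (form σ (V σ)))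

namespace FormalConn

variable {E : Type*} [NormedAddCommGroup E] [NormedSpace ℝ E]
  {T : Type*} [TopologicalSpace T] [ChartedSpace E T] [IsManifold 𝓘(ℝ, E) ∞ T]
  {F : Type*} [NormedAddCommGroup F] [NormedSpace ℝ F]
  {M : Type*} [TopologicalSpace M] [ChartedSpace F M]

/-- The function on `M` that is the coefficient of `h^l` in `(D_v f)_σ = v[f] + D̃_σ(v)(f_σ)`, for a
tangent vector `v` at `σ` and a map `f : T → C^∞_h(M)` which is smooth near `σ`. -/
def covAt (D : FormalConn E T F M) (f : T → FormalFun F M) (σ : T)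
    (v : TangentSpace 𝓘(ℝ, E) σ) (l : ℕ) (x : M) : ℂ :=
  vderiv E (fun τ => PowerSeries.coeff l (f τ)) σ v x
    + PowerSeries.coeff l ((D.form σ v).app (f σ)) x

theorem contMDiff_vderiv [IsManifold 𝓘(ℝ, F) ∞ M] (V : VField E T) (f : FamFun E T F M) :
    ContMDiff ((𝓘(ℝ, E)).prod 𝓘(ℝ, F)) 𝓘(ℝ, ℂ) ∞
      (fun p : T × M => vderiv E (slice f) p.1 (V p.1) p.2) := by
  have : IsManifold 𝓘(ℝ, E) 1 T := IsManifold.of_le (n := ∞) (by simp)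
  have : IsManifold 𝓘(ℝ, F) 1 M := IsManifold.of_le (n := ∞) (by simp)
  have h1 : ContMDiff ((𝓘(ℝ, E)).prod 𝓘(ℝ, F)) (𝓘(ℝ, E)).tangent ∞
      (fun p : T × M => (⟨p.1, V p.1⟩ : TangentBundle 𝓘(ℝ, E) T)) :=
    V.contMDiff.comp contMDiff_fst
  have h2 : ContMDiff ((𝓘(ℝ, E)).prod 𝓘(ℝ, F)) (𝓘(ℝ, F)).tangent ∞
      (fun p : T × M => (⟨p.2, 0⟩ : TangentBundle 𝓘(ℝ, F) M)) :=
    (Bundle.contMDiff_zeroSection ℝ (TangentSpace 𝓘(ℝ, F) : M → Type _)).comp contMDiff_snd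
  have h3 := (contMDiff_equivTangentBundleProd_symm (n := ∞) (I := 𝓘(ℝ, E)) (I' := 𝓘(ℝ, F))
    (M := T) (M' := M)).comp (h1.prodMk h2)
  have h4 := (f.contMDiff.contMDiff_tangentMap (m := ∞) (by simp)).comp h3
  have h5 := (contMDiff_snd_tangentBundle_modelSpace ℂ 𝓘(ℝ, ℂ) (n := ∞)).comp h4
  refine h5.congr fun p => ?_
  have h6 : MDifferentiableAt 𝓘(ℝ, E) ((𝓘(ℝ, E)).prod 𝓘(ℝ, F)) (fun τ : T => (τ, p.2)) p.1 :=
    mdifferentiableAt_id.prodMk mdifferentiableAt_const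
  have h7 := mfderiv_comp p.1 (f.contMDiff.mdifferentiableAt (x := (p.1, p.2)) (by simp)) h6
  have h8 := mfderiv_prod_left (I := 𝓘(ℝ, E)) (I' := 𝓘(ℝ, F)) (x₀ := p.1) (y₀ := p.2)
  rw [h8] at h7
  exact congrArg (fun L => L (V p.1)) h7

theorem contMDiff_covAt [IsManifold 𝓘(ℝ, F) ∞ M] (D : FormalConn E T F M) (V : VField E T)
    (f : FormalSection E T F M) (l : ℕ) :
    ContMDiff ((𝓘(ℝ, E)).prod 𝓘(ℝ, F)) 𝓘(ℝ, ℂ) ∞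
      (fun p : T × M => D.covAt f.at p.1 (V p.1) l p.2) := by
  have h1 := contMDiff_vderiv V (PowerSeries.coeff l f)
  have h2 : ContMDiff ((𝓘(ℝ, E)).prod 𝓘(ℝ, F)) 𝓘(ℝ, ℂ) ∞ (fun p : T × M =>
      ∑ q ∈ Finset.HasAntidiagonal.antidiagonal l,
        hcoeff q.1 (D.form p.1 (V p.1)) (slice (PowerSeries.coeff q.2 f) p.1) p.2) := by
    refine contMDiff_finsetSum fun q _ => ?_
    have h := (D.smooth q.1 V).2 (PowerSeries.coeff q.2 f)
    rwa [Set.univ_prod_univ, contMDiffOn_univ] at h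
  refine (h1.add h2).congr fun p => ?_
  have h3 : PowerSeries.coeff l ((D.form p.1 (V p.1)).app (f.at p.1)) p.2
      = ∑ q ∈ Finset.HasAntidiagonal.antidiagonal l,
        hcoeff q.1 (D.form p.1 (V p.1)) (slice (PowerSeries.coeff q.2 f) p.1) p.2 := by
    simp only [FormalDiffOp.app, FormalSection.at, PowerSeries.coeff_mk]
    exact map_sum (ContMDiffMap.evalRingHom (I := 𝓘(ℝ, F)) (I' := 𝓘(ℝ, ℂ)) (n := ∞) p.2) _ _
  have h4 : (fun τ => PowerSeries.coeff l (f.at τ)) = slice (PowerSeries.coeff l f) := by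
    funext τ
    simp only [FormalSection.at, PowerSeries.coeff_mk]
  rw [covAt, h3, h4]
  rfl

/-- The covariant derivative `D_V` on smooth sections of `C_h`. -/
def cov [IsManifold 𝓘(ℝ, F) ∞ M] (D : FormalConn E T F M) (V : VField E T)
    (f : FormalSection E T F M) : FormalSection E T F M :=
  PowerSeries.mk fun l =>
    ⟨fun p => D.covAt f.at p.1 (V p.1) l p.2, D.contMDiff_covAt V f l⟩

/-- The Lie bracket of smooth vector fields. -/
def lieBracket [FiniteDimensional ℝ E] (V W : VField E T) : VField E T :=
  ⟨VectorField.mlieBracket 𝓘(ℝ, E) V W, by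
    have : CompleteSpace E := FiniteDimensional.complete ℝ E
    have : IsManifold 𝓘(ℝ, E) ((⊤ : ℕ∞) + 1) T := by simpa using ‹IsManifold 𝓘(ℝ, E) ∞ T›
    have : IsManifold 𝓘(ℝ, E) (minSmoothness ℝ 2) T := by
      rw [minSmoothness_of_isRCLikeNormedField]
      exact IsManifold.of_le (n := ∞) ENat.LEInfty.out
    have : IsManifold 𝓘(ℝ, E) (minSmoothness ℝ 3) T := by
      rw [minSmoothness_of_isRCLikeNormedField]
      exact IsManifold.of_le (n := ∞) ENat.LEInfty.out
    exact ContDiff.mlieBracket_vectorField (n := ⊤) (m := ⊤) V.contMDiff W.contMDiff (by simp)⟩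

/-- `D` is flat, i.e. `[D_V, D_W] = D_{[V, W]}` on sections of `C_h`. -/
def IsFlat [FiniteDimensional ℝ E] [IsManifold 𝓘(ℝ, F) ∞ M] (D : FormalConn E T F M) : Prop :=
  ∀ (V W : VField E T) (f : FormalSection E T F M),
    D.cov V (D.cov W f) - D.cov W (D.cov V f) - D.cov (lieBracket V W) f = 0

/-- `D̃ = 0 mod h`. -/
def IsZeroModH (D : FormalConn E T F M) : Prop :=
  ∀ (σ : T) (v : TangentSpace 𝓘(ℝ, E) σ), hcoeff 0 (D.form σ v) = 0

/-- `D` is `Γ`-invariant. Since the trivial connection `V[f]` is invariant, this says that all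
coefficients of `D̃` are. -/
def IsInvariant (Γ : Type*) [Group Γ] [MulAction Γ T] [MulAction Γ M] [SmoothAction F M Γ]
    (D : FormalConn E T F M) : Prop :=
  ∀ l : ℕ, OpOneForm.IsInvariant Γ
    (fun σ => hcoeff l ∘ₗ D.form σ)

/-- `P` is a formal trivialization of `D` over the open set `U`: it is smooth over `U`, it is an
isomorphism of `C^∞(M)` modulo `h`, and `D_v (P(f)) = 0` over `U` for all `f ∈ C^∞_h(M)`. -/
structure IsTrivializationOn (D : FormalConn E T F M) (U : Set T)
    (P : T → FormalDiffOp F M) : Prop where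
  smooth : ∀ l, SmoothFamilyOn E U (fun σ => hcoeff l (P σ))
  bijective : ∀ σ ∈ U, Function.Bijective (hcoeff 0 (P σ) : SmoothFun F M → SmoothFun F M)
  covariant : ∀ f : FormalFun F M, ∀ σ ∈ U, ∀ (v : TangentSpace 𝓘(ℝ, E) σ) (l : ℕ) (x : M),
    D.covAt (fun τ => (P τ).app f) σ v l x = 0

end FormalConn

end FormalConnection

end

/-! Write `P = ∑ P_l h^l` with `P_0 = 1`. A function `f` in `C^∞_h(M)` does not depend on the point
of `T`, so `D_V(P f) = 0` for all `f` follows from the equations `dP_l = α_l`, where `α_l =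
-∑_{i+j=l} D̃⁽ⁱ⁾ P_j` (`recForm`). Because `D̃⁽⁰⁾ = 0`, only `P_j` with `j < l` enter into `α_l`,
and the system is a recursion that asks for one primitive at each order in `h`.

The form `α_l` is closed. Flatness says `dD̃⁽ˡ⁾(V, W) = ∑_{i+j=l} (D̃⁽ⁱ⁾(W) D̃⁽ʲ⁾(V) - D̃⁽ⁱ⁾(V)
D̃⁽ʲ⁾(W))`. In `dα_l` the Leibniz rule and the equations already solved produce the same quadratic
terms with the opposite sign (`IsFlat.isClosedOn_recForm`). Hence each part of the proposition only
needs its own source of primitives for closed `𝒟(M)`-valued forms (`exists_isTrivializationOn`).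

Locally the source is the Poincaré lemma: integrate the operators along segments in a chart ball
(`IsAdapted.exists_primitive`). If `H¹(T, ℝ) = 0`, the scalar forms `α(·) f x` have primitives for
each `f` and `x`. Normalized to vanish at one point of each component, these differ locally from an
operator-valued primitive by a quantity independent of the point, and a connectedness argument shows
that they come from differential operators (`exists_primitive_of_deRhamH1`). In the equivariant case
`α_l` is invariant and the cohomological hypothesis itself gives an equivariant primitive.

The analytic core is that a smooth family of operators, known to be smooth on functions without
parameters, is smooth on functions with parameters (`smoothParamOn_apply`). Operators are defined by
iterated commutators and have no coefficients at hand, so this goes by induction on the order: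
Hadamard's lemma expands the function about the point of evaluation, and each remainder turns into a
commutator of lower order. Products and the Leibniz rule for families rest on it. -/

noncomputable section

namespace FormalConnection

/-! ### Integrals depending on parameters, and Hadamard's lemma -/

section ParametricIntegral

/-- The segments `{z} × [0, 1]` with `z` near a given point stay in a compact subset of `Ω`. -/
theorem exists_ball_prod_Icc_subset {W : Type*} [PseudoMetricSpace W] {Ω : Set (W × ℝ)}
    (hΩ : IsOpen Ω) {z₀ : W} (hz : ∀ t ∈ Set.Icc (0 : ℝ) 1, (z₀, t) ∈ Ω) :
    ∃ ε > 0, Metric.closedBall z₀ ε ×ˢ Set.Icc (0 : ℝ) 1 ⊆ Ω := by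
  obtain ⟨u, v, hu, -, hzu, hv, huv⟩ := generalized_tube_lemma (s := {z₀}) isCompact_singleton
    (isCompact_Icc (a := (0 : ℝ)) (b := 1)) hΩ (by rintro ⟨a, t⟩ ⟨rfl, ht⟩; exact hz t ht)
  obtain ⟨ε, hε, h⟩ := Metric.nhds_basis_closedBall.mem_iff.1 (hu.mem_nhds (hzu rfl))
  exact ⟨ε, hε, (Set.prod_mono h hv).trans huv⟩

variable {W : Type*} [NormedAddCommGroup W] [NormedSpace ℝ W] [FiniteDimensional ℝ W]

/-- Dominated differentiation under the integral: on a compact tube around the segment the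
derivative is bounded, and that constant is the dominating function. Allowing any open `Ω` around
the segments, instead of a product, suits integrands that are only defined where a path stays inside
a given set. -/
theorem hasFDerivAt_parametricIntegral {Ω : Set (W × ℝ)} (hΩ : IsOpen Ω) {h : W × ℝ → ℂ}
    (hh : ContDiffOn ℝ 1 h Ω) {z₀ : W} (hz : ∀ t ∈ Set.Icc (0 : ℝ) 1, (z₀, t) ∈ Ω) :
    HasFDerivAt (fun z => ∫ t in (0 : ℝ)..1, h (z, t))
      (∫ t in (0 : ℝ)..1, (fderiv ℝ h (z₀, t)).comp (ContinuousLinearMap.inl ℝ W ℝ)) z₀ := by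
  obtain ⟨ε, hε, hsub⟩ := exists_ball_prod_Icc_subset hΩ hz
  have hcd : ContinuousOn (fun p => (fderiv ℝ h p).comp (ContinuousLinearMap.inl ℝ W ℝ)) Ω :=
    (hh.continuousOn_fderiv_of_isOpen hΩ le_rfl).clm_comp continuousOn_const
  have hK : IsCompact (Metric.closedBall z₀ ε ×ˢ Set.Icc (0 : ℝ) 1) :=
    (isCompact_closedBall _ _).prod isCompact_Icc
  obtain ⟨C, hC⟩ := hK.exists_bound_of_continuousOn (hcd.mono hsub)
  have hsl : ∀ z ∈ Metric.closedBall z₀ ε, Set.MapsTo (fun t : ℝ => (z, t)) (Set.Icc 0 1) Ω :=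
    fun z hz t ht => hsub ⟨hz, ht⟩
  have hcz : ∀ z : W, ContinuousOn (fun t : ℝ => (z, t)) (Set.Icc 0 1) := fun z => by fun_prop
  have hint : ∀ z ∈ Metric.closedBall z₀ ε,
      IntervalIntegrable (fun t => h (z, t)) MeasureTheory.volume 0 1 := fun z hz =>
    ContinuousOn.intervalIntegrable_of_Icc zero_le_one
      (hh.continuousOn.comp (hcz z) (hsl z hz))
  have hz0 : z₀ ∈ Metric.closedBall z₀ ε := Metric.mem_closedBall_self hε.le
  refine intervalIntegral.hasFDerivAt_integral_of_dominated_of_fderiv_le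
    (F := fun z t => h (z, t))
    (F' := fun z t => (fderiv ℝ h (z, t)).comp (ContinuousLinearMap.inl ℝ W ℝ))
    (bound := fun _ => C) (Metric.closedBall_mem_nhds z₀ hε) ?_ (hint _ hz0) ?_ ?_ (by simp) ?_
  · filter_upwards [Metric.closedBall_mem_nhds z₀ hε] with z hz
    have := (hint z hz).aestronglyMeasurable
    rwa [Set.uIoc_of_le zero_le_one]
  · have : IntervalIntegrable (fun t => (fderiv ℝ h (z₀, t)).comp (ContinuousLinearMap.inl ℝ W ℝ))
        MeasureTheory.volume 0 1 := ContinuousOn.intervalIntegrable_of_Icc zero_le_one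
      (hcd.comp (hcz z₀) (hsl z₀ hz0))
    have := this.aestronglyMeasurable
    rwa [Set.uIoc_of_le zero_le_one]
  · refine Filter.Eventually.of_forall fun t ht z hz => hC (z, t) ⟨hz, ?_⟩
    rw [Set.uIoc_of_le zero_le_one] at ht
    exact Set.Ioc_subset_Icc_self ht
  · refine Filter.Eventually.of_forall fun t ht z hz => ?_
    rw [Set.uIoc_of_le zero_le_one] at ht
    have h1 : HasFDerivAt h (fderiv ℝ h (z, t)) (z, t) :=
      ((hh.differentiableOn (by simp)).differentiableAt
        (hΩ.mem_nhds (hsl z hz (Set.Ioc_subset_Icc_self ht)))).hasFDerivAt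
    exact h1.comp z (hasFDerivAt_prodMk_left z t)

/-- Each directional derivative of the integral is again an integral of the same kind, with
integrand `fderiv ℝ h p (y, 0)`. The induction therefore runs over all smooth integrands at once. -/
theorem contDiffOn_parametricIntegral_nat (n : ℕ) {Ω : Set (W × ℝ)} (hΩ : IsOpen Ω)
    {h : W × ℝ → ℂ} (hh : ContDiffOn ℝ ∞ h Ω) {O : Set W} (hO : IsOpen O)
    (hOΩ : ∀ z ∈ O, ∀ t ∈ Set.Icc (0 : ℝ) 1, (z, t) ∈ Ω) :
    ContDiffOn ℝ n (fun z => ∫ t in (0 : ℝ)..1, h (z, t)) O := by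
  have h1 : ∀ {k : W × ℝ → ℂ}, ContDiffOn ℝ ∞ k Ω → ∀ z ∈ O, HasFDerivAt _ _ z :=
    fun {k} hk z hz => hasFDerivAt_parametricIntegral hΩ
      (hk.of_le (by exact_mod_cast le_top)) (hOΩ z hz)
  induction n generalizing h with
  | zero =>
    exact contDiffOn_zero.2 fun z hz => (h1 hh z hz).continuousAt.continuousWithinAt
  | succ n ih =>
    refine contDiffOn_succ_of_fderiv_apply (n := n)
      (fun z hz => (h1 hh z hz).differentiableAt.differentiableWithinAt)
      (fun h => by simp at h) fun y => ?_
    have hd : ContDiffOn ℝ ∞ (fun p => fderiv ℝ h p (y, 0)) Ω :=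
      (hh.fderiv_of_isOpen hΩ (m := ∞) (by simp)).clm_apply contDiffOn_const
    refine (ih hd).congr fun z hz => ?_
    rw [fderivWithin_of_isOpen hO hz, (h1 hh z hz).fderiv]
    rw [ContinuousLinearMap.intervalIntegral_apply]
    · rfl
    · refine ContinuousOn.intervalIntegrable_of_Icc zero_le_one ?_
      have hcd : ContinuousOn (fun p => (fderiv ℝ h p).comp (ContinuousLinearMap.inl ℝ W ℝ)) Ω :=
        (hh.continuousOn_fderiv_of_isOpen hΩ (by simp)).clm_comp
          continuousOn_const
      exact hcd.comp (by fun_prop) (fun t ht => hOΩ z hz t ht)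

/-- Smooth dependence of integrals on parameters. -/
theorem contDiffOn_parametricIntegral {Ω : Set (W × ℝ)} (hΩ : IsOpen Ω)
    {h : W × ℝ → ℂ} (hh : ContDiffOn ℝ ∞ h Ω) {O : Set W} (hO : IsOpen O)
    (hOΩ : ∀ z ∈ O, ∀ t ∈ Set.Icc (0 : ℝ) 1, (z, t) ∈ Ω) :
    ContDiffOn ℝ ∞ (fun z => ∫ t in (0 : ℝ)..1, h (z, t)) O :=
  contDiffOn_infty.2 fun n => contDiffOn_parametricIntegral_nat n hΩ hh hO hOΩ

/-- Hadamard's lemma with parameters. -/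
theorem exists_hadamard {F : Type*} [NormedAddCommGroup F] [NormedSpace ℝ F]
    [FiniteDimensional ℝ F] {ι : Type*} [Fintype ι] (b : Module.Basis ι ℝ F) {O : Set W}
    (hO : IsOpen O) {G : W × F → ℂ} (hG : ContDiffOn ℝ ∞ G (O ×ˢ Set.univ)) :
    ∃ H : ι → (W × F) × F → ℂ,
      (∀ i, ContDiffOn ℝ ∞ (H i) ((O ×ˢ Set.univ) ×ˢ Set.univ)) ∧
      ∀ z ∈ O, ∀ w w' : F,
        G (z, w') = G (z, w) + ∑ i, ((b.repr w' i - b.repr w i : ℝ) : ℂ) * H i ((z, w), w') := by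
  have hOu : IsOpen (O ×ˢ (Set.univ : Set F)) := hO.prod isOpen_univ
  have hd : ∀ i, ContDiffOn ℝ ∞ (fun p => fderiv ℝ G p (0, b i)) (O ×ˢ Set.univ) := fun i =>
    (hG.fderiv_of_isOpen hOu (m := ∞) (by simp)).clm_apply contDiffOn_const
  -- The segment from `w` to `w'` at fixed `z`. By the fundamental theorem of calculus along it, `H
  -- i` is the integral over the segment of the partial derivative of `G` in the direction `b i`.
  let c : ((W × F) × F) × ℝ → W × F := fun q => (q.1.1.1, q.1.1.2 + q.2 • (q.1.2 - q.1.1.2))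
  have hc : ContDiff ℝ ∞ c := by
    change ContDiff ℝ ∞ fun q : ((W × F) × F) × ℝ => (q.1.1.1, q.1.1.2 + q.2 • (q.1.2 - q.1.1.2))
    fun_prop
  refine ⟨fun i q => ∫ t in (0 : ℝ)..1, fderiv ℝ G (c (q, t)) (0, b i), fun i => ?_, ?_⟩
  · refine contDiffOn_parametricIntegral (Ω := c ⁻¹' (O ×ˢ Set.univ))
      (hOu.preimage hc.continuous) (h := fun q => fderiv ℝ G (c q) (0, b i))
      ((hd i).comp hc.contDiffOn fun q hq => hq) (hOu.prod isOpen_univ) ?_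
    rintro ⟨⟨z, w⟩, w'⟩ ⟨⟨hz, -⟩, -⟩ t -
    exact ⟨hz, trivial⟩
  · intro z hz w w'
    have hmem : ∀ t, c (((z, w), w'), t) ∈ O ×ˢ (Set.univ : Set F) := fun t => ⟨hz, trivial⟩
    have hct : ContDiff ℝ ∞ fun t : ℝ => c (((z, w), w'), t) :=
      hc.comp (contDiff_const.prodMk contDiff_id)
    have hderiv : ∀ t ∈ Set.uIcc (0 : ℝ) 1,
        HasDerivAt (fun t => G (c (((z, w), w'), t)))
          (fderiv ℝ G (c (((z, w), w'), t)) (0, w' - w)) t := by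
      intro t _
      have h1 : HasDerivAt (fun t : ℝ => c (((z, w), w'), t)) (0, w' - w) t := by
        refine (hasDerivAt_const t z).prodMk ?_
        simpa using ((hasDerivAt_id t).smul_const (w' - w)).const_add w
      have h2 : HasFDerivAt G (fderiv ℝ G (c (((z, w), w'), t))) (c (((z, w), w'), t)) :=
        ((hG.differentiableOn (by simp)).differentiableAt (hOu.mem_nhds (hmem t))).hasFDerivAt
      exact h2.comp_hasDerivAt t h1
    have hexp : ∀ t, fderiv ℝ G (c (((z, w), w'), t)) (0, w' - w)
        = ∑ i, ((b.repr w' i - b.repr w i : ℝ) : ℂ) *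
          fderiv ℝ G (c (((z, w), w'), t)) (0, b i) := by
      intro t
      have h1 : ((0 : W), w' - w) = ∑ i, (b.repr w' i - b.repr w i) • ((0 : W), b i) := by
        rw [Prod.ext_iff]
        constructor
        · simp [Prod.fst_sum]
        · rw [Prod.snd_sum]
          simp only [Prod.smul_snd]
          rw [← b.sum_repr (w' - w)]
          simp
      rw [h1, map_sum]
      simp only [map_smul, Complex.real_smul]
    have hcont : ∀ i, Continuous fun t : ℝ => fderiv ℝ G (c (((z, w), w'), t)) (0, b i) :=
      fun i => by
        rw [← continuousOn_univ]
        exact (hd i).continuousOn.comp hct.continuous.continuousOn fun t _ => hmem t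
    have hint := intervalIntegral.integral_eq_sub_of_hasDerivAt hderiv (by
      simp only [hexp]
      exact (continuous_finsetSum _ fun i _ => continuous_const.mul (hcont i)).intervalIntegrable
        _ _)
    simp only [hexp] at hint
    have hii : ∀ i, IntervalIntegrable (fun t : ℝ => ((b.repr w' i - b.repr w i : ℝ) : ℂ) *
        fderiv ℝ G (c (((z, w), w'), t)) (0, b i)) MeasureTheory.volume 0 1 :=
      fun i => (continuous_const.mul (hcont i)).intervalIntegrable _ _
    rw [intervalIntegral.integral_finsetSum fun i _ => hii i] at hint
    simp only [intervalIntegral.integral_const_mul] at hint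
    rw [hint]
    simp [c]

end ParametricIntegral

universe u v w

/-! ### Functions on `M` depending smoothly on parameters in a vector space -/

section SmoothParam

variable {W : Type*} [NormedAddCommGroup W] [NormedSpace ℝ W]
  {F : Type v} [NormedAddCommGroup F] [NormedSpace ℝ F]
  {M : Type w} [TopologicalSpace M] [ChartedSpace F M]

theorem contMDiffOn_prod_iff_contDiffOn {G : Type*} [NormedAddCommGroup G] [NormedSpace ℝ G]
    {f : W × F → G} {s : Set (W × F)} :
    ContMDiffOn (𝓘(ℝ, W).prod 𝓘(ℝ, F)) 𝓘(ℝ, G) ∞ f s ↔ ContDiffOn ℝ ∞ f s := by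
  rw [← contMDiffOn_iff_contDiffOn, ← modelWithCornersSelf_prod, chartedSpaceSelf_prod]

variable (F) in
/-- The function `u z x` is smooth in `(z, x)` over `O × M`, where `O` is a set of parameters. -/
def SmoothParamOn (O : Set W) (u : W → M → ℂ) : Prop :=
  ContMDiffOn (𝓘(ℝ, W).prod 𝓘(ℝ, F)) 𝓘(ℝ, ℂ) ∞ (fun p : W × M => u p.1 p.2) (O ×ˢ Set.univ)

theorem SmoothParamOn.congr {O : Set W} {u u' : W → M → ℂ} (h : SmoothParamOn F O u)
    (e : ∀ z ∈ O, ∀ x, u' z x = u z x) : SmoothParamOn F O u' :=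
  ContMDiffOn.congr h fun p hp => e p.1 hp.1 p.2

theorem SmoothParamOn.mono {O O' : Set W} {u : W → M → ℂ} (h : SmoothParamOn F O u)
    (hO : O' ⊆ O) : SmoothParamOn F O' u :=
  ContMDiffOn.mono h (Set.prod_mono hO subset_rfl)

theorem SmoothParamOn.comp {W' : Type*} [NormedAddCommGroup W'] [NormedSpace ℝ W']
    {O : Set W} {u : W → M → ℂ} (h : SmoothParamOn F O u) {O' : Set W'} {c : W' → W}
    (hc : ContDiffOn ℝ ∞ c O') (hO : Set.MapsTo c O' O) :
    SmoothParamOn F O' (fun z x => u (c z) x) := by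
  have h1 : ContMDiffOn (𝓘(ℝ, W').prod 𝓘(ℝ, F)) (𝓘(ℝ, W).prod 𝓘(ℝ, F)) ∞
      (fun p : W' × M => (c p.1, p.2)) (O' ×ˢ Set.univ) :=
    (hc.contMDiffOn.comp contMDiffOn_fst fun p hp => hp.1).prodMk contMDiffOn_snd
  exact ContMDiffOn.comp h h1 fun p hp => ⟨hO hp.1, trivial⟩

/-- A smooth family of functions is a map to `C^∞(M)`. -/
theorem SmoothParamOn.exists_smoothFun {O : Set W} {u : W → M → ℂ} (h : SmoothParamOn F O u) :
    ∃ f : W → SmoothFun F M, ∀ z ∈ O, ∀ x, f z x = u z x := by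
  classical
  have h1 : ∀ z ∈ O, ContMDiff 𝓘(ℝ, F) 𝓘(ℝ, ℂ) ∞ (u z) := fun z hz => by
    rw [← contMDiffOn_univ]
    exact ContMDiffOn.comp h (f := fun x : M => (z, x))
      (contMDiff_const.prodMk contMDiff_id).contMDiffOn fun x _ => ⟨hz, trivial⟩
  refine ⟨fun z => if hz : z ∈ O then ⟨u z, h1 z hz⟩ else 0, fun z hz x => ?_⟩
  exact DFunLike.congr_fun (dif_pos hz) x

theorem SmoothParamOn.contDiffOn [IsManifold 𝓘(ℝ, F) ∞ M] {O : Set W} {u : W → M → ℂ}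
    (h : SmoothParamOn F O u) (x₀ : M) :
    ContDiffOn ℝ ∞ (fun p : W × F => u p.1 ((chartAt F x₀).symm p.2))
      (O ×ˢ (chartAt F x₀).target) := by
  rw [← contMDiffOn_prod_iff_contDiffOn]
  refine ContMDiffOn.comp h (f := fun p : W × F => (p.1, (chartAt F x₀).symm p.2)) ?_
    fun p hp => ⟨hp.1, trivial⟩
  exact contMDiffOn_fst.prodMk
    ((contMDiffOn_chart_symm (I := 𝓘(ℝ, F)) (x := x₀)).comp contMDiffOn_snd fun p hp => hp.2)

theorem smoothParamOn_of_contDiffOn [IsManifold 𝓘(ℝ, F) ∞ M] {O : Set W} {u : W → M → ℂ}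
    (h : ∀ x₀ : M, ContDiffOn ℝ ∞ (fun p : W × F => u p.1 ((chartAt F x₀).symm p.2))
      (O ×ˢ (chartAt F x₀).target)) : SmoothParamOn F O u := by
  rintro ⟨z, x₀⟩ ⟨hz, -⟩
  have h1 := h x₀
  rw [← contMDiffOn_prod_iff_contDiffOn] at h1
  have h2 : ContMDiffOn (𝓘(ℝ, W).prod 𝓘(ℝ, F)) (𝓘(ℝ, W).prod 𝓘(ℝ, F)) ∞
      (fun p : W × M => (p.1, chartAt F x₀ p.2)) (O ×ˢ (chartAt F x₀).source) :=
    contMDiffOn_fst.prodMk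
      ((contMDiffOn_chart (I := 𝓘(ℝ, F)) (x := x₀)).comp contMDiffOn_snd fun p hp => hp.2)
  have h3 : ContMDiffOn (𝓘(ℝ, W).prod 𝓘(ℝ, F)) 𝓘(ℝ, ℂ) ∞ (fun p : W × M => u p.1 p.2)
      (O ×ˢ (chartAt F x₀).source) := by
    refine (h1.comp h2 fun p hp => ⟨hp.1, (chartAt F x₀).map_source hp.2⟩).congr fun p hp => ?_
    simp only [Function.comp_apply, (chartAt F x₀).left_inv hp.2]
  refine (h3 (z, x₀) ⟨hz, mem_chart_source F x₀⟩).mono_of_mem_nhdsWithin ?_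
  rw [nhdsWithin_prod_eq, nhdsWithin_univ]
  exact Filter.prod_mem_prod self_mem_nhdsWithin
    ((chartAt F x₀).open_source.mem_nhds (mem_chart_source F x₀))

/-- Smooth dependence of integrals on parameters. -/
theorem SmoothParamOn.integral [FiniteDimensional ℝ W] [FiniteDimensional ℝ F]
    [IsManifold 𝓘(ℝ, F) ∞ M] {Ω : Set (W × ℝ)} (hΩ : IsOpen Ω) {h : W × ℝ → M → ℂ}
    (hh : SmoothParamOn F Ω h) {O : Set W} (hO : IsOpen O)
    (hOΩ : ∀ z ∈ O, ∀ t ∈ Set.Icc (0 : ℝ) 1, (z, t) ∈ Ω) :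
    SmoothParamOn F O (fun z x => ∫ t in (0 : ℝ)..1, h (z, t) x) := by
  refine smoothParamOn_of_contDiffOn fun x₀ => ?_
  refine contDiffOn_parametricIntegral
    (Ω := {q : (W × F) × ℝ | (q.1.1, q.2) ∈ Ω ∧ q.1.2 ∈ (chartAt F x₀).target})
    (h := fun q => h (q.1.1, q.2) ((chartAt F x₀).symm q.1.2)) ?_ ?_
    (hO.prod (chartAt F x₀).open_target) ?_
  · exact (hΩ.preimage (by fun_prop : Continuous fun q : (W × F) × ℝ => (q.1.1, q.2))).inter
      ((chartAt F x₀).open_target.preimage (by fun_prop))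
  · refine (hh.contDiffOn x₀).comp
      (f := fun q : (W × F) × ℝ => ((q.1.1, q.2), q.1.2)) ?_ fun q hq => hq
    exact ContDiff.contDiffOn (by fun_prop)
  · rintro ⟨z, y⟩ ⟨hz, hy⟩ t ht
    exact ⟨hOΩ z hz t ht, hy⟩

theorem SmoothParamOn.deriv [IsManifold 𝓘(ℝ, F) ∞ M] {u : ℝ → M → ℂ}
    (hu : SmoothParamOn F Set.univ u) :
    SmoothParamOn F Set.univ (fun s x => deriv (fun s => u s x) s) := by
  refine smoothParamOn_of_contDiffOn fun x₀ => ?_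
  have h1 := hu.contDiffOn x₀
  have ho : IsOpen ((Set.univ : Set ℝ) ×ˢ (chartAt F x₀).target) :=
    isOpen_univ.prod (chartAt F x₀).open_target
  have h2 := (h1.fderiv_of_isOpen ho (m := ∞) (by simp)).clm_apply
    (contDiffOn_const (c := ((1 : ℝ), (0 : F))))
  refine h2.congr fun p hp => ?_
  have h3 := ((h1.differentiableOn (by simp)).differentiableAt (ho.mem_nhds hp)).hasFDerivAt
  have h4 : HasDerivAt (fun s : ℝ => (s, p.2)) ((1 : ℝ), (0 : F)) p.1 :=
    (hasDerivAt_id p.1).prodMk (hasDerivAt_const _ _)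
  exact (h3.comp_hasDerivAt p.1 h4).deriv

theorem SmoothParamOn.contDiff {u : ℝ → M → ℂ} (hu : SmoothParamOn F Set.univ u) (x : M) :
    ContDiff ℝ ∞ (fun s => u s x) := by
  rw [← contMDiff_iff_contDiff, ← contMDiffOn_univ]
  exact ContMDiffOn.comp hu (f := fun s : ℝ => (s, x))
    (contMDiff_id.prodMk contMDiff_const).contMDiffOn fun _ _ => ⟨trivial, trivial⟩

/-- Hadamard's lemma in the variable `s`, with `k s = ∫₀¹ u'(t s) dt`. It turns the product rule for
curves of operators into a statement about linearity and continuity. -/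
theorem SmoothParamOn.exists_eq_add_mul [FiniteDimensional ℝ F] [IsManifold 𝓘(ℝ, F) ∞ M]
    {u : ℝ → M → ℂ} (hu : SmoothParamOn F Set.univ u) :
    ∃ k : ℝ → M → ℂ, SmoothParamOn F Set.univ k ∧ (∀ s x, u s x = u 0 x + s * k s x) ∧
      ∀ x, k 0 x = _root_.deriv (fun s => u s x) 0 := by
  refine ⟨fun s x => ∫ t in (0 : ℝ)..1, _root_.deriv (fun s => u s x) (t * s), ?_, ?_, ?_⟩
  · refine SmoothParamOn.integral (Ω := Set.univ) isOpen_univ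
      (h := fun q x => _root_.deriv (fun s => u s x) (q.2 * q.1)) ?_ isOpen_univ
      fun _ _ _ _ => trivial
    exact hu.deriv.comp (c := fun q : ℝ × ℝ => q.2 * q.1)
      (ContDiff.contDiffOn (by fun_prop)) fun _ _ => trivial
  · intro s x
    have hx := hu.contDiff x
    have h1 : ∀ t ∈ Set.uIcc (0 : ℝ) 1, HasDerivAt (fun t => u (t * s) x)
        (s • _root_.deriv (fun s => u s x) (t * s)) t := fun t _ => by
      have h2 := ((hx.differentiable (by simp)) (t * s)).hasDerivAt
      have h3 : HasDerivAt (fun t : ℝ => t * s) s t := by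
        simpa using (hasDerivAt_id t).mul_const s
      exact h2.scomp t h3
    have h2 : Continuous fun t : ℝ => s • _root_.deriv (fun s => u s x) (t * s) :=
      ((hx.continuous_deriv (by simp)).comp (by fun_prop)).const_smul s
    have h3 := intervalIntegral.integral_eq_sub_of_hasDerivAt h1 (h2.intervalIntegrable _ _)
    rw [intervalIntegral.integral_smul, Complex.real_smul] at h3
    simp only [h3]
    simp
  · intro x
    simp

/-- The device that lowers the order. The constant `g y` passes through `A` by complex linearity,
and at the point `y` it equals multiplication by `g`, so what is left is the commutator. -/
theorem HasOrderLT.commutator_apply {n : ℕ} {A : Module.End ℝ (SmoothFun F M)}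
    (hA : HasOrderLT (n + 1) A) (g h : SmoothFun F M) (y : M) :
    A ((g - ContMDiffMap.const (g y)) * h) y = (A * mulOp g - mulOp g * A) h y := by
  rw [sub_mul, map_sub, HasOrderLE.map_const_mul hA]
  rfl

end SmoothParam

/-! ### Operators acting on functions with parameters -/

section Apply

variable {F : Type v} [NormedAddCommGroup F] [NormedSpace ℝ F] [FiniteDimensional ℝ F]
  {M : Type w} [TopologicalSpace M] [ChartedSpace F M] [IsManifold 𝓘(ℝ, F) ∞ M] [T2Space M]

/-- Near `x₀`, coordinates `X` on `M` and a bump function `ρ`, such that each smooth family of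
functions is near `x₀` a smooth family of functions of `X`. -/
theorem exists_coordinates (x₀ : M) :
    ∃ (X : M → F) (ρ : SmoothFun F M), ContMDiff 𝓘(ℝ, F) 𝓘(ℝ, F) ∞ X ∧ (∀ᶠ x in 𝓝 x₀, ρ x = 1) ∧
      ∀ {W : Type (max u v)} [NormedAddCommGroup W] [NormedSpace ℝ W] (O : Set W) (u : W → M → ℂ),
        IsOpen O → SmoothParamOn F O u → ∃ G : W × F → ℂ, ContDiffOn ℝ ∞ G (O ×ˢ Set.univ) ∧
          ∀ z x, u z x - G (z, X x) = (1 - ρ x) * (u z x - G (z, X x)) := by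
  obtain ⟨χ, -⟩ := (SmoothBumpFunction.nhds_basis_tsupport (I := 𝓘(ℝ, F)) x₀).ex_mem
  set φ := chartAt F x₀ with hφ
  obtain ⟨r, hr, hrt⟩ := Metric.nhds_basis_closedBall.mem_iff.1
    (φ.open_target.mem_nhds (φ.map_source (mem_chart_source F x₀)))
  let β : ContDiffBump (φ x₀) := ⟨r / 2, r, by positivity, by linarith⟩
  have hX : ContMDiff 𝓘(ℝ, F) 𝓘(ℝ, F) ∞ fun x => χ x • φ x :=
    χ.contMDiff_smul contMDiffOn_chart
  have hN : ∀ᶠ x in 𝓝 x₀, χ x = 1 ∧ x ∈ φ.source ∧ β (φ x) = 1 := by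
    have h1 : ∀ᶠ x in 𝓝 x₀, x ∈ φ.source :=
      φ.open_source.mem_nhds (mem_chart_source F x₀)
    have h2 : ∀ᶠ x in 𝓝 x₀, β (φ x) = 1 :=
      (φ.continuousAt (mem_chart_source F x₀)).eventually β.eventuallyEq_one
    filter_upwards [χ.eventuallyEq_one, h1, h2] with x hx1 hx2 hx3
    exact ⟨hx1, hx2, hx3⟩
  -- On the support of `ρ` both cutoffs are `1` and the chart is invertible, so there `u z x = G (z,
  -- X x)`. Off the support `ρ = 0` and the claimed identity is trivial.
  obtain ⟨ρ, -, hρ⟩ := (SmoothBumpFunction.nhds_basis_tsupport (I := 𝓘(ℝ, F)) x₀).mem_iff.1 hN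
  have hρs : ContMDiff 𝓘(ℝ, F) 𝓘(ℝ, ℂ) ∞ fun x => (ρ x : ℂ) :=
    Complex.ofRealCLM.contDiff.contMDiff.comp ρ.contMDiff
  refine ⟨fun x => χ x • φ x, ⟨fun x => (ρ x : ℂ), hρs⟩, hX, ?_, ?_⟩
  · filter_upwards [ρ.eventuallyEq_one] with x hx
    change (ρ x : ℂ) = 1
    simp [hx]
  · intro W _ _ O u hO hu
    -- The function in coordinates, cut off by `β` inside the target of the chart, so that `G` is
    -- smooth on all of `F` and Hadamard's lemma applies along every segment.
    refine ⟨fun p => β p.2 • u p.1 (φ.symm p.2), ?_, ?_⟩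
    · rintro ⟨z, y⟩ ⟨hz, -⟩
      refine ContDiffAt.contDiffWithinAt ?_
      by_cases hy : y ∈ Metric.closedBall (φ x₀) r
      · refine ContDiffAt.smul (β.contDiff.contDiffAt.comp _ contDiffAt_snd) ?_
        exact (hu.contDiffOn x₀).contDiffAt
          ((hO.prod φ.open_target).mem_nhds ⟨hz, hrt hy⟩)
      · have h1 : ∀ᶠ p : W × F in 𝓝 (z, y), p.2 ∉ Metric.closedBall (φ x₀) r :=
          (Metric.isClosed_closedBall.isOpen_compl.preimage continuous_snd).mem_nhds hy
        refine (contDiffAt_const (c := (0 : ℂ))).congr_of_eventuallyEq ?_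
        filter_upwards [h1] with p hp
        have h2 : β p.2 = 0 := by
          refine β.zero_of_le_dist ?_
          have := not_le.1 (fun h => hp (Metric.mem_closedBall.2 h))
          exact this.le
        simp [h2]
    · intro z x
      change _ = (1 - (ρ x : ℂ)) * _
      by_cases hx : x ∈ tsupport ρ
      · obtain ⟨h1, h2, h3⟩ := hρ hx
        simp [h1, h3, φ.left_inv h2]
      · simp [image_eq_zero_of_notMem_tsupport hx]

/-- Induction on the order. Near `x₀` write `f z = G (z, X ·) + R z`, where `R z` vanishes on the
support of `ρ`, and expand `G` about `X y` by Hadamard's lemma. Applying `A z` and evaluating at `y`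
leaves `G (z, X y) * A z 1 y` and commutators of `A z` with coordinates and with `ρ`, which have
smaller order. Their arguments depend on the additional parameter `X y` in `F`; the parameter space
grows from `W` to `W × F` in the induction, and the universe `max u v` contains both. -/
theorem smoothParamOn_apply_of_universe_le (n : ℕ) {W : Type (max u v)} [NormedAddCommGroup W] [NormedSpace ℝ W]
    [FiniteDimensional ℝ W] {O : Set W} (hO : IsOpen O) {A : W → Module.End ℝ (SmoothFun F M)}
    (hA : ∀ z ∈ O, HasOrderLT n (A z))
    (hs : ∀ f : SmoothFun F M, SmoothParamOn F O (fun z x => A z f x))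
    {f : W → SmoothFun F M} (hf : SmoothParamOn F O (fun z x => f z x)) :
    SmoothParamOn F O (fun z x => A z (f z) x) := by
  induction n generalizing W with
  | zero =>
    refine (contMDiffOn_const (c := (0 : ℂ))).congr fun p hp => ?_
    have h0 : A p.1 = 0 := hA p.1 hp.1
    simp only [h0]
    rfl
  | succ n ih =>
    rintro ⟨z₀, x₀⟩ ⟨hz₀, -⟩
    obtain ⟨X, ρ, hX, hρ, hG⟩ := exists_coordinates.{u} (F := F) x₀
    obtain ⟨G, hGs, hG⟩ := hG O _ hO hf
    let b := Module.finBasis ℝ F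
    obtain ⟨H, hHs, hH⟩ := exists_hadamard b hO hGs
    -- The induction hypothesis for commutators of `A` with a fixed function, after a change of
    -- parameters `c`. It is used with the projection `W × F → W` for the Hadamard coefficients and
    -- with the identity for the remainder `R`.
    have hcomm : ∀ {W' : Type (max u v)} [NormedAddCommGroup W'] [NormedSpace ℝ W']
        [FiniteDimensional ℝ W'] {O' : Set W'} (_ : IsOpen O') {c : W' → W}
        (_ : ContDiffOn ℝ ∞ c O') (_ : Set.MapsTo c O' O) (g : SmoothFun F M)
        {h : W' → SmoothFun F M} (_ : SmoothParamOn F O' (fun z x => h z x)),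
        SmoothParamOn F O' (fun z x => (A (c z) * mulOp g - mulOp g * A (c z)) (h z) x) := by
      intro W' _ _ _ O' hO' c hc hcO g h hh
      refine ih hO' (A := fun z => A (c z) * mulOp g - mulOp g * A (c z))
        (fun z hz => hA (c z) (hcO hz) g) (fun k => ?_) hh
      have h1 := (hs (g * k)).comp hc hcO
      have h2 := (hs k).comp hc hcO
      have h3 : ContMDiffOn (𝓘(ℝ, W').prod 𝓘(ℝ, F)) 𝓘(ℝ, ℂ) ∞ (fun p : W' × M => g p.2)
          (O' ×ˢ Set.univ) := g.contMDiff.comp_contMDiffOn contMDiffOn_snd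
      exact (ContMDiffOn.sub h1 (ContMDiffOn.mul h3 h2))
    have hXs : ∀ i, ContMDiff 𝓘(ℝ, F) 𝓘(ℝ, ℂ) ∞ fun x => ((b.repr (X x) i : ℝ) : ℂ) := fun i => by
      have h1 : ContDiff ℝ ∞ fun w : F => ((b.repr w i : ℝ) : ℂ) :=
        Complex.ofRealCLM.contDiff.comp
          (LinearMap.toContinuousLinearMap (b.coord i)).contDiff
      exact h1.contMDiff.comp hX
    let Xf : Fin (Module.finrank ℝ F) → SmoothFun F M := fun i => ⟨_, hXs i⟩
    have hXp : ContMDiffOn (𝓘(ℝ, W).prod 𝓘(ℝ, F)) 𝓘(ℝ, W × F) ∞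
        (fun p : W × M => (p.1, X p.2)) (O ×ˢ Set.univ) := by
      exact contMDiffOn_fst.prodMk_space (hX.comp_contMDiffOn contMDiffOn_snd)
    have hGX : SmoothParamOn F O (fun z x => G (z, X x)) :=
      ContMDiffOn.comp hGs.contMDiffOn hXp fun p hp => ⟨hp.1, trivial⟩
    have hHX : ∀ i, SmoothParamOn F (O ×ˢ (Set.univ : Set F)) (fun q x => H i (q, X x)) := by
      intro i
      have h1 : ContMDiffOn (𝓘(ℝ, W × F).prod 𝓘(ℝ, F)) 𝓘(ℝ, (W × F) × F) ∞
          (fun p : (W × F) × M => (p.1, X p.2)) ((O ×ˢ Set.univ) ×ˢ Set.univ) := by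
        exact contMDiffOn_fst.prodMk_space (hX.comp_contMDiffOn contMDiffOn_snd)
      exact ContMDiffOn.comp (hHs i).contMDiffOn h1 fun p hp => ⟨hp.1, trivial⟩
    choose Hf hHf using fun i => (hHX i).exists_smoothFun
    obtain ⟨R, hR⟩ := SmoothParamOn.exists_smoothFun (u := fun z x => f z x - G (z, X x))
      (ContMDiffOn.sub hf hGX)
    have key : ∀ z ∈ O, ∀ y, ρ y = 1 → A z (f z) y = G (z, X y) * A z 1 y
        + ∑ i, (A z * mulOp (Xf i) - mulOp (Xf i) * A z) (Hf i (z, X y)) y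
        - (A z * mulOp ρ - mulOp ρ * A z) (R z) y := by
      intro z hz y hy
      -- Every term but the first carries a factor that vanishes at `y`. For the remainder this uses
      -- `R z = (1 - ρ) * R z` and `ρ y = 1`, so that `R z = -(ρ - ρ y) * R z`.
      have e : f z = ContMDiffMap.const (G (z, X y)) * 1
          + ∑ i, (Xf i - ContMDiffMap.const (Xf i y)) * Hf i (z, X y)
          - (ρ - ContMDiffMap.const (ρ y)) * R z := by
        ext x
        have e1 : (∑ i, (Xf i - ContMDiffMap.const (Xf i y)) * Hf i (z, X y) : SmoothFun F M) x
            = ∑ i, ((b.repr (X x) i - b.repr (X y) i : ℝ) : ℂ) * H i ((z, X y), X x) := by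
          rw [show (∑ i, (Xf i - ContMDiffMap.const (Xf i y)) * Hf i (z, X y) : SmoothFun F M) x
            = ∑ i, ((Xf i - ContMDiffMap.const (Xf i y)) * Hf i (z, X y) : SmoothFun F M) x from
              map_sum (ContMDiffMap.evalRingHom (I := 𝓘(ℝ, F)) (I' := 𝓘(ℝ, ℂ)) (n := ∞) x) _ _]
          refine Finset.sum_congr rfl fun i _ => ?_
          rw [← hHf i (z, X y) ⟨hz, trivial⟩ x]
          change (((b.repr (X x) i : ℝ) : ℂ) - ((b.repr (X y) i : ℝ) : ℂ)) * _ = _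
          push_cast
          rfl
        change f z x = G (z, X y) * 1 + (∑ i, (Xf i - ContMDiffMap.const (Xf i y))
          * Hf i (z, X y) : SmoothFun F M) x - (ρ x - ρ y) * R z x
        rw [e1, hR z hz, hy]
        have h1 := hG z x
        have h2 := hH z hz (X y) (X x)
        linear_combination h1 + h2
      conv_lhs => rw [e]
      rw [map_sub, map_add, map_sum, HasOrderLE.map_const_mul (hA z hz)]
      have e2 : (∑ i, A z ((Xf i - ContMDiffMap.const (Xf i y)) * Hf i (z, X y))) y
          = ∑ i, (A z * mulOp (Xf i) - mulOp (Xf i) * A z) (Hf i (z, X y)) y := by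
        rw [show (∑ i, A z ((Xf i - ContMDiffMap.const (Xf i y)) * Hf i (z, X y))) y
          = ∑ i, A z ((Xf i - ContMDiffMap.const (Xf i y)) * Hf i (z, X y)) y from
            map_sum (ContMDiffMap.evalRingHom (I := 𝓘(ℝ, F)) (I' := 𝓘(ℝ, ℂ)) (n := ∞) y) _ _]
        exact Finset.sum_congr rfl fun i _ => (hA z hz).commutator_apply _ _ _
      rw [← e2, ← (hA z hz).commutator_apply]
      rfl
    have hterm : ∀ i, SmoothParamOn F O
        (fun z y => (A z * mulOp (Xf i) - mulOp (Xf i) * A z) (Hf i (z, X y)) y) := by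
      intro i
      -- The base point `w` of the expansion is first an independent parameter, and only afterwards
      -- set to `X y`, `y` being also the point of evaluation.
      have h1 := hcomm (hO.prod isOpen_univ) (c := Prod.fst) contDiffOn_fst
        (fun q hq => hq.1) (Xf i) ((hHX i).congr (hHf i))
      exact ContMDiffOn.comp h1 (f := fun p : W × M => ((p.1, X p.2), p.2))
        (hXp.prodMk contMDiffOn_snd) fun p hp => ⟨⟨hp.1, trivial⟩, trivial⟩
    have hlast := hcomm hO (c := id) contDiffOn_id (fun _ h => h) ρ
      (SmoothParamOn.congr (u := fun z x => f z x - G (z, X x)) (ContMDiffOn.sub hf hGX) hR)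
    have hall : SmoothParamOn F O (fun z y => G (z, X y) * A z 1 y
        + ∑ i, (A z * mulOp (Xf i) - mulOp (Xf i) * A z) (Hf i (z, X y)) y
        - (A z * mulOp ρ - mulOp ρ * A z) (R z) y) := by
      refine ContMDiffOn.sub (ContMDiffOn.add (ContMDiffOn.mul hGX (hs 1)) ?_) hlast
      exact contMDiffOn_finsetSum fun i _ => hterm i
    refine (hall (z₀, x₀) ⟨hz₀, trivial⟩).congr_of_eventuallyEq ?_ (key z₀ hz₀ x₀ hρ.self_of_nhds)
    rw [nhdsWithin_prod_eq, nhdsWithin_univ]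
    filter_upwards [Filter.prod_mem_prod self_mem_nhdsWithin hρ] with p hp
    exact key p.1 hp.1 p.2 hp.2

/-- Smooth families of differential operators take smooth families of functions to smooth
families. -/
theorem smoothParamOn_apply {n : ℕ} {W : Type*} [NormedAddCommGroup W] [NormedSpace ℝ W]
    [FiniteDimensional ℝ W] {O : Set W} (hO : IsOpen O) {A : W → Module.End ℝ (SmoothFun F M)}
    (hA : ∀ z ∈ O, HasOrderLT n (A z))
    (hs : ∀ f : SmoothFun F M, SmoothParamOn F O (fun z x => A z f x))
    {f : W → SmoothFun F M} (hf : SmoothParamOn F O (fun z x => f z x)) :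
    SmoothParamOn F O (fun z x => A z (f z) x) := by
  -- A dummy parameter in `F` lifts an arbitrary `W` to the required universe; at the end it is set
  -- to `0`.
  have h := smoothParamOn_apply_of_universe_le n (W := W × F) (O := O ×ˢ Set.univ)
    (A := fun z => A z.1) (f := fun z => f z.1) (hO.prod isOpen_univ) (fun z hz => hA z.1 hz.1)
    (fun f => (hs f).comp contDiffOn_fst fun z hz => hz.1)
    (hf.comp contDiffOn_fst fun z hz => hz.1)
  exact h.comp (c := fun z => (z, 0)) (ContDiff.contDiffOn (by fun_prop)) fun z hz => ⟨hz, trivial⟩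

/-- The Leibniz rule for the action of a curve of operators on a curve of functions. -/
theorem deriv_apply {n : ℕ} {A : ℝ → Module.End ℝ (SmoothFun F M)}
    (hA : ∀ s, HasOrderLT n (A s))
    (hs : ∀ f : SmoothFun F M, SmoothParamOn F Set.univ (fun s x => A s f x))
    {g : ℝ → SmoothFun F M} (hg : SmoothParamOn F Set.univ (fun s x => g s x))
    {g' : SmoothFun F M} (hg' : ∀ x, g' x = deriv (fun s => g s x) 0) (x : M) :
    deriv (fun s => A s (g s) x) 0 = deriv (fun s => A s (g 0) x) 0 + A 0 g' x := by
  -- With `g s = g 0 + s • K s`, linearity gives `A s (g s) = A s (g 0) + s • A s (K s)`. The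
  -- derivative of the last term at `0` is `A 0 (K 0) = A 0 g'`, provided `s ↦ A s (K s) x` is
  -- differentiable, which is `smoothParamOn_apply`.
  obtain ⟨k, hk, hgk, hk0⟩ := hg.exists_eq_add_mul
  obtain ⟨K, hK⟩ := hk.exists_smoothFun
  have e : ∀ s, g s = g 0 + s • K s := fun s => by
    ext y
    change g s y = g 0 y + (s : ℝ) • K s y
    rw [hgk s y, hK s trivial, Complex.real_smul]
  have e0 : K 0 = g' := by
    ext y
    rw [hK 0 trivial, hk0, hg']
  have h1 : ∀ s, A s (g s) x = A s (g 0) x + s • A s (K s) x := fun s => by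
    conv_lhs => rw [e s, map_add, map_smul]
    rfl
  have h2 : SmoothParamOn F Set.univ (fun s x => A s (K s) x) :=
    smoothParamOn_apply isOpen_univ (fun s _ => hA s) hs (hk.congr hK)
  have h3 := ((h2.contDiff x).differentiable (by simp) 0).hasDerivAt
  have h4 := (((hs (g 0)).contDiff x).differentiable (by simp) 0).hasDerivAt
  have h5 := h4.add ((hasDerivAt_id (0 : ℝ)).smul h3)
  rw [← e0]
  simp only [h1]
  refine h5.deriv.trans ?_
  simp

end Apply

/-! ### Smooth families over the manifold `T`, and their Leibniz rule -/

section Families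

variable {E : Type*} [NormedAddCommGroup E] [NormedSpace ℝ E]
  {T : Type*} [TopologicalSpace T] [ChartedSpace E T]
  {F : Type*} [NormedAddCommGroup F] [NormedSpace ℝ F]
  {M : Type*} [TopologicalSpace M] [ChartedSpace F M]
  {W : Type*} [NormedAddCommGroup W] [NormedSpace ℝ W]

theorem SmoothParamOn.of_locally {O : Set W} {u : W → M → ℂ}
    (h : ∀ z ∈ O, ∃ O' ∈ 𝓝 z, SmoothParamOn F O' u) : SmoothParamOn F O u := by
  rintro ⟨z, x⟩ ⟨hz, -⟩
  obtain ⟨O', hO', hu⟩ := h z hz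
  exact (ContMDiffOn.contMDiffAt hu (prod_mem_nhds hO' Filter.univ_mem)).contMDiffWithinAt

variable (E F) in
/-- The function `u σ x` is smooth in `(σ, x)` over `U × M`, where `U` is a subset of the
manifold `T`. -/
def SmoothOver (U : Set T) (u : T → M → ℂ) : Prop :=
  ContMDiffOn ((𝓘(ℝ, E)).prod 𝓘(ℝ, F)) 𝓘(ℝ, ℂ) ∞ (fun p : T × M => u p.1 p.2) (U ×ˢ Set.univ)

theorem SmoothOver.congr {U : Set T} {u u' : T → M → ℂ} (h : SmoothOver E F U u)
    (e : ∀ z ∈ U, ∀ x, u' z x = u z x) : SmoothOver E F U u' :=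
  ContMDiffOn.congr h fun p hp => e p.1 hp.1 p.2

theorem SmoothOver.mono {U U' : Set T} {u : T → M → ℂ} (h : SmoothOver E F U u)
    (hU : U' ⊆ U) : SmoothOver E F U' u :=
  ContMDiffOn.mono h (Set.prod_mono hU subset_rfl)

theorem SmoothOver.of_locally {U : Set T} {u : T → M → ℂ}
    (h : ∀ σ ∈ U, ∃ U' ∈ 𝓝 σ, SmoothOver E F U' u) : SmoothOver E F U u := by
  rintro ⟨σ, x⟩ ⟨hσ, -⟩
  obtain ⟨U', hU', hu⟩ := h σ hσ
  exact (ContMDiffOn.contMDiffAt hu (prod_mem_nhds hU' Filter.univ_mem)).contMDiffWithinAt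

theorem SmoothOver.comp {U : Set T} {u : T → M → ℂ} (h : SmoothOver E F U u) {O : Set W}
    {c : W → T} (hc : ContMDiffOn 𝓘(ℝ, W) 𝓘(ℝ, E) ∞ c O) (hO : Set.MapsTo c O U) :
    SmoothParamOn F O (fun z x => u (c z) x) :=
  ContMDiffOn.comp h (f := fun p : W × M => (c p.1, p.2))
    ((hc.comp contMDiffOn_fst fun _ hp => hp.1).prodMk contMDiffOn_snd)
    fun _ hp => ⟨hO hp.1, trivial⟩

theorem SmoothParamOn.smoothOver {O : Set W} {u : W → M → ℂ} (h : SmoothParamOn F O u)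
    {U : Set T} {c : T → W} (hc : ContMDiffOn 𝓘(ℝ, E) 𝓘(ℝ, W) ∞ c U) (hU : Set.MapsTo c U O) :
    SmoothOver E F U (fun σ x => u (c σ) x) :=
  ContMDiffOn.comp h (f := fun p : T × M => (c p.1, p.2))
    ((hc.comp contMDiffOn_fst fun _ hp => hp.1).prodMk contMDiffOn_snd)
    fun _ hp => ⟨hU hp.1, trivial⟩

theorem SmoothOver.mdifferentiableAt {U : Set T} (hU : IsOpen U) {u : T → M → ℂ}
    (h : SmoothOver E F U u) {σ : T} (hσ : σ ∈ U) (x : M) :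
    MDifferentiableAt 𝓘(ℝ, E) 𝓘(ℝ, ℂ) (fun τ => u τ x) σ := by
  have h1 : ContMDiffOn 𝓘(ℝ, E) 𝓘(ℝ, ℂ) ∞ (fun τ => u τ x) U :=
    ContMDiffOn.comp h (f := fun τ : T => (τ, x)) (contMDiffOn_id.prodMk contMDiffOn_const)
      fun τ hτ => ⟨hτ, trivial⟩
  exact (h1.contMDiffAt (hU.mem_nhds hσ)).mdifferentiableAt (by simp)

theorem FamFun.smoothOver (f : FamFun E T F M) (U : Set T) :
    SmoothOver E F U (fun σ x => slice f σ x) :=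
  f.contMDiff.contMDiffOn

theorem SmoothFamilyOn.smoothOver {U : Set T} {A : T → DiffOp F M} (hA : SmoothFamilyOn E U A)
    (f : FamFun E T F M) : SmoothOver E F U (fun σ x => A σ (slice f σ) x) := hA.2 f

theorem SmoothFamilyOn.intro {U : Set T} {A : T → DiffOp F M}
    (h1 : ∀ σ ∈ U, ∃ n, ∀ᶠ τ in 𝓝 σ, HasOrderLE n (A τ).toEnd)
    (h2 : ∀ f : FamFun E T F M, SmoothOver E F U (fun σ x => A σ (slice f σ) x)) :
    SmoothFamilyOn E U A := ⟨h1, h2⟩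

theorem SmoothFamilyOn.mono {U U' : Set T} {A : T → DiffOp F M} (h : SmoothFamilyOn E U A)
    (hU : U' ⊆ U) : SmoothFamilyOn E U' A :=
  .intro (fun σ hσ => h.1 σ (hU hσ)) fun f => (h.smoothOver f).mono hU

theorem SmoothFamilyOn.of_locally {U : Set T} {A : T → DiffOp F M}
    (h : ∀ σ ∈ U, ∃ U', IsOpen U' ∧ σ ∈ U' ∧ SmoothFamilyOn E U' A) : SmoothFamilyOn E U A := by
  refine .intro (fun σ hσ => ?_) fun f => SmoothOver.of_locally fun σ hσ => ?_
  · obtain ⟨U', -, h1, h2⟩ := h σ hσ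
    exact h2.1 σ h1
  · obtain ⟨U', h0, h1, h2⟩ := h σ hσ
    exact ⟨U', h0.mem_nhds h1, h2.smoothOver f⟩

theorem SmoothFamilyOn.congr {U : Set T} (hU : IsOpen U) {A B : T → DiffOp F M}
    (h : SmoothFamilyOn E U A) (e : ∀ σ ∈ U, B σ = A σ) : SmoothFamilyOn E U B := by
  refine .intro (fun σ hσ => ?_) fun f => (h.smoothOver f).congr fun σ hσ x => by rw [e σ hσ]
  obtain ⟨n, hn⟩ := h.1 σ hσ
  refine ⟨n, ?_⟩
  filter_upwards [hn, hU.mem_nhds hσ] with τ h1 h2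
  rwa [e τ h2]

theorem SmoothFamilyOn.const (U : Set T) (A : DiffOp F M)
    (hA : ∀ f : FamFun E T F M, SmoothOver E F U (fun σ x => A (slice f σ) x)) :
    SmoothFamilyOn E U (fun _ => A) := by
  obtain ⟨n, hn⟩ := A.2
  exact ⟨fun σ _ => ⟨n, Filter.Eventually.of_forall fun _ => hn⟩, hA⟩

theorem SmoothFamilyOn.one (U : Set T) : SmoothFamilyOn E U (fun _ => (1 : DiffOp F M)) := by
  refine SmoothFamilyOn.const U 1 fun f => ?_
  rw [map_one]
  exact FamFun.smoothOver f U

theorem SmoothFamilyOn.neg {U : Set T} {A : T → DiffOp F M} (hA : SmoothFamilyOn E U A) :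
    SmoothFamilyOn E U (fun σ => -A σ) := by
  simpa only [neg_one_smul] using hA.smul (-1)

theorem SmoothFamilyOn.sum {ι : Type*} (s : Finset ι) {U : Set T} {A : ι → T → DiffOp F M}
    (hA : ∀ i ∈ s, SmoothFamilyOn E U (A i)) : SmoothFamilyOn E U (fun σ => ∑ i ∈ s, A i σ) := by
  classical
  induction s using Finset.induction_on with
  | empty => simpa using SmoothFamilyOn.zero U
  | insert i s hi ih =>
    simp only [Finset.sum_insert hi]
    exact (hA i (by simp)).add (ih fun j hj => hA j (by simp [hj]))

theorem SmoothFamilyOn.smoothOver_apply_const {U : Set T} {A : T → DiffOp F M}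
    (hA : SmoothFamilyOn E U A) (f : SmoothFun F M) : SmoothOver E F U (fun σ x => A σ f x) :=
  hA.2 (f.comp ContMDiffMap.snd)

/-- The definition of a smooth family only tests functions smooth on all of `T × M`. Near `σ` the
family `g` is replaced by its product with a bump function, extended by zero; since `A` acts on each
fibre separately, agreement of the slices near `σ` suffices. -/
theorem SmoothFamilyOn.smoothOver_apply [FiniteDimensional ℝ E] [IsManifold 𝓘(ℝ, E) ∞ T]
    [T2Space T] {U : Set T} (hU : IsOpen U) {A : T → DiffOp F M} (hA : SmoothFamilyOn E U A)
    {g : T → SmoothFun F M} (hg : SmoothOver E F U (fun σ x => g σ x)) :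
    SmoothOver E F U (fun σ x => A σ (g σ) x) := by
  refine SmoothOver.of_locally fun σ hσ => ?_
  obtain ⟨χ, -, hχ⟩ := (SmoothBumpFunction.nhds_basis_tsupport (I := 𝓘(ℝ, E)) σ).mem_iff.1
    (hU.mem_nhds hσ)
  have hs : ContMDiff ((𝓘(ℝ, E)).prod 𝓘(ℝ, F)) 𝓘(ℝ, ℂ) ∞
      (fun p : T × M => χ p.1 • g p.1 p.2) := by
    rintro ⟨τ, x⟩
    by_cases hτ : τ ∈ tsupport χ
    · exact (χ.contMDiff.contMDiffAt.comp _ contMDiffAt_fst).smul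
        (ContMDiffOn.contMDiffAt hg (prod_mem_nhds (hU.mem_nhds (hχ hτ)) Filter.univ_mem))
    · refine (contMDiffAt_const (c := (0 : ℂ))).congr_of_eventuallyEq ?_
      have h1 : ∀ᶠ p : T × M in 𝓝 (τ, x), p.1 ∉ tsupport χ :=
        ((isClosed_tsupport χ).isOpen_compl.preimage continuous_fst).mem_nhds hτ
      filter_upwards [h1] with p hp
      rw [image_eq_zero_of_notMem_tsupport hp, zero_smul]
  let h : FamFun E T F M := ⟨_, hs⟩
  refine ⟨_, Filter.inter_mem χ.eventuallyEq_one (hU.mem_nhds hσ),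
    ((hA.smoothOver h).mono Set.inter_subset_right).congr ?_⟩
  rintro τ ⟨hτ, -⟩ x
  have e : slice h τ = g τ := by
    ext y
    change χ τ • g τ y = g τ y
    rw [show χ τ = 1 from hτ, one_smul]
  rw [e]

theorem SmoothFamilyOn.mul [FiniteDimensional ℝ E] [IsManifold 𝓘(ℝ, E) ∞ T] [T2Space T]
    {U : Set T} (hU : IsOpen U) {A B : T → DiffOp F M} (hA : SmoothFamilyOn E U A)
    (hB : SmoothFamilyOn E U B) : SmoothFamilyOn E U (fun σ => A σ * B σ) := by
  refine .intro (fun σ hσ => ?_) fun f => ?_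
  · obtain ⟨m, hm⟩ := hA.1 σ hσ
    obtain ⟨n, hn⟩ := hB.1 σ hσ
    refine ⟨m + n, ?_⟩
    filter_upwards [hm, hn] with τ h1 h2
    rw [map_mul]
    exact (HasOrderLT.mul h1 h2).mono (by omega)
  · have h1 := hA.smoothOver_apply hU (g := fun σ => B σ (slice f σ)) (hB.smoothOver f)
    refine SmoothOver.congr h1 fun σ _ x => ?_
    rw [map_mul]
    rfl

/-- Smooth families of operators take families of functions with additional parameters to such
families. -/
theorem SmoothFamilyOn.smoothParamOn_apply [FiniteDimensional ℝ F] [IsManifold 𝓘(ℝ, F) ∞ M]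
    [T2Space M] [FiniteDimensional ℝ W] {U : Set T} {A : T → DiffOp F M}
    (hA : SmoothFamilyOn E U A) {O : Set W} (hO : IsOpen O) {c : W → T}
    (hc : ContMDiffOn 𝓘(ℝ, W) 𝓘(ℝ, E) ∞ c O) (hcO : Set.MapsTo c O U)
    {f : W → SmoothFun F M} (hf : SmoothParamOn F O (fun z x => f z x)) :
    SmoothParamOn F O (fun z x => A (c z) (f z) x) := by
  refine SmoothParamOn.of_locally fun z hz => ?_
  obtain ⟨n, hn⟩ := hA.1 (c z) (hcO hz)
  have h1 : ∀ᶠ z' in 𝓝 z, z' ∈ O ∧ HasOrderLE n (A (c z')).toEnd :=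
    (hO.eventually_mem hz).and ((hc.continuousOn.continuousAt (hO.mem_nhds hz)).eventually hn)
  obtain ⟨O', hO'1, hO'2, hzO'⟩ := mem_nhds_iff.1 h1
  refine ⟨O', hO'2.mem_nhds hzO', FormalConnection.smoothParamOn_apply hO'2
    (A := fun z => (A (c z)).toEnd) (fun z' hz' => (hO'1 hz').2) (fun k => ?_)
    (hf.mono fun z' hz' => (hO'1 hz').1)⟩
  exact ((hA.smoothOver_apply_const k).comp hc hcO).mono fun z' hz' => (hO'1 hz').1

/-- Tangent vectors are velocities of smooth curves, that stay in a given open set. -/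
theorem exists_curve [IsManifold 𝓘(ℝ, E) ∞ T] {U : Set T} (hU : IsOpen U) {σ : T} (hσ : σ ∈ U)
    (v : TangentSpace 𝓘(ℝ, E) σ) :
    ∃ γ : ℝ → T, ContMDiff 𝓘(ℝ, ℝ) 𝓘(ℝ, E) ∞ γ ∧ (∀ s, γ s ∈ U) ∧ γ 0 = σ ∧
      ∀ u : T → ℂ, MDifferentiableAt 𝓘(ℝ, E) 𝓘(ℝ, ℂ) u σ →
        deriv (fun s => u (γ s)) 0 = mfderiv 𝓘(ℝ, E) 𝓘(ℝ, ℂ) u σ v := by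
  set φ := chartAt E σ with hφ
  have : IsManifold 𝓘(ℝ, E) 1 T := IsManifold.of_le (n := ∞) (by simp)
  have hφd : φ.MDifferentiable 𝓘(ℝ, E) 𝓘(ℝ, E) := mdifferentiable_chart σ
  have hσφ : σ ∈ φ.source := mem_chart_source E σ
  let w : E := mfderiv 𝓘(ℝ, E) 𝓘(ℝ, E) φ σ v
  have hopen : IsOpen (φ.target ∩ φ.symm ⁻¹' U) := φ.isOpen_inter_preimage_symm hU
  have hmem : φ σ ∈ φ.target ∩ φ.symm ⁻¹' U :=
    ⟨φ.map_source hσφ, by rw [Set.mem_preimage, φ.left_inv hσφ]; exact hσ⟩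
  have hcont : Continuous fun s : ℝ => φ σ + s • w := by fun_prop
  obtain ⟨ε, hε, hsub⟩ := Metric.nhds_basis_closedBall.mem_iff.1
    (hcont.continuousAt.preimage_mem_nhds (x := 0)
      (show φ.target ∩ φ.symm ⁻¹' U ∈ 𝓝 (φ σ + (0 : ℝ) • w) by
        rw [zero_smul, add_zero]; exact hopen.mem_nhds hmem))
  let β : ContDiffBump (0 : ℝ) := ⟨ε / 2, ε, by positivity, by linarith⟩
  have hβ : ∀ s : ℝ, |β s * s| ≤ ε := fun s => by
    by_cases hs : s ∈ Metric.ball (0 : ℝ) ε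
    · rw [abs_mul, abs_of_nonneg β.nonneg]
      have h1 : |s| < ε := by simpa using hs
      calc β s * |s| ≤ 1 * |s| := by gcongr; exact β.le_one
        _ ≤ ε := by linarith
    · rw [β.zero_of_le_dist (not_lt.1 hs)]
      simpa using hε.le
  -- The factor `β s * s` is bounded by `ε`, which keeps the curve in the chart and in `U` for all
  -- real `s`. It equals `s` near `0`, so the velocity there is still `w`.
  let c : ℝ → E := fun s => φ σ + (β s * s) • w
  have hcs : ContDiff ℝ ∞ c := by
    exact contDiff_const.add ((β.contDiff.mul contDiff_id).smul contDiff_const)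
  have hcm : ∀ s, c s ∈ φ.target ∩ φ.symm ⁻¹' U := fun s =>
    hsub (by simpa using hβ s : β s * s ∈ Metric.closedBall (0 : ℝ) ε)
  have hc0 : c 0 = φ σ := by simp [c]
  have hcd : HasDerivAt c w 0 := by
    have h1 : c =ᶠ[𝓝 0] fun s => φ σ + s • w := by
      filter_upwards [β.eventuallyEq_one] with s hs
      simp [c, hs]
    refine HasDerivAt.congr_of_eventuallyEq ?_ h1
    simpa using ((hasDerivAt_id (0 : ℝ)).smul_const w).const_add (φ σ)
  refine ⟨fun s => φ.symm (c s), ?_, fun s => (hcm s).2, ?_, fun u hu => ?_⟩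
  · have h1 : ContMDiffOn 𝓘(ℝ, E) 𝓘(ℝ, E) ∞ φ.symm φ.target := contMDiffOn_chart_symm
    exact h1.comp_contMDiff hcs.contMDiff fun s => (hcm s).1
  · change φ.symm (c 0) = σ
    rw [hc0, φ.left_inv hσφ]
  · have hu' : MDifferentiableAt 𝓘(ℝ, E) 𝓘(ℝ, ℂ) u (φ.symm (φ σ)) := by rwa [φ.left_inv hσφ]
    have h1 := hφd.mdifferentiableAt_symm (φ.map_source hσφ)
    have h2 : HasMFDerivAt 𝓘(ℝ, E) 𝓘(ℝ, ℂ) (u ∘ φ.symm) (φ σ) _ :=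
      hu'.hasMFDerivAt.comp (φ σ) h1.hasMFDerivAt
    have h3 := h2.hasFDerivAt
    rw [← hc0] at h3
    refine (h3.comp_hasDerivAt 0 hcd).deriv.trans ?_
    have h4 := DFunLike.congr_fun (hφd.symm_comp_deriv hσφ) v
    -- The point `φ.symm (φ σ)` is only propositionally `σ`. All tangent spaces are `E`, and so the
    -- derivatives can be compared after a substitution.
    have h5 : ∀ τ, τ = σ → (mfderiv 𝓘(ℝ, E) 𝓘(ℝ, ℂ) u τ : E →L[ℝ] ℂ)
        = (mfderiv 𝓘(ℝ, E) 𝓘(ℝ, ℂ) u σ : E →L[ℝ] ℂ) := by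
      rintro τ rfl
      rfl
    rw [hc0]
    change (mfderiv 𝓘(ℝ, E) 𝓘(ℝ, ℂ) u (φ.symm (φ σ)) : E →L[ℝ] ℂ)
      ((mfderiv 𝓘(ℝ, E) 𝓘(ℝ, E) φ.symm (φ σ) : E →L[ℝ] E) w) = _
    rw [h5 _ (φ.left_inv hσφ)]
    exact congrArg (mfderiv 𝓘(ℝ, E) 𝓘(ℝ, ℂ) u σ : E →L[ℝ] ℂ) h4

/-- The Leibniz rule for the action of a family of operators on a family of functions. -/
theorem SmoothFamilyOn.vderiv_apply [FiniteDimensional ℝ E] [IsManifold 𝓘(ℝ, E) ∞ T] [T2Space T]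
    [FiniteDimensional ℝ F] [IsManifold 𝓘(ℝ, F) ∞ M] [T2Space M]
    {U : Set T} (hU : IsOpen U) {A : T → DiffOp F M} (hA : SmoothFamilyOn E U A)
    {g : T → SmoothFun F M} (hg : SmoothOver E F U (fun σ x => g σ x)) {σ : T} (hσ : σ ∈ U)
    (v : TangentSpace 𝓘(ℝ, E) σ) {g' : SmoothFun F M} (hg' : ∀ x, g' x = vderiv E g σ v x)
    (x : M) :
    vderiv E (fun τ => A τ (g τ)) σ v x = vderiv E (fun τ => A τ (g σ)) σ v x + A σ g' x := by
  obtain ⟨n, hn⟩ := hA.1 σ hσ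
  -- The claim is reduced to a curve with velocity `v`. The curve is kept in a neighbourhood where
  -- the order is bounded, because `deriv_apply` needs one bound for all parameters.
  obtain ⟨U', hU'1, hU'2, hσU'⟩ := mem_nhds_iff.1 (hn.and (hU.mem_nhds hσ))
  obtain ⟨γ, hγ, hγU, hγ0, hγd⟩ := exists_curve hU'2 hσU' v
  have hγo := hγ.contMDiffOn (s := Set.univ)
  have h1 := deriv_apply (n := n + 1) (A := fun s => (A (γ s)).toEnd) (g := fun s => g (γ s))
    (g' := g') (fun s => (hU'1 (hγU s)).1)
    (fun f => (hA.smoothOver_apply_const f).comp hγo fun s _ => (hU'1 (hγU s)).2)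
    (hg.comp hγo fun s _ => (hU'1 (hγU s)).2)
    (fun y => by rw [hg' y, hγd (fun τ => g τ y) (hg.mdifferentiableAt hU hσ y)]; rfl) x
  rw [hγ0, hγd (fun τ => A τ (g τ) x) ((hA.smoothOver_apply hU hg).mdifferentiableAt hU hσ x),
    hγd (fun τ => A τ (g σ) x) ((hA.smoothOver_apply_const (g σ)).mdifferentiableAt hU hσ x)] at h1
  exact h1

end Families

/-! ### The Poincaré lemma for operator-valued one-forms on a ball -/

section LocalPrimitive

variable {F : Type*} [NormedAddCommGroup F] [NormedSpace ℝ F]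
  {M : Type*} [TopologicalSpace M] [ChartedSpace F M]

/-- Integration of a curve of differential operators. -/
theorem HasOrderLT.exists_integral {n : ℕ} {h : ℝ → Module.End ℝ (SmoothFun F M)}
    (hn : ∀ t ∈ Set.Icc (0 : ℝ) 1, HasOrderLT n (h t))
    (hc : ∀ f x, ContinuousOn (fun t => h t f x) (Set.Icc 0 1))
    (hs : ∀ f, ContMDiff 𝓘(ℝ, F) 𝓘(ℝ, ℂ) ∞ (fun x => ∫ t in (0 : ℝ)..1, h t f x)) :
    ∃ A : Module.End ℝ (SmoothFun F M), HasOrderLT n A ∧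
      ∀ f x, A f x = ∫ t in (0 : ℝ)..1, h t f x := by
  have hi : ∀ {h : ℝ → Module.End ℝ (SmoothFun F M)},
      (∀ f x, ContinuousOn (fun t => h t f x) (Set.Icc 0 1)) → ∀ f x,
      IntervalIntegrable (fun t => h t f x) MeasureTheory.volume 0 1 := fun hc f x =>
    (hc f x).intervalIntegrable_of_Icc zero_le_one
  let A : Module.End ℝ (SmoothFun F M) :=
    { toFun := fun f => ⟨fun x => ∫ t in (0 : ℝ)..1, h t f x, hs f⟩
      map_add' := fun f g => by
        ext x
        refine Eq.trans ?_ (intervalIntegral.integral_add (hi hc f x) (hi hc g x))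
        refine intervalIntegral.integral_congr fun t _ => ?_
        simp only [map_add]
        rfl
      map_smul' := fun r f => by
        ext x
        refine Eq.trans ?_ (intervalIntegral.integral_smul r fun t => h t f x)
        refine intervalIntegral.integral_congr fun t _ => ?_
        simp only [map_smul]
        rfl }
  have hA : ∀ f x, A f x = ∫ t in (0 : ℝ)..1, h t f x := fun _ _ => rfl
  refine ⟨A, ?_, hA⟩
  -- The commutator of the integral with `g` is the integral of the commutators. The induction
  -- therefore concerns any operator satisfying the integral formula, and not the particular
  -- construction of `A`.
  clear_value A
  clear hs
  induction n generalizing A h with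
  | zero =>
    change A = 0
    ext f x
    rw [hA]
    refine (intervalIntegral.integral_congr (g := fun _ => (0 : ℂ)) fun t ht => ?_).trans
      intervalIntegral.integral_zero
    rw [Set.uIcc_of_le zero_le_one] at ht
    have h0 : h t = 0 := hn t ht
    simp only [h0]
    rfl
  | succ n ih =>
    intro g
    have hc' : ∀ f x, ContinuousOn (fun t => (h t * mulOp g - mulOp g * h t) f x)
        (Set.Icc 0 1) := fun f x =>
      (hc (g * f) x).sub (continuousOn_const.mul (hc f x))
    refine ih (h := fun t => h t * mulOp g - mulOp g * h t) (fun t ht => hn t ht g) hc' _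
      fun f x => ?_
    change A (g * f) x - g x * A f x = ∫ t in (0 : ℝ)..1, (h t (g * f) x - g x * h t f x)
    rw [hA, hA, intervalIntegral.integral_sub (hi hc _ x) ((hi hc f x).const_mul _),
      intervalIntegral.integral_const_mul]

variable {E : Type*} [NormedAddCommGroup E] [NormedSpace ℝ E]
  {T : Type*} [TopologicalSpace T] [ChartedSpace E T]

theorem SmoothFamilyOn.exists_hasOrderLE_of_isCompact {U : Set T} {A : T → DiffOp F M}
    (hA : SmoothFamilyOn E U A) {K : Set T} (hK : IsCompact K) (hKU : K ⊆ U) :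
    ∃ n, ∀ σ ∈ K, HasOrderLE n (A σ).toEnd := by
  refine hK.induction_on (p := fun s => ∃ n, ∀ σ ∈ s, HasOrderLE n (A σ).toEnd)
    ⟨0, fun σ hσ => hσ.elim⟩ ?_ ?_ ?_
  · rintro s t hst ⟨n, hn⟩
    exact ⟨n, fun σ hσ => hn σ (hst hσ)⟩
  · rintro s t ⟨m, hm⟩ ⟨n, hn⟩
    refine ⟨m + n, fun σ hσ => ?_⟩
    rcases hσ with hσ | hσ
    · exact HasOrderLT.mono (by omega) (hm σ hσ)
    · exact HasOrderLT.mono (by omega) (hn σ hσ)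
  · intro σ hσ
    obtain ⟨n, hn⟩ := hA.1 σ (hKU hσ)
    exact ⟨_, mem_nhdsWithin_of_mem_nhds hn, n, fun τ hτ => hτ⟩

variable {W : Type*} [NormedAddCommGroup W] [NormedSpace ℝ W]

theorem SmoothParamOn.contDiffOn_apply {O : Set W} {u : W → M → ℂ} (hu : SmoothParamOn F O u)
    (x : M) : ContDiffOn ℝ ∞ (fun s => u s x) O := by
  rw [← contMDiffOn_iff_contDiffOn]
  exact ContMDiffOn.comp hu (f := fun s : W => (s, x)) (contMDiffOn_id.prodMk contMDiffOn_const)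
    fun z hz => ⟨hz, trivial⟩

theorem SmoothParamOn.contMDiff {O : Set W} {u : W → M → ℂ} (hu : SmoothParamOn F O u) {z : W}
    (hz : z ∈ O) : ContMDiff 𝓘(ℝ, F) 𝓘(ℝ, ℂ) ∞ (u z) := by
  rw [← contMDiffOn_univ]
  exact ContMDiffOn.comp hu (f := fun x : M => (z, x))
    (contMDiff_const.prodMk contMDiff_id).contMDiffOn fun x _ => ⟨hz, trivial⟩

theorem smoothOver_iff_smoothParamOn {O : Set W} {u : W → M → ℂ} :
    SmoothOver W F O u ↔ SmoothParamOn F O u := Iff.rfl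

theorem exists_toEnd_eq {B : Module.End ℝ (SmoothFun F M)} (h : ∃ n, HasOrderLE n B) :
    ∃ A : DiffOp F M, A.toEnd = B := ⟨⟨B, h⟩, rfl⟩

/-- The Poincaré lemma for one-forms with values in `𝒟(M)` on a ball in a vector space. -/
theorem exists_primitive_ball [FiniteDimensional ℝ E] [FiniteDimensional ℝ F]
    [IsManifold 𝓘(ℝ, F) ∞ M] [T2Space M] {w₁ : E} {r : ℝ} (a : E → E →ₗ[ℝ] DiffOp F M)
    (hs : ∀ e, SmoothFamilyOn E (Metric.ball w₁ r) (fun w => a w e))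
    (hcl : ∀ w ∈ Metric.ball w₁ r, ∀ (e e' : E) (f : SmoothFun F M) (x : M),
      fderiv ℝ (fun w => a w e' f x) w e = fderiv ℝ (fun w => a w e f x) w e') :
    ∃ A : E → DiffOp F M, SmoothFamilyOn E (Metric.ball w₁ r) A ∧
      ∀ w ∈ Metric.ball w₁ r, ∀ (f : SmoothFun F M) (x : M),
        ∃ η : E →L[ℝ] ℂ, HasFDerivAt (fun w => A w f x) η w ∧ ∀ e, η e = a w e f x := by
  set O := Metric.ball w₁ r with hOdef
  have hO : IsOpen O := Metric.isOpen_ball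
  have hconv : Convex ℝ O := convex_ball _ _
  let b := Module.finBasis ℝ E
  let c : E × ℝ → E := fun q => AffineMap.lineMap w₁ q.1 q.2
  have hc : ContDiff ℝ ∞ c := by
    have : c = fun q : E × ℝ => q.2 • (q.1 - w₁) + w₁ := by
      funext q
      simp [c, AffineMap.lineMap_apply]
    rw [this]
    fun_prop
  -- The primitive is the radial one, `A_w = ∫₀¹ a_{c(w,t)}(w - w₁) dt`. The set `Ω` below is an
  -- open neighbourhood of the segments on which this integrand is smooth.
  let h : E × ℝ → Module.End ℝ (SmoothFun F M) := fun q => (a (c q) (q.1 - w₁)).toEnd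
  let Ω : Set (E × ℝ) := {q | q.1 ∈ O ∧ c q ∈ O}
  have hΩ : IsOpen Ω := (hO.preimage continuous_fst).inter (hO.preimage hc.continuous)
  have hcO : ∀ w ∈ O, ∀ t ∈ Set.Icc (0 : ℝ) 1, c (w, t) ∈ O := fun w hw t ht =>
    hconv.lineMap_mem (Metric.mem_ball_self (Metric.pos_of_mem_ball hw)) hw ht
  have hOΩ : ∀ w ∈ O, ∀ t ∈ Set.Icc (0 : ℝ) 1, (w, t) ∈ Ω := fun w hw t ht =>
    ⟨hw, hcO w hw t ht⟩
  have hexp : ∀ w e f x, a w e f x = ∑ i, ((b.repr e i : ℝ) : ℂ) * a w (b i) f x := by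
    intro w e f x
    conv_lhs => rw [← b.sum_repr e, map_sum, map_sum, LinearMap.sum_apply]
    refine (map_sum (ContMDiffMap.evalRingHom (I := 𝓘(ℝ, F)) (I' := 𝓘(ℝ, ℂ)) (n := ∞) x)
      _ _).trans (Finset.sum_congr rfl fun i _ => ?_)
    rw [map_smul, map_smul]
    exact Complex.real_smul
  have hh : ∀ f : E → SmoothFun F M, SmoothParamOn F O (fun w x => f w x) →
      SmoothParamOn F Ω (fun q x => h q (f q.1) x) := by
    intro f hf
    have h1 : ∀ i, SmoothParamOn F Ω (fun q x => a (c q) (b i) (f q.1) x) := fun i =>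
      (hs (b i)).smoothParamOn_apply hΩ (c := c) hc.contDiffOn.contMDiffOn (fun q hq => hq.2)
        (f := fun q => f q.1) (hf.comp contDiffOn_fst fun q hq => hq.1)
    have h2 : ∀ i, SmoothParamOn F Ω
        (fun q (_ : M) => ((b.repr (q.1 - w₁) i : ℝ) : ℂ)) := fun i => by
      have h3 : ContDiff ℝ ∞ fun q : E × ℝ => ((b.repr (q.1 - w₁) i : ℝ) : ℂ) :=
        (Complex.ofRealCLM.contDiff.comp
          (LinearMap.toContinuousLinearMap (b.coord i)).contDiff).comp
            (contDiff_fst.sub contDiff_const)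
      exact h3.contMDiff.comp_contMDiffOn contMDiffOn_fst
    have h3 : SmoothParamOn F Ω (fun q x => ∑ i, ((b.repr (q.1 - w₁) i : ℝ) : ℂ)
        * a (c q) (b i) (f q.1) x) :=
      contMDiffOn_finsetSum fun i _ => ContMDiffOn.mul (h2 i) (h1 i)
    exact h3.congr fun q _ x => hexp _ _ _ _
  have hint : ∀ f : E → SmoothFun F M, SmoothParamOn F O (fun w x => f w x) →
      SmoothParamOn F O (fun w x => ∫ t in (0 : ℝ)..1, h (w, t) (f w) x) := fun f hf =>
    (hh f hf).integral hΩ hO hOΩ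
  have hconst : ∀ f : SmoothFun F M, SmoothParamOn F O (fun (_ : E) x => f x) := fun f =>
    f.contMDiff.comp_contMDiffOn contMDiffOn_snd
  -- The order of `a` may be unbounded on the open ball, but on smaller closed balls it is bounded
  -- by compactness. These contain the segments from `w₁` to their points, hence the bound passes to
  -- the integral.
  have hcomp : ∀ R < r, ∃ n, ∀ w ∈ Metric.closedBall w₁ R, ∀ e, HasOrderLE n (a w e).toEnd := by
    intro R hR
    choose n hn using fun i => (hs (b i)).exists_hasOrderLE_of_isCompact
      (isCompact_closedBall w₁ R) (Metric.closedBall_subset_ball hR)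
    refine ⟨Finset.univ.sup n, fun w hw e => ?_⟩
    rw [← b.sum_repr e, map_sum, map_sum]
    refine Finset.sum_induction _ (fun B => HasOrderLE (Finset.univ.sup n) B)
      (fun _ _ => HasOrderLT.add) (HasOrderLT.zero _) fun i _ => ?_
    rw [map_smul, map_smul]
    refine HasOrderLT.smul (HasOrderLT.mono ?_ (hn i w hw)) _
    exact Nat.succ_le_succ (Finset.le_sup (Finset.mem_univ i))
  have hcR : ∀ R, ∀ w ∈ Metric.closedBall w₁ R, ∀ t ∈ Set.Icc (0 : ℝ) 1,
      c (w, t) ∈ Metric.closedBall w₁ R := fun R w hw t ht =>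
    (convex_closedBall w₁ R).lineMap_mem
      (Metric.mem_closedBall_self (dist_nonneg.trans (Metric.mem_closedBall.1 hw))) hw ht
  -- The operator `B` has to be chosen once for each `w`, while the local bound on its order depends
  -- on a radius `R`. The middle clause records all these bounds; they hold because the integral
  -- formula determines `B`.
  have hex : ∀ w ∈ O, ∃ B : Module.End ℝ (SmoothFun F M),
      (∃ n, HasOrderLE n B) ∧ (∀ R < r, ∀ n, w ∈ Metric.closedBall w₁ R →
        (∀ w ∈ Metric.closedBall w₁ R, ∀ e, HasOrderLE n (a w e).toEnd) → HasOrderLE n B) ∧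
      ∀ f x, B f x = ∫ t in (0 : ℝ)..1, h (w, t) f x := by
    intro w hw
    have hB : ∀ R < r, ∀ n, w ∈ Metric.closedBall w₁ R →
        (∀ w ∈ Metric.closedBall w₁ R, ∀ e, HasOrderLE n (a w e).toEnd) →
        ∃ B : Module.End ℝ (SmoothFun F M), HasOrderLE n B ∧
          ∀ f x, B f x = ∫ t in (0 : ℝ)..1, h (w, t) f x := by
      intro R hR n hwR hn
      refine HasOrderLT.exists_integral (h := fun t => h (w, t))
        (fun t ht => hn _ (hcR R w hwR t ht) _) (fun f x => ?_) fun f => ?_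
      · exact ((hh (fun _ => f) (hconst f)).contDiffOn_apply x).continuousOn.comp
          (f := fun t : ℝ => (w, t)) (by fun_prop) fun t ht => hOΩ w hw t ht
      · exact (hint (fun _ => f) (hconst f)).contMDiff hw
    obtain ⟨R, hR1, hR2⟩ := exists_between (Metric.mem_ball.1 hw)
    obtain ⟨n, hn⟩ := hcomp R hR2
    obtain ⟨B, hBn, hBi⟩ := hB R hR2 n (Metric.mem_closedBall.2 hR1.le) hn
    refine ⟨B, ⟨n, hBn⟩, fun R' hR' n' hw' hn' => ?_, hBi⟩
    obtain ⟨B', hBn', hBi'⟩ := hB R' hR' n' hw' hn'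
    have : B = B' := by
      ext f x
      rw [hBi, hBi']
    rwa [this]
  choose! B hB1 hB2 hB3 using hex
  choose! A hAB using fun w hw => exists_toEnd_eq (hB1 w hw)
  refine ⟨A, .intro (fun w hw => ?_) fun f => ?_, fun w hw f x => ?_⟩
  · obtain ⟨R, hR1, hR2⟩ := exists_between (Metric.mem_ball.1 hw)
    obtain ⟨n, hn⟩ := hcomp R hR2
    refine ⟨n, ?_⟩
    filter_upwards [Metric.isOpen_ball.mem_nhds (Metric.mem_ball.2 hR1)] with w' hw'
    have hw'O : w' ∈ O := Metric.ball_subset_ball hR2.le hw'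
    rw [hAB w' hw'O]
    exact hB2 w' hw'O R hR2 n (Metric.ball_subset_closedBall hw') hn
  · rw [smoothOver_iff_smoothParamOn]
    refine (hint (fun w => slice f w) (FamFun.smoothOver f O)).congr ?_
    intro w hw x
    rw [hAB w hw, hB3 w hw]
  -- For fixed `f` and `x` this is a scalar one-form. Closedness means that its derivative is
  -- symmetric, and its segment integral from `w₁` is `A w f x`, so the scalar Poincaré lemma gives
  -- the differential.
  · let η : E → E →L[ℝ] ℂ := fun w => LinearMap.toContinuousLinearMap
      { toFun := fun e => a w e f x
        map_add' := fun e e' => by rw [map_add, map_add]; rfl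
        map_smul' := fun s e => by rw [map_smul, map_smul]; rfl }
    have hηe : ∀ w e, η w e = a w e f x := fun _ _ => rfl
    have hηs : ContDiffOn ℝ ∞ η O := contDiffOn_clm_apply.2 fun e =>
      (smoothOver_iff_smoothParamOn.1 ((hs e).smoothOver_apply_const f)).contDiffOn_apply x
    have hηd : ∀ w ∈ O, HasFDerivAt η (fderiv ℝ η w) w := fun w hw =>
      ((hηs.differentiableOn (by simp)).differentiableAt (hO.mem_nhds hw)).hasFDerivAt
    have hsymm : ∀ w ∈ O, ∀ e e', fderiv ℝ η w e e' = fderiv ℝ η w e' e := by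
      have h1 : ∀ w ∈ O, ∀ e e', fderiv ℝ η w e e' = fderiv ℝ (fun w => a w e' f x) w e := by
        intro w hw e e'
        have h2 := (hηd w hw).clm_apply (hasFDerivAt_const e' w)
        change _ = fderiv ℝ (fun w => η w e') w e
        rw [h2.fderiv]
        simp
      intro w hw e e'
      rw [h1 w hw, h1 w hw]
      exact hcl w hw e e' f x
    have h3 := hconv.hasFDerivWithinAt_curveIntegral_segment_of_hasFDerivWithinAt_symmetric
      (fun w hw => (hηd w hw).hasFDerivWithinAt) (fun w hw e _ e' _ => hsymm w hw e e')
      (Metric.mem_ball_self (Metric.pos_of_mem_ball hw)) hw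
    refine ⟨η w, ?_, hηe w⟩
    refine (h3.hasFDerivAt (hO.mem_nhds hw)).congr_of_eventuallyEq ?_
    filter_upwards [hO.mem_nhds hw] with w' hw'
    rw [hAB w' hw', hB3 w' hw', curveIntegral_segment]
    rfl

end LocalPrimitive

/-! ### Chart balls, coordinate fields, and the Poincaré lemma on `T` -/

section ChartBall

variable {E : Type*} [NormedAddCommGroup E] [NormedSpace ℝ E]
  {T : Type*} [TopologicalSpace T] [ChartedSpace E T] [IsManifold 𝓘(ℝ, E) ∞ T]
  {F : Type*} [NormedAddCommGroup F] [NormedSpace ℝ F]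
  {M : Type*} [TopologicalSpace M] [ChartedSpace F M]

/-- Smoothness over `U` of a one-form with values in `𝒟(M)`. -/
def OpOneForm.IsSmoothOn (U : Set T) (α : OpOneForm E T F M) : Prop :=
  ∀ V : VField E T, SmoothFamilyOn E U (fun σ => α σ (V σ))

/-- `dα = 0` over `U`. -/
def OpOneForm.IsClosedOn (U : Set T) (α : OpOneForm E T F M) : Prop :=
  ∀ (V W : VField E T) (f : SmoothFun F M), ∀ σ ∈ U, ∀ x : M,
    vderiv E (fun τ => α τ (W τ) f) σ (V σ) x
    - vderiv E (fun τ => α τ (V τ) f) σ (W σ) x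
    - α σ (VectorField.mlieBracket 𝓘(ℝ, E) V W σ) f x = 0

/-- `α = dA` over `U`. -/
def OpOneForm.IsDifferentialOn (U : Set T) (α : OpOneForm E T F M) (A : T → DiffOp F M) : Prop :=
  ∀ σ ∈ U, ∀ (v : TangentSpace 𝓘(ℝ, E) σ) (f : SmoothFun F M) (x : M),
    α σ v f x = vderiv E (fun τ => A τ f) σ v x

variable (E) in
/-- The ball of radius `r` around `σ₁` in the preferred chart at `σ₁`. -/
def chartBall (σ₁ : T) (r : ℝ) : Set T :=
  (chartAt E σ₁).source ∩ chartAt E σ₁ ⁻¹' Metric.ball (chartAt E σ₁ σ₁) r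

/-- The constant vector field `e` on `E`. -/
def constField (e : E) (w : E) : TangentSpace 𝓘(ℝ, E) w := e

variable (E) in
/-- The vector field that is constant, equal to `e`, in the preferred chart at `σ₁`. -/
def coordField (σ₁ : T) (e : E) (σ : T) : TangentSpace 𝓘(ℝ, E) σ :=
  VectorField.mpullback 𝓘(ℝ, E) 𝓘(ℝ, E) (chartAt E σ₁) (constField e) σ

variable (E) in
/-- The chart ball is the preimage of a ball in the target of the chart, and the coordinate fields
have extensions to global fields. -/
structure IsAdapted (σ₁ : T) (r : ℝ) : Prop where
  pos : 0 < r
  subset_target : Metric.ball (chartAt E σ₁ σ₁) r ⊆ (chartAt E σ₁).target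
  exists_field : ∀ e : E, ∃ V : VField E T, ∀ σ ∈ chartBall E σ₁ r, V σ = coordField E σ₁ e σ

omit [NormedSpace ℝ E] [IsManifold 𝓘(ℝ, E) ∞ T] in
theorem isOpen_chartBall (σ₁ : T) (r : ℝ) : IsOpen (chartBall E σ₁ r) :=
  (chartAt E σ₁).isOpen_inter_preimage Metric.isOpen_ball

theorem mfderiv_chartAt_comp_symm {σ₁ σ : T} (hσ : σ ∈ (chartAt E σ₁).source) :
    (mfderiv 𝓘(ℝ, E) 𝓘(ℝ, E) (chartAt E σ₁) σ : E →L[ℝ] E) ∘L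
      (mfderiv 𝓘(ℝ, E) 𝓘(ℝ, E) (chartAt E σ₁).symm (chartAt E σ₁ σ) : E →L[ℝ] E)
      = ContinuousLinearMap.id ℝ E := by
  have : IsManifold 𝓘(ℝ, E) 1 T := IsManifold.of_le (n := ∞) (by simp)
  have h1 : ∀ τ, τ = σ → (mfderiv 𝓘(ℝ, E) 𝓘(ℝ, E) (chartAt E σ₁) τ : E →L[ℝ] E)
      = (mfderiv 𝓘(ℝ, E) 𝓘(ℝ, E) (chartAt E σ₁) σ : E →L[ℝ] E) := by
    rintro τ rfl
    rfl
  rw [← h1 _ ((chartAt E σ₁).left_inv hσ)]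
  exact (mdifferentiable_chart (I := 𝓘(ℝ, E)) σ₁).comp_symm_deriv
    ((chartAt E σ₁).map_source hσ)

theorem mfderiv_symm_comp_chartAt {σ₁ σ : T} (hσ : σ ∈ (chartAt E σ₁).source) :
    (mfderiv 𝓘(ℝ, E) 𝓘(ℝ, E) (chartAt E σ₁).symm (chartAt E σ₁ σ) : E →L[ℝ] E) ∘L
      (mfderiv 𝓘(ℝ, E) 𝓘(ℝ, E) (chartAt E σ₁) σ : E →L[ℝ] E)
      = ContinuousLinearMap.id ℝ E := by
  have : IsManifold 𝓘(ℝ, E) 1 T := IsManifold.of_le (n := ∞) (by simp)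
  exact (mdifferentiable_chart (I := 𝓘(ℝ, E)) σ₁).symm_comp_deriv hσ

theorem isInvertible_mfderiv_chartAt {σ₁ σ : T} (hσ : σ ∈ (chartAt E σ₁).source) :
    (mfderiv 𝓘(ℝ, E) 𝓘(ℝ, E) (chartAt E σ₁) σ).IsInvertible :=
  ContinuousLinearMap.IsInvertible.of_inverse (M := E) (M₂ := E) (mfderiv_chartAt_comp_symm hσ)
    (mfderiv_symm_comp_chartAt hσ)

theorem coordField_eq {σ₁ σ : T} (hσ : σ ∈ (chartAt E σ₁).source) (e : E) :
    coordField E σ₁ e σ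
      = (mfderiv 𝓘(ℝ, E) 𝓘(ℝ, E) (chartAt E σ₁).symm (chartAt E σ₁ σ) : E →L[ℝ] E) e :=
  congrArg (fun L : E →L[ℝ] E => L e) (ContinuousLinearMap.inverse_eq (M := E) (M₂ := E)
    (mfderiv_chartAt_comp_symm hσ) (mfderiv_symm_comp_chartAt hσ))

theorem contMDiff_constField (e : E) :
    ContMDiff 𝓘(ℝ, E) (𝓘(ℝ, E)).tangent ∞
      (fun w => (⟨w, constField e w⟩ : TangentBundle 𝓘(ℝ, E) E)) :=
  (contMDiff_vectorSpace_iff_contDiff (V := constField e)).2 contDiff_const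

theorem mlieBracket_constField (e e' : E) :
    VectorField.mlieBracket 𝓘(ℝ, E) (constField e) (constField e') = 0 := by
  have h : VectorField.lieBracketWithin ℝ (fun _ : E => e) (fun _ : E => e') Set.univ = 0 := by
    funext w
    simp [VectorField.lieBracketWithin]
  rw [← VectorField.mlieBracketWithin_univ, VectorField.mlieBracketWithin_eq_lieBracketWithin]
  exact h

theorem contMDiffAt_coordField [CompleteSpace E] {σ₁ σ : T} (hσ : σ ∈ (chartAt E σ₁).source)
    (e : E) :
    ContMDiffAt 𝓘(ℝ, E) (𝓘(ℝ, E)).tangent ∞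
      (fun τ => (⟨τ, coordField E σ₁ e τ⟩ : TangentBundle 𝓘(ℝ, E) T)) σ := by
  refine ContMDiffAt.mpullback_vectorField_preimage (n := ∞)
    (contMDiff_constField e).contMDiffAt
    (contMDiffOn_chart.contMDiffAt ((chartAt E σ₁).open_source.mem_nhds hσ))
    (isInvertible_mfderiv_chartAt hσ) (by simp)

/-- Constant fields commute and pull-back preserves brackets. As a consequence the bracket term in
`dα` drops out for coordinate fields, and closedness becomes symmetry of the derivative in the
chart. -/
theorem mlieBracket_coordField [CompleteSpace E] {σ₁ σ : T} (hσ : σ ∈ (chartAt E σ₁).source)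
    (e e' : E) :
    VectorField.mlieBracket 𝓘(ℝ, E) (coordField E σ₁ e) (coordField E σ₁ e') σ = 0 := by
  have : IsManifold 𝓘(ℝ, E) (minSmoothness ℝ 2) T := by
    rw [minSmoothness_of_isRCLikeNormedField]
    exact IsManifold.of_le (n := ∞) ENat.LEInfty.out
  have hd : ∀ e : E, MDifferentiableAt 𝓘(ℝ, E) (𝓘(ℝ, E)).tangent
      (fun w => (⟨w, constField e w⟩ : TangentBundle 𝓘(ℝ, E) E)) (chartAt E σ₁ σ) := fun e =>
    (contMDiff_constField e).contMDiffAt.mdifferentiableAt (by simp)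
  have h := VectorField.mpullback_mlieBracket (n := ∞) (hd e) (hd e')
    (contMDiffOn_chart.contMDiffAt ((chartAt E σ₁).open_source.mem_nhds hσ)) (by
      rw [minSmoothness_of_isRCLikeNormedField]; exact ENat.LEInfty.out)
  rw [mlieBracket_constField, VectorField.mpullback_zero] at h
  exact h.symm

/-- Smoothness and closedness of forms are tested on global vector fields only. A coordinate field
becomes global after multiplication by a bump function, and the radius is chosen so that this
function is `1` on the ball. -/
theorem exists_isAdapted [FiniteDimensional ℝ E] [T2Space T] {σ₁ : T} {U : Set T}
    (hU : U ∈ 𝓝 σ₁) :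
    ∃ r, IsAdapted E σ₁ r ∧ chartBall E σ₁ r ⊆ U := by
  have : CompleteSpace E := FiniteDimensional.complete ℝ E
  obtain ⟨χ, -⟩ := (SmoothBumpFunction.nhds_basis_tsupport (I := 𝓘(ℝ, E)) σ₁).ex_mem
  set φ := chartAt E σ₁ with hφ
  have hσ : σ₁ ∈ φ.source := mem_chart_source E σ₁
  have h1 : ∀ᶠ w in 𝓝 (φ σ₁), w ∈ φ.target ∧ χ (φ.symm w) = 1 ∧ φ.symm w ∈ U := by
    have h2 : Filter.Tendsto φ.symm (𝓝 (φ σ₁)) (𝓝 σ₁) := by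
      have := φ.continuousAt_symm (φ.map_source hσ)
      rwa [ContinuousAt, φ.left_inv hσ] at this
    exact (φ.open_target.eventually_mem (φ.map_source hσ)).and
      ((h2.eventually χ.eventuallyEq_one).and (h2.eventually hU))
  obtain ⟨r, hr, hsub⟩ := Metric.nhds_basis_ball.mem_iff.1 h1
  refine ⟨r, ⟨hr, fun w hw => (hsub hw).1, fun e => ?_⟩, ?_⟩
  · have h3 : ContMDiff 𝓘(ℝ, E) (𝓘(ℝ, E)).tangent ∞
        (fun τ => (⟨τ, ((χ : T → ℝ) • coordField E σ₁ e : ∀ σ, TangentSpace 𝓘(ℝ, E) σ) τ⟩ :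
          TangentBundle 𝓘(ℝ, E) T)) := by
      refine ContMDiffOn.smul_section_of_tsupport χ.contMDiff.contMDiffOn φ.open_source
        χ.tsupport_subset_chartAt_source fun σ hσ => (contMDiffAt_coordField hσ e).contMDiffWithinAt
    refine ⟨⟨_, h3⟩, ?_⟩
    rintro σ ⟨hσ1, hσ2⟩
    have h4 := (hsub hσ2).2.1
    rw [φ.left_inv hσ1] at h4
    change χ σ • coordField E σ₁ e σ = _
    rw [h4, one_smul]
  · rintro σ ⟨hσ1, hσ2⟩
    have h4 := (hsub hσ2).2.2
    rwa [φ.left_inv hσ1] at h4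

/-- The Poincaré lemma on a chart ball. -/
theorem IsAdapted.exists_primitive [FiniteDimensional ℝ E] [T2Space T] [FiniteDimensional ℝ F]
    [IsManifold 𝓘(ℝ, F) ∞ M] [T2Space M] {σ₁ : T} {r : ℝ} (h : IsAdapted E σ₁ r)
    {α : OpOneForm E T F M} (hs : α.IsSmoothOn (chartBall E σ₁ r))
    (hc : α.IsClosedOn (chartBall E σ₁ r)) :
    ∃ A : T → DiffOp F M, SmoothFamilyOn E (chartBall E σ₁ r) A ∧
      α.IsDifferentialOn (chartBall E σ₁ r) A := by
  have : CompleteSpace E := FiniteDimensional.complete ℝ E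
  have : IsManifold 𝓘(ℝ, E) 1 T := IsManifold.of_le (n := ∞) (by simp)
  set φ := chartAt E σ₁ with hφ
  set O := Metric.ball (φ σ₁) r with hOdef
  have hO : IsOpen O := Metric.isOpen_ball
  have hmem : Set.MapsTo φ.symm O (chartBall E σ₁ r) := fun w hw =>
    ⟨φ.map_target (h.subset_target hw), by
      rw [Set.mem_preimage, ← hφ, φ.right_inv (h.subset_target hw)]; exact hw⟩
  have hsymm : ContMDiffOn 𝓘(ℝ, E) 𝓘(ℝ, E) ∞ φ.symm O :=
    contMDiffOn_chart_symm.mono h.subset_target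
  choose V hV using h.exists_field
  -- The form `α` read in the chart. With the inverse of the derivative of `φ`, the value `a w e` is
  -- by definition `α` on the coordinate field `e` at `φ.symm w`.
  let a : E → E →ₗ[ℝ] DiffOp F M := fun w => (α (φ.symm w)).comp
    ((mfderiv 𝓘(ℝ, E) 𝓘(ℝ, E) φ (φ.symm w)).inverse : E →L[ℝ] E).toLinearMap
  have ha : ∀ w ∈ O, ∀ e, a w e = α (φ.symm w) (V e (φ.symm w)) := fun w hw e => by
    rw [hV e _ (hmem hw)]
    rfl
  have has : ∀ e, SmoothFamilyOn E O (fun w => a w e) := by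
    intro e
    refine SmoothFamilyOn.congr hO (A := fun w => α (φ.symm w) (V e (φ.symm w))) ?_
      fun w hw => ha w hw e
    refine .intro (fun w hw => ?_) fun f => ?_
    · obtain ⟨n, hn⟩ := (hs (V e)).1 _ (hmem hw)
      exact ⟨n, (hsymm.continuousOn.continuousAt (hO.mem_nhds hw)).eventually hn⟩
    · rw [smoothOver_iff_smoothParamOn]
      exact (hs (V e)).smoothParamOn_apply hO hsymm hmem (FamFun.smoothOver f O)
  have hd : ∀ w ∈ O, ∀ (e e' : E) (f : SmoothFun F M) (x : M),
      fderiv ℝ (fun w => a w e' f x) w e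
        = vderiv E (fun τ => α τ (V e' τ) f) (φ.symm w) (V e (φ.symm w)) x := by
    intro w hw e e' f x
    have hwt := h.subset_target hw
    have h1 : (fun w => a w e' f x) =ᶠ[𝓝 w]
        (fun τ => α τ (V e' τ) f x) ∘ φ.symm := by
      filter_upwards [hO.mem_nhds hw] with w' hw'
      rw [Function.comp_apply, ha w' hw']
    have h2 : MDifferentiableAt 𝓘(ℝ, E) 𝓘(ℝ, ℂ) (fun τ => α τ (V e' τ) f x) (φ.symm w) :=
      ((hs (V e')).smoothOver_apply_const f).mdifferentiableAt (isOpen_chartBall σ₁ r) (hmem hw) x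
    let L : E →L[ℝ] ℂ :=
      (mfderiv 𝓘(ℝ, E) 𝓘(ℝ, ℂ) (fun τ => α τ (V e' τ) f x) (φ.symm w) : E →L[ℝ] ℂ) ∘L
        (mfderiv 𝓘(ℝ, E) 𝓘(ℝ, E) φ.symm w : E →L[ℝ] E)
    have h3 : HasFDerivAt ((fun τ => α τ (V e' τ) f x) ∘ φ.symm) L w :=
      (h2.hasMFDerivAt.comp w ((mdifferentiable_chart (I := 𝓘(ℝ, E)) σ₁).mdifferentiableAt_symm
        hwt).hasMFDerivAt).hasFDerivAt
    rw [h1.fderiv_eq, h3.fderiv]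
    have h4 : V e (φ.symm w) = (mfderiv 𝓘(ℝ, E) 𝓘(ℝ, E) φ.symm w : E →L[ℝ] E) e := by
      rw [hV e _ (hmem hw), coordField_eq (hmem hw).1, ← hφ, φ.right_inv hwt]
    unfold vderiv
    rw [h4]
    rfl
  obtain ⟨A, hA, hAd⟩ := exists_primitive_ball a has fun w hw e e' f x => by
    have h1 := hc (V e) (V e') f _ (hmem hw) x
    -- The global extensions agree with the coordinate fields on an open set, and the bracket is
    -- local.
    have h2 : VectorField.mlieBracket 𝓘(ℝ, E) (V e) (V e') (φ.symm w) = 0 := by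
      have h3 : ∀ e, (V e : ∀ σ : T, TangentSpace 𝓘(ℝ, E) σ) =ᶠ[𝓝 (φ.symm w)]
          coordField E σ₁ e := fun e => by
        filter_upwards [(isOpen_chartBall σ₁ r).mem_nhds (hmem hw)] with τ hτ
        exact hV e τ hτ
      rw [(h3 e).mlieBracket_vectorField_eq (h3 e'), mlieBracket_coordField (hmem hw).1]
    rw [h2, map_zero, map_zero] at h1
    rw [hd w hw, hd w hw]
    exact sub_eq_zero.1 ((sub_zero _).symm.trans h1)
  have hφs : ContMDiffOn 𝓘(ℝ, E) 𝓘(ℝ, E) ∞ φ (chartBall E σ₁ r) :=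
    contMDiffOn_chart.mono Set.inter_subset_left
  have hφm : Set.MapsTo φ (chartBall E σ₁ r) O := fun σ hσ => hσ.2
  refine ⟨fun σ => A (φ σ), .intro (fun σ hσ => ?_) fun f => ?_, fun σ hσ v f x => ?_⟩
  · obtain ⟨n, hn⟩ := hA.1 _ (hφm hσ)
    exact ⟨n, (hφs.continuousOn.continuousAt ((isOpen_chartBall σ₁ r).mem_nhds hσ)).eventually hn⟩
  · have h1 : SmoothParamOn F O (fun w x => A w (slice f (φ.symm w)) x) :=
      hA.smoothParamOn_apply hO (c := id) contMDiffOn_id (fun w hw => hw)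
        ((FamFun.smoothOver f _).comp hsymm hmem)
    refine (h1.smoothOver hφs hφm).congr fun σ hσ x => ?_
    rw [φ.left_inv hσ.1]
  · obtain ⟨η, hη, hηe⟩ := hAd _ (hφm hσ) f x
    have h1 := (mdifferentiable_chart (I := 𝓘(ℝ, E)) σ₁).mdifferentiableAt hσ.1
    have h2 := (HasMFDerivAt.comp σ hη.hasMFDerivAt h1.hasMFDerivAt).mfderiv
    have h3 : ∀ τ, τ = σ → ∀ e : E,
        α τ ((mfderiv 𝓘(ℝ, E) 𝓘(ℝ, E) φ τ).inverse e : E)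
        = α σ ((mfderiv 𝓘(ℝ, E) 𝓘(ℝ, E) φ σ).inverse e : E) := by
      rintro τ rfl e
      rfl
    have h4 := hηe (mfderiv 𝓘(ℝ, E) 𝓘(ℝ, E) φ σ v)
    have h5 : a (φ σ) (mfderiv 𝓘(ℝ, E) 𝓘(ℝ, E) φ σ v) = α σ v := by
      refine (h3 _ (φ.left_inv hσ.1) _).trans (congrArg (α σ) ?_)
      obtain ⟨L, hL⟩ := isInvertible_mfderiv_chartAt (E := E) hσ.1
      rw [← hφ] at hL
      rw [← hL, ContinuousLinearMap.inverse_equiv]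
      exact L.symm_apply_apply v
    rw [h5] at h4
    rw [← h4]
    exact (congrArg (fun L : E →L[ℝ] ℂ => L v) h2).symm

end ChartBall

/-! ### Global primitives when `H¹(T, ℝ) = 0` -/

section GlobalPrimitive

variable {E : Type*} [NormedAddCommGroup E] [NormedSpace ℝ E]
  {T : Type*} [TopologicalSpace T] [ChartedSpace E T]
  {F : Type*} [NormedAddCommGroup F] [NormedSpace ℝ F]
  {M : Type*} [TopologicalSpace M] [ChartedSpace F M]

theorem DiffOp.ext {A B : DiffOp F M} (h : ∀ f x, A f x = B f x) : A = B :=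
  Subtype.ext (LinearMap.ext fun f => ContMDiffMap.ext fun x => h f x)

/-- Smoothness has to be tested on functions that vary with the point of `T`. Even for a constant
family this is the action of an operator on functions with parameters, obtained in charts of `T`
from `smoothParamOn_apply`. -/
theorem smoothFamilyOn_const [IsManifold 𝓘(ℝ, E) ∞ T] [FiniteDimensional ℝ E]
    [FiniteDimensional ℝ F] [IsManifold 𝓘(ℝ, F) ∞ M] [T2Space M] (U : Set T) (A : DiffOp F M) :
    SmoothFamilyOn E U (fun _ => A) := by
  refine SmoothFamilyOn.const U A fun f => SmoothOver.of_locally fun σ _ => ?_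
  obtain ⟨n, hn⟩ := A.2
  set φ := chartAt E σ
  have h1 : SmoothParamOn F φ.target (fun w x => A (slice f (φ.symm w)) x) :=
    smoothParamOn_apply φ.open_target (A := fun _ => A.toEnd) (fun _ _ => hn)
      (fun k => (A k).contMDiff.comp_contMDiffOn contMDiffOn_snd)
      ((FamFun.smoothOver f Set.univ).comp contMDiffOn_chart_symm (Set.mapsTo_univ _ _))
  refine ⟨φ.source, φ.open_source.mem_nhds (mem_chart_source E σ),
    (h1.smoothOver contMDiffOn_chart φ.mapsTo).congr fun τ hτ x => ?_⟩
  rw [φ.left_inv hτ]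

omit [NormedSpace ℝ E] in
theorem chartBall_eq_image {σ₁ : T} {r : ℝ}
    (h : Metric.ball (chartAt E σ₁ σ₁) r ⊆ (chartAt E σ₁).target) :
    chartBall E σ₁ r = (chartAt E σ₁).symm '' Metric.ball (chartAt E σ₁ σ₁) r := by
  ext σ
  constructor
  · rintro ⟨h1, h2⟩
    exact ⟨_, h2, (chartAt E σ₁).left_inv h1⟩
  · rintro ⟨w, hw, rfl⟩
    refine ⟨(chartAt E σ₁).map_target (h hw), ?_⟩
    rw [Set.mem_preimage, (chartAt E σ₁).right_inv (h hw)]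
    exact hw

theorem isPreconnected_chartBall {σ₁ : T} {r : ℝ}
    (h : Metric.ball (chartAt E σ₁ σ₁) r ⊆ (chartAt E σ₁).target) :
    IsPreconnected (chartBall E σ₁ r) := by
  rw [chartBall_eq_image h]
  exact (convex_ball _ _).isPreconnected.image _ ((chartAt E σ₁).continuousOn_symm.mono h)

/-- Functions on a chart ball with vanishing derivative are constant. -/
theorem eq_of_hasMFDerivAt_zero [IsManifold 𝓘(ℝ, E) ∞ T] {σ₁ : T} {r : ℝ}
    (h : Metric.ball (chartAt E σ₁ σ₁) r ⊆ (chartAt E σ₁).target) {u : T → ℂ}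
    (hu : ∀ σ ∈ chartBall E σ₁ r, MDifferentiableAt 𝓘(ℝ, E) 𝓘(ℝ, ℂ) u σ)
    (hu0 : ∀ σ ∈ chartBall E σ₁ r, ∀ v : TangentSpace 𝓘(ℝ, E) σ,
      (mfderiv 𝓘(ℝ, E) 𝓘(ℝ, ℂ) u σ v : ℂ) = 0)
    {σ τ : T} (hσ : σ ∈ chartBall E σ₁ r) (hτ : τ ∈ chartBall E σ₁ r) : u σ = u τ := by
  have : IsManifold 𝓘(ℝ, E) 1 T := IsManifold.of_le (n := ∞) (by simp)
  set φ := chartAt E σ₁ with hφ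
  have hd : ∀ w ∈ Metric.ball (φ σ₁) r, HasFDerivAt (u ∘ φ.symm) (0 : E →L[ℝ] ℂ) w := by
    intro w hw
    have hm : φ.symm w ∈ chartBall E σ₁ r := by
      rw [chartBall_eq_image h]
      exact ⟨w, hw, rfl⟩
    let L : E →L[ℝ] ℂ := (mfderiv 𝓘(ℝ, E) 𝓘(ℝ, ℂ) u (φ.symm w) : E →L[ℝ] ℂ) ∘L
        (mfderiv 𝓘(ℝ, E) 𝓘(ℝ, E) φ.symm w : E →L[ℝ] E)
    have h3 : HasFDerivAt (u ∘ φ.symm) L w :=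
      ((hu _ hm).hasMFDerivAt.comp w ((mdifferentiable_chart (I := 𝓘(ℝ, E))
        σ₁).mdifferentiableAt_symm (h hw)).hasMFDerivAt).hasFDerivAt
    have h4 : L = 0 := by
      ext e
      exact hu0 _ hm _
    rwa [h4] at h3
  have h5 := (convex_ball (φ σ₁) r).is_const_of_fderivWithin_eq_zero (𝕜 := ℝ) (f := u ∘ φ.symm)
    (fun w hw => (hd w hw).differentiableAt.differentiableWithinAt)
    (fun w hw => by
      rw [fderivWithin_of_isOpen Metric.isOpen_ball hw, (hd w hw).fderiv]) hσ.2 hτ.2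
  change u (φ.symm (φ σ)) = u (φ.symm (φ τ)) at h5
  rwa [φ.left_inv hσ.1, φ.left_inv hτ.1] at h5

variable [IsManifold 𝓘(ℝ, E) ∞ T]

theorem mem_exactOneForms (h : Subsingleton (DeRhamH1 E T)) {β : RealOneForm E T}
    (hβ : β ∈ closedOneForms E T) : β ∈ exactOneForms E T := by
  have h1 : (⟨β, hβ⟩ : closedOneForms E T) ∈
      (exactOneForms E T).submoduleOf (closedOneForms E T) :=
    (Submodule.Quotient.mk_eq_zero _).1 (Subsingleton.elim _ _)
  exact h1

omit [IsManifold 𝓘(ℝ, E) ∞ T] in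
theorem rderiv_clm_comp {u : T → ℂ} {σ : T} (hu : MDifferentiableAt 𝓘(ℝ, E) 𝓘(ℝ, ℂ) u σ)
    (L : ℂ →L[ℝ] ℝ) (v : TangentSpace 𝓘(ℝ, E) σ) :
    rderiv (fun τ => L (u τ)) σ v = L (mfderiv 𝓘(ℝ, E) 𝓘(ℝ, ℂ) u σ v : ℂ) := by
  have h := (HasMFDerivAt.comp σ L.hasMFDerivAt hu.hasMFDerivAt).mfderiv
  exact congrArg (fun K : E →L[ℝ] ℝ => K v) h

variable {α : OpOneForm E T F M}

/-- The components of a closed form are exact if `H¹(T, ℝ) = 0`. -/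
theorem exists_real_primitive (h : Subsingleton (DeRhamH1 E T)) (hs : α.IsSmoothOn Set.univ)
    (hc : α.IsClosedOn Set.univ) (L : ℂ →L[ℝ] ℝ) (f : SmoothFun F M) (x : M) :
    ∃ g : C^∞⟮𝓘(ℝ, E), T; 𝓘(ℝ, ℝ), ℝ⟯, ∀ (σ : T) (v : TangentSpace 𝓘(ℝ, E) σ),
      L (α σ v f x) = rderiv g σ v := by
  let β : RealOneForm E T := fun σ =>
    { toFun := fun v => L (α σ v f x)
      map_add' := fun v w => by
        rw [map_add, map_add]
        exact map_add L _ _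
      map_smul' := fun r v => by
        rw [map_smul, map_smul]
        exact map_smul L _ _ }
  refine mem_exactOneForms h (β := β) ⟨fun V => ?_, fun V W σ => ?_⟩
  · have h1 : ContMDiff 𝓘(ℝ, E) 𝓘(ℝ, ℂ) ∞ (fun τ => α τ (V τ) f x) := by
      rw [← contMDiffOn_univ]
      exact ContMDiffOn.comp ((hs V).smoothOver_apply_const f) (f := fun τ : T => (τ, x))
        (contMDiffOn_id.prodMk contMDiffOn_const) fun _ _ => ⟨trivial, trivial⟩
    exact L.contDiff.contMDiff.comp h1
  · have hd : ∀ V : VField E T, MDifferentiableAt 𝓘(ℝ, E) 𝓘(ℝ, ℂ) (fun τ => α τ (V τ) f x) σ :=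
      fun V => (hs V).mdifferentiableAt f σ x
    have h1 := congrArg L (hc V W f σ trivial x)
    rw [map_sub, map_sub, map_zero] at h1
    rw [← h1]
    exact congrArg₂ (fun a b => a - b - L (α σ (VectorField.mlieBracket 𝓘(ℝ, E) V W σ) f x))
      (rderiv_clm_comp (hd W) L (V σ)) (rderiv_clm_comp (hd V) L (W σ))

theorem exists_complex_primitive (h : Subsingleton (DeRhamH1 E T)) (hs : α.IsSmoothOn Set.univ)
    (hc : α.IsClosedOn Set.univ) (f : SmoothFun F M) (x : M) :
    ∃ g : T → ℂ, ∀ σ : T, MDifferentiableAt 𝓘(ℝ, E) 𝓘(ℝ, ℂ) g σ ∧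
      ∀ v : TangentSpace 𝓘(ℝ, E) σ, α σ v f x = mfderiv 𝓘(ℝ, E) 𝓘(ℝ, ℂ) g σ v := by
  obtain ⟨g, hg⟩ := exists_real_primitive h hs hc Complex.reCLM f x
  obtain ⟨k, hk⟩ := exists_real_primitive h hs hc Complex.imCLM f x
  let K : ℝ →L[ℝ] ℂ := Complex.ofRealCLM
  let J : ℝ →L[ℝ] ℂ := Complex.I • Complex.ofRealCLM
  have hK : ∀ σ, HasMFDerivAt 𝓘(ℝ, E) 𝓘(ℝ, ℂ) (fun τ => K (g τ) + J (k τ)) σ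
      (K ∘L (mfderiv 𝓘(ℝ, E) 𝓘(ℝ, ℝ) g σ : E →L[ℝ] ℝ)
        + J ∘L (mfderiv 𝓘(ℝ, E) 𝓘(ℝ, ℝ) k σ : E →L[ℝ] ℝ)) := fun σ =>
    (HasMFDerivAt.comp σ K.hasMFDerivAt (g.mdifferentiableAt (x := σ)).hasMFDerivAt).add
      (HasMFDerivAt.comp σ J.hasMFDerivAt (k.mdifferentiableAt (x := σ)).hasMFDerivAt)
  refine ⟨fun τ => K (g τ) + J (k τ), fun σ => ⟨(hK σ).mdifferentiableAt, fun v => ?_⟩⟩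
  rw [(hK σ).mfderiv]
  have e1 : (α σ v f x).re = rderiv g σ v := hg σ v
  have e2 : (α σ v f x).im = rderiv k σ v := hk σ v
  change _ = ((rderiv g σ v : ℝ) : ℂ) + Complex.I * ((rderiv k σ v : ℝ) : ℂ)
  rw [← e1, ← e2, mul_comm Complex.I]
  exact (Complex.re_add_im _).symm

/-- If `H¹(T, ℝ) = 0`, then closed one-forms with values in `𝒟(M)` are exact. -/
theorem exists_primitive_of_deRhamH1 [FiniteDimensional ℝ E] [T2Space T] [FiniteDimensional ℝ F]
    [IsManifold 𝓘(ℝ, F) ∞ M] [T2Space M] (h : Subsingleton (DeRhamH1 E T))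
    (hs : α.IsSmoothOn Set.univ) (hc : α.IsClosedOn Set.univ) :
    ∃ A : T → DiffOp F M, SmoothFamilyOn E Set.univ A ∧ α.IsDifferentialOn Set.univ A := by
  -- The scalar primitives are chosen separately for each `f` and `x`. Their constants of
  -- integration are arbitrary, and nothing yet makes `g f x` linear in `f` or smooth in `x`.
  choose g hgd hg using exists_complex_primitive h hs hc
  -- One base point in each connected component. Subtracting the value there removes the arbitrary
  -- constants.
  let base : T → T := fun σ => Quotient.out (ConnectedComponents.mk σ)
  have hbase : ∀ σ, ConnectedComponents.mk (base σ) = ConnectedComponents.mk σ := fun σ =>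
    Quotient.out_eq (ConnectedComponents.mk σ)
  have hbb : ∀ σ, base (base σ) = base σ := fun σ => by
    change Quotient.out (ConnectedComponents.mk (base σ)) = _
    rw [hbase]
  let a : SmoothFun F M → M → T → ℂ := fun f x σ => g f x σ - g f x (base σ)
  -- On a chart ball, which is connected, the normalized scalar primitives and an operator-valued
  -- local primitive `B` have the same differential. Their increments between two points of the ball
  -- are therefore equal.
  have hloc : ∀ σ₁ : T, ∃ r, IsAdapted E σ₁ r ∧ ∃ B : T → DiffOp F M,
      SmoothFamilyOn E (chartBall E σ₁ r) B ∧
      ∀ σ ∈ chartBall E σ₁ r, ∀ τ ∈ chartBall E σ₁ r, base σ = base τ ∧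
        ∀ f x, a f x τ - a f x σ = B τ f x - B σ f x := by
    intro σ₁
    obtain ⟨r, hr, -⟩ := exists_isAdapted (E := E) (Filter.univ_mem : Set.univ ∈ 𝓝 σ₁)
    obtain ⟨B, hB, hBd⟩ := hr.exists_primitive (α := α)
      (fun V => (hs V).mono (Set.subset_univ _)) fun V W f σ _ x => hc V W f σ trivial x
    refine ⟨r, hr, B, hB, fun σ hσ τ hτ => ?_⟩
    have e : base σ = base τ := by
      have h1 : ConnectedComponents.mk σ = ConnectedComponents.mk τ := by
        rw [ConnectedComponents.coe_eq_coe]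
        exact connectedComponent_eq ((isPreconnected_chartBall
          hr.subset_target).subset_connectedComponent hσ hτ)
      change Quotient.out (ConnectedComponents.mk σ) = _
      rw [h1]
    refine ⟨e, fun f x => ?_⟩
    have hBm : ∀ σ ∈ chartBall E σ₁ r, MDifferentiableAt 𝓘(ℝ, E) 𝓘(ℝ, ℂ) (fun τ => B τ f x) σ :=
      fun σ hσ => (hB.smoothOver_apply_const f).mdifferentiableAt (isOpen_chartBall σ₁ r) hσ x
    have h2 := eq_of_hasMFDerivAt_zero hr.subset_target (u := fun τ => g f x τ - B τ f x)
      (fun σ hσ => (hgd f x σ).sub (hBm σ hσ)) (fun σ hσ v => by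
        have h3 := ((hgd f x σ).hasMFDerivAt.sub (hBm σ hσ).hasMFDerivAt).mfderiv
        refine (congrArg (fun L : E →L[ℝ] ℂ => L v) h3).trans ?_
        exact (sub_eq_zero (G := ℂ)).2 ((hg f x σ v).symm.trans (hBd σ hσ v f x))) hσ hτ
    simp only [a, e]
    linear_combination -h2
  -- By `hloc`, the set of points at which the scalars `a f x σ` are the values of a differential
  -- operator is open and closed. At a base point that operator is `0`, so the set meets every
  -- component.
  have hgood : ∀ σ, ∃ K : DiffOp F M, ∀ f x, K f x = a f x σ := by
    have hstep : ∀ σ₁ : T, ∃ B ∈ 𝓝 σ₁, ∀ σ ∈ B, ∀ τ ∈ B,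
        (∃ K : DiffOp F M, ∀ f x, K f x = a f x σ) →
        ∃ K : DiffOp F M, ∀ f x, K f x = a f x τ := by
      intro σ₁
      obtain ⟨r, hr, B, hB, hBa⟩ := hloc σ₁
      refine ⟨chartBall E σ₁ r, (isOpen_chartBall σ₁ r).mem_nhds
        ⟨mem_chart_source E σ₁, Metric.mem_ball_self hr.pos⟩, fun σ hσ τ hτ ⟨K, hK⟩ =>
        ⟨K + (B τ - B σ), fun f x => ?_⟩⟩
      rw [map_add, map_sub]
      change K f x + (B τ f x - B σ f x) = _
      rw [← (hBa σ hσ τ hτ).2, hK]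
      ring
    have hclopen : IsClopen {σ | ∃ K : DiffOp F M, ∀ f x, K f x = a f x σ} := by
      constructor
      · rw [← isOpen_compl_iff, isOpen_iff_mem_nhds]
        intro σ hσ
        obtain ⟨B, hB, hBs⟩ := hstep σ
        filter_upwards [hB] with τ hτ hK
        exact hσ (hBs τ hτ σ (mem_of_mem_nhds hB) hK)
      · rw [isOpen_iff_mem_nhds]
        intro σ hσ
        obtain ⟨B, hB, hBs⟩ := hstep σ
        filter_upwards [hB] with τ hτ
        exact hBs σ (mem_of_mem_nhds hB) τ hτ hσ
    intro σ
    refine hclopen.connectedComponent_subset (x := base σ) ⟨0, fun f x => ?_⟩ ?_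
    · rw [map_zero]
      simp only [a, hbb, sub_self]
      rfl
    · rw [ConnectedComponents.coe_eq_coe.1 (hbase σ)]
      exact mem_connectedComponent
  choose A hA using hgood
  refine ⟨A, SmoothFamilyOn.of_locally fun σ₁ _ => ?_, fun σ _ v f x => ?_⟩
  · obtain ⟨r, hr, B, hB, hBa⟩ := hloc σ₁
    have hmem : σ₁ ∈ chartBall E σ₁ r := ⟨mem_chart_source E σ₁, Metric.mem_ball_self hr.pos⟩
    -- Near `σ₁` the global primitive is `B` plus the constant operator `A σ₁ - B σ₁`.
    refine ⟨chartBall E σ₁ r, isOpen_chartBall σ₁ r, hmem, SmoothFamilyOn.congr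
      (isOpen_chartBall σ₁ r) (hB.add (smoothFamilyOn_const _ (A σ₁ - B σ₁))) fun σ hσ =>
      DiffOp.ext fun f x => ?_⟩
    rw [map_add, map_sub]
    change _ = B σ f x + (A σ₁ f x - B σ₁ f x)
    have := (hBa σ₁ hmem σ hσ).2 f x
    rw [hA, hA]
    linear_combination this
  · obtain ⟨r, hr, B, hB, hBa⟩ := hloc σ
    have hmem : σ ∈ chartBall E σ r := ⟨mem_chart_source E σ, Metric.mem_ball_self hr.pos⟩
    have h1 : (fun τ => A τ f x) =ᶠ[𝓝 σ] fun τ => g f x τ - g f x (base σ) := by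
      filter_upwards [(isOpen_chartBall σ r).mem_nhds hmem] with τ hτ
      rw [hA, (hBa σ hmem τ hτ).1]
    have h2 := ((hgd f x σ).hasMFDerivAt.sub
      (hasMFDerivAt_const (g f x (base σ)) σ)).congr_of_eventuallyEq h1
    rw [hg f x σ v]
    refine Eq.trans ?_ (congrArg (fun L : E →L[ℝ] ℂ => L v) h2.mfderiv).symm
    exact (sub_zero _).symm

end GlobalPrimitive

/-- Recursive choice where the condition on the term `l` depends on the earlier terms. By `hcongr`
later terms do not matter, so an initial segment may be completed by an arbitrary `b₀`. -/
theorem exists_sequence {β : Type*} [Nonempty β] (p : ℕ → (ℕ → β) → β → Prop)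
    (hcongr : ∀ l Q Q' b, (∀ j < l, Q j = Q' j) → p l Q b → p l Q' b)
    (hstep : ∀ l Q, (∀ j < l, p j Q (Q j)) → ∃ b, p l Q b) : ∃ P : ℕ → β, ∀ l, p l P (P l) := by
  classical
  obtain ⟨b₀⟩ := ‹Nonempty β›
  -- The choice operator returns a value even if no suitable one exists. This permits defining the
  -- sequence first and proving afterwards, by strong induction, that every choice was possible.
  let step : ∀ l, (∀ j < l, β) → β := fun l Q =>
    Classical.epsilon (p l fun j => if h : j < l then Q j h else b₀)
  let P : ℕ → β := WellFounded.fix (C := fun _ => β) Nat.lt_wfRel.wf step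
  have hP : ∀ l, P l = Classical.epsilon (p l fun j => if j < l then P j else b₀) := fun l => by
    change WellFounded.fix (C := fun _ => β) Nat.lt_wfRel.wf step l = _
    rw [WellFounded.fix_eq]
    rfl
  refine ⟨P, fun l => ?_⟩
  induction l using Nat.strong_induction_on with
  | _ l ih =>
    have e : ∀ j < l, P j = (fun j => if j < l then P j else b₀) j := fun j hj => by simp [hj]
    have h1 : ∃ b, p l (fun j => if j < l then P j else b₀) b := by
      refine hstep l _ fun j hj => ?_
      rw [if_pos hj]
      exact hcongr j P _ _ (fun k hk => e k (hk.trans hj)) (ih j hj)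
    have h2 := Classical.epsilon_spec h1
    rw [← hP] at h2
    exact hcongr l _ _ _ (fun j hj => (e j hj).symm) h2

/-! ### The equations for the coefficients, and flatness in each order of `h` -/

section Recursion

variable {E : Type*} [NormedAddCommGroup E] [NormedSpace ℝ E]
  {T : Type*} [TopologicalSpace T] [ChartedSpace E T]
  {F : Type*} [NormedAddCommGroup F] [NormedSpace ℝ F]
  {M : Type*} [TopologicalSpace M] [ChartedSpace F M]

theorem smoothFun_sum_apply {ι : Type*} (s : Finset ι) (f : ι → SmoothFun F M) (x : M) :
    (∑ i ∈ s, f i) x = ∑ i ∈ s, f i x :=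
  map_sum (ContMDiffMap.evalRingHom (I := 𝓘(ℝ, F)) (I' := 𝓘(ℝ, ℂ)) (n := ∞) x) _ _

theorem vderiv_neg {f : T → SmoothFun F M} {σ : T} {x : M}
    (hf : MDifferentiableAt 𝓘(ℝ, E) 𝓘(ℝ, ℂ) (fun τ => f τ x) σ) (v : TangentSpace 𝓘(ℝ, E) σ) :
    vderiv E (fun τ => -f τ) σ v x = -vderiv E f σ v x := by
  have h := vderiv_smul hf (-1) v
  simpa only [neg_one_smul] using h

theorem mdifferentiableAt_sum_apply {ι : Type*} (s : Finset ι) {f : ι → T → SmoothFun F M} {σ : T}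
    {x : M} (hf : ∀ i ∈ s, MDifferentiableAt 𝓘(ℝ, E) 𝓘(ℝ, ℂ) (fun τ => f i τ x) σ) :
    MDifferentiableAt 𝓘(ℝ, E) 𝓘(ℝ, ℂ) (fun τ => (∑ i ∈ s, f i τ) x) σ := by
  classical
  induction s using Finset.induction_on with
  | empty =>
    simp only [Finset.sum_empty]
    exact mdifferentiableAt_const (c := (0 : ℂ))
  | insert i s hi ih =>
    simp only [Finset.sum_insert hi]
    exact (hf i (by simp)).add (ih fun j hj => hf j (by simp [hj]))

theorem vderiv_sum {ι : Type*} (s : Finset ι) {f : ι → T → SmoothFun F M} {σ : T} {x : M}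
    (hf : ∀ i ∈ s, MDifferentiableAt 𝓘(ℝ, E) 𝓘(ℝ, ℂ) (fun τ => f i τ x) σ)
    (v : TangentSpace 𝓘(ℝ, E) σ) :
    vderiv E (fun τ => ∑ i ∈ s, f i τ) σ v x = ∑ i ∈ s, vderiv E (f i) σ v x := by
  classical
  induction s using Finset.induction_on with
  | empty =>
    simp only [Finset.sum_empty]
    exact vderiv_zero σ v x
  | insert i s hi ih =>
    simp only [Finset.sum_insert hi]
    rw [vderiv_add (hf i (by simp))
      (mdifferentiableAt_sum_apply s fun j hj => hf j (by simp [hj])),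
      ih fun j hj => hf j (by simp [hj])]

variable [IsManifold 𝓘(ℝ, E) ∞ T]

namespace FormalConn

/-- The coefficient of `h^l` in `D̃`. -/
def coeffForm (D : FormalConn E T F M) (l : ℕ) : OpOneForm E T F M :=
  fun σ => hcoeff l ∘ₗ D.form σ

/-- The one-form whose primitive is the coefficient of `h^l` in a formal trivialization with
coefficients `P`. -/
def recForm (D : FormalConn E T F M) (P : ℕ → T → DiffOp F M) (l : ℕ) : OpOneForm E T F M :=
  fun σ => -∑ p ∈ Finset.HasAntidiagonal.antidiagonal l, LinearMap.mulRight ℝ (P p.2 σ) ∘ₗ D.coeffForm p.1 σ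

variable {D : FormalConn E T F M}

theorem recForm_apply (P : ℕ → T → DiffOp F M) (l : ℕ) (σ : T) (v : TangentSpace 𝓘(ℝ, E) σ) :
    D.recForm P l σ v = -∑ p ∈ Finset.HasAntidiagonal.antidiagonal l, D.coeffForm p.1 σ v * P p.2 σ := by
  simp only [recForm, LinearMap.neg_apply, LinearMap.sum_apply]
  rfl

theorem recForm_apply_fun (P : ℕ → T → DiffOp F M) (l : ℕ) (σ : T) (v : TangentSpace 𝓘(ℝ, E) σ)
    (f : SmoothFun F M) :
    D.recForm P l σ v f
      = -∑ p ∈ Finset.HasAntidiagonal.antidiagonal l, D.coeffForm p.1 σ v (P p.2 σ f) := by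
  rw [recForm_apply, map_neg, map_sum, LinearMap.neg_apply, LinearMap.sum_apply]
  simp only [map_mul]
  rfl

theorem IsZeroModH.coeffForm_zero (hD : D.IsZeroModH) (σ : T) (v : TangentSpace 𝓘(ℝ, E) σ) :
    D.coeffForm 0 σ v = 0 := hD σ v

/-- The coefficient `P l` occurs only next to `D̃⁽⁰⁾ = 0`. This is what makes `dP_l = recForm P l` a
recursion. -/
theorem IsZeroModH.recForm_congr (hD : D.IsZeroModH) {P Q : ℕ → T → DiffOp F M} {l : ℕ}
    (h : ∀ j < l, P j = Q j) : D.recForm P l = D.recForm Q l := by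
  funext σ
  refine LinearMap.ext fun v => ?_
  rw [recForm_apply, recForm_apply]
  congr 1
  refine Finset.sum_congr rfl fun p hp => ?_
  rw [Finset.HasAntidiagonal.mem_antidiagonal] at hp
  by_cases h0 : p.1 = 0
  · rw [h0, hD.coeffForm_zero, zero_mul, zero_mul]
  · rw [h p.2 (by omega)]

theorem coeff_cov_apply [IsManifold 𝓘(ℝ, F) ∞ M] (V : VField E T) (f : FormalSection E T F M)
    (l : ℕ) (p : T × M) :
    PowerSeries.coeff l (D.cov V f) p = D.covAt f.at p.1 (V p.1) l p.2 := by
  have h : PowerSeries.coeff l (D.cov V f)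
      = (⟨fun p => D.covAt f.at p.1 (V p.1) l p.2, D.contMDiff_covAt V f l⟩ : FamFun E T F M) :=
    PowerSeries.coeff_mk _ _
  rw [h]
  rfl

/-- Flatness on the level of the coefficients of `D̃`. -/
theorem IsFlat.coeffForm [FiniteDimensional ℝ E] [IsManifold 𝓘(ℝ, F) ∞ M] (hD : D.IsFlat)
    (V W : VField E T) (l : ℕ) (f : SmoothFun F M) (σ : T) (x : M) :
    vderiv E (fun τ => D.coeffForm l τ (W τ) f) σ (V σ) x
      - vderiv E (fun τ => D.coeffForm l τ (V τ) f) σ (W σ) x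
      - D.coeffForm l σ (VectorField.mlieBracket 𝓘(ℝ, E) V W σ) f x
      = ∑ p ∈ Finset.HasAntidiagonal.antidiagonal l,
        (D.coeffForm p.1 σ (W σ) (D.coeffForm p.2 σ (V σ) f) x
          - D.coeffForm p.1 σ (V σ) (D.coeffForm p.2 σ (W σ) f) x) := by
  -- Flatness is evaluated on the section that is constant along `T` and has `f` as its only
  -- coefficient, in degree `0`. Then `V[s] = 0` and `D_V s` has the coefficients `D̃⁽ˡ⁾(V) f`.
  let s : FormalSection E T F M := PowerSeries.mk fun l =>
    if l = 0 then f.comp ContMDiffMap.snd else 0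
  have hs : ∀ σ, s.at σ = PowerSeries.mk fun l => if l = 0 then f else 0 := fun σ => by
    refine PowerSeries.ext fun l => ?_
    simp only [s, FormalSection.at, PowerSeries.coeff_mk]
    split_ifs <;> rfl
  have happ : ∀ σ (v : TangentSpace 𝓘(ℝ, E) σ) l,
      PowerSeries.coeff l ((D.form σ v).app (s.at σ)) = D.coeffForm l σ v f := by
    intro σ v l
    rw [hs]
    simp only [FormalDiffOp.app, PowerSeries.coeff_mk]
    rw [Finset.sum_eq_single (l, 0)]
    · simp only [if_pos]
      rfl
    · rintro ⟨i, j⟩ hp hne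
      rw [Finset.HasAntidiagonal.mem_antidiagonal] at hp
      have : j ≠ 0 := by
        rintro rfl
        exact hne (by simp at hp; rw [hp])
      simp only [this, if_false]
      exact map_zero _
    · intro h
      exact absurd (Finset.HasAntidiagonal.mem_antidiagonal.2 (by simp)) h
  have hcov1 : ∀ σ (v : TangentSpace 𝓘(ℝ, E) σ) l x,
      D.covAt s.at σ v l x = D.coeffForm l σ v f x := by
    intro σ v l x
    rw [covAt, happ]
    have h1 : vderiv E (fun τ => PowerSeries.coeff l (s.at τ)) σ v x = 0 := by
      have h2 : (fun τ => PowerSeries.coeff l (s.at τ)) = fun _ => if l = 0 then f else 0 := by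
        funext τ
        rw [hs]
        exact PowerSeries.coeff_mk _ _
      rw [h2]
      unfold vderiv
      rw [mfderiv_const]
      rfl
    rw [h1, zero_add]
  have hat : ∀ (W : VField E T) l τ, PowerSeries.coeff l ((D.cov W s).at τ)
      = D.coeffForm l τ (W τ) f := by
    intro W l τ
    have h1 : PowerSeries.coeff l ((D.cov W s).at τ) = slice (PowerSeries.coeff l (D.cov W s)) τ :=
      PowerSeries.coeff_mk _ _
    rw [h1]
    ext x
    exact (coeff_cov_apply W s l (τ, x)).trans <| hcov1 τ (W τ) l x
  have hcov2 : ∀ V W : VField E T, D.covAt (D.cov W s).at σ (V σ) l x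
      = vderiv E (fun τ => D.coeffForm l τ (W τ) f) σ (V σ) x
        + ∑ p ∈ Finset.HasAntidiagonal.antidiagonal l,
          D.coeffForm p.1 σ (V σ) (D.coeffForm p.2 σ (W σ) f) x := by
    intro V W
    rw [covAt]
    simp only [hat]
    congr 1
    simp only [FormalDiffOp.app, PowerSeries.coeff_mk, hat]
    exact smoothFun_sum_apply _ _ _
  have h := hD V W s
  have h1 := congrArg (fun g : FormalSection E T F M => PowerSeries.coeff l g (σ, x)) h
  have h2 : D.covAt (D.cov W s).at σ (V σ) l x - D.covAt (D.cov V s).at σ (W σ) l x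
      - D.covAt s.at σ (VectorField.mlieBracket 𝓘(ℝ, E) V W σ) l x = 0 := by
    simp only [map_sub, map_zero] at h1
    rw [← coeff_cov_apply V _ l (σ, x), ← coeff_cov_apply W _ l (σ, x)]
    have h3 := coeff_cov_apply (D := D) (lieBracket V W) s l (σ, x)
    change _ = D.covAt s.at σ (VectorField.mlieBracket 𝓘(ℝ, E) V W σ) l x at h3
    rw [← h3]
    exact h1
  rw [hcov2, hcov2, hcov1] at h2
  rw [Finset.sum_sub_distrib]
  linear_combination h2

end FormalConn

end Recursion

/-- Both sides run over the triples with sum `l`. It is the associativity of Cauchy products, for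
terms that need not be products. -/
theorem sum_antidiagonal_assoc {R : Type*} [AddCommMonoid R] (X : ℕ → ℕ → ℕ → R) (l : ℕ) :
    ∑ p ∈ Finset.HasAntidiagonal.antidiagonal l, ∑ q ∈ Finset.HasAntidiagonal.antidiagonal p.1,
        X q.1 q.2 p.2
      = ∑ p ∈ Finset.HasAntidiagonal.antidiagonal l,
        ∑ q ∈ Finset.HasAntidiagonal.antidiagonal p.2, X p.1 q.1 q.2 := by
  rw [Finset.sum_sigma', Finset.sum_sigma']
  refine Finset.sum_bij' (fun a _ => ⟨(a.2.1, a.2.2 + a.1.2), (a.2.2, a.1.2)⟩)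
    (fun a _ => ⟨(a.1.1 + a.2.1, a.2.2), (a.1.1, a.2.1)⟩) ?_ ?_ ?_ ?_ ?_
  · rintro ⟨⟨i, j⟩, ⟨a, b⟩⟩ h
    simp only [Finset.mem_sigma, Finset.HasAntidiagonal.mem_antidiagonal] at h ⊢
    exact ⟨by omega, trivial⟩
  · rintro ⟨⟨i, j⟩, ⟨a, b⟩⟩ h
    simp only [Finset.mem_sigma, Finset.HasAntidiagonal.mem_antidiagonal] at h ⊢
    exact ⟨by omega, trivial⟩
  · rintro ⟨⟨i, j⟩, ⟨a, b⟩⟩ h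
    simp only [Finset.mem_sigma, Finset.HasAntidiagonal.mem_antidiagonal] at h ⊢
    rw [h.2]
  · rintro ⟨⟨i, j⟩, ⟨a, b⟩⟩ h
    simp only [Finset.mem_sigma, Finset.HasAntidiagonal.mem_antidiagonal] at h ⊢
    rw [h.2]
  · exact fun _ _ => rfl

/-! ### Closedness of the recursive forms, and solution order by order -/

section Recursion

variable {E : Type*} [NormedAddCommGroup E] [NormedSpace ℝ E]
  {T : Type*} [TopologicalSpace T] [ChartedSpace E T] [IsManifold 𝓘(ℝ, E) ∞ T]
  {F : Type*} [NormedAddCommGroup F] [NormedSpace ℝ F]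
  {M : Type*} [TopologicalSpace M] [ChartedSpace F M]

namespace FormalConn

variable {D : FormalConn E T F M} {U : Set T} {P : ℕ → T → DiffOp F M} {l : ℕ}

/-- Since `f` is constant along `T`, the derivative falls on the coefficients of `Q`. After
substitution of the recursive equations, the derivative part and the part from `D̃` are the two ways
of arranging one triple sum, with opposite signs. -/
theorem covAt_app_eq_zero {Q : T → FormalDiffOp F M} {σ : T}
    (hs : ∀ l f x, MDifferentiableAt 𝓘(ℝ, E) 𝓘(ℝ, ℂ) (fun τ => hcoeff l (Q τ) f x) σ)
    (hd : ∀ l (v : TangentSpace 𝓘(ℝ, E) σ) f x, D.recForm (fun l τ => hcoeff l (Q τ)) l σ v f x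
      = vderiv E (fun τ => hcoeff l (Q τ) f) σ v x)
    (f : FormalFun F M) (v : TangentSpace 𝓘(ℝ, E) σ) (l : ℕ) (x : M) :
    D.covAt (fun τ => (Q τ).app f) σ v l x = 0 := by
  have happ : ∀ (A : FormalDiffOp F M) (g : FormalFun F M) l, PowerSeries.coeff l (A.app g)
      = ∑ p ∈ Finset.HasAntidiagonal.antidiagonal l, hcoeff p.1 A (PowerSeries.coeff p.2 g) :=
    fun A g l => PowerSeries.coeff_mk _ _
  simp only [covAt, happ]
  rw [vderiv_sum _ fun p _ => hs p.1 _ x, smoothFun_sum_apply]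
  simp only [← hd, recForm_apply_fun, map_sum, smoothFun_sum_apply]
  have hassoc := sum_antidiagonal_assoc (fun a b j =>
    D.coeffForm a σ v (hcoeff b (Q σ) (PowerSeries.coeff j f)) x) l
  refine (congrArg (· + _) ?_).trans (neg_add_eq_zero.2 hassoc)
  rw [← Finset.sum_neg_distrib]
  refine Finset.sum_congr rfl fun p _ => ?_
  rw [← smoothFun_sum_apply]
  rfl

theorem smoothFamilyOn_coeffForm (D : FormalConn E T F M) (U : Set T) (l : ℕ) (V : VField E T) :
    SmoothFamilyOn E U (fun σ => D.coeffForm l σ (V σ)) :=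
  SmoothFamilyOn.mono (D.smooth l V) (Set.subset_univ U)

variable [FiniteDimensional ℝ E] [T2Space T]

theorem IsZeroModH.isSmoothOn_recForm (hD : D.IsZeroModH) (hU : IsOpen U)
    (hP : ∀ j < l, SmoothFamilyOn E U (P j)) : (D.recForm P l).IsSmoothOn U := by
  intro V
  simp only [recForm_apply]
  refine (SmoothFamilyOn.sum _ fun p hp => ?_).neg
  rw [Finset.HasAntidiagonal.mem_antidiagonal] at hp
  by_cases h0 : p.1 = 0
  · simp only [h0, hD.coeffForm_zero, zero_mul]
    exact SmoothFamilyOn.zero U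
  · exact (D.smoothFamilyOn_coeffForm U p.1 V).mul hU (hP p.2 (by omega))

variable [FiniteDimensional ℝ F] [IsManifold 𝓘(ℝ, F) ∞ M] [T2Space M]

/-- The Leibniz rule for the terms of `recForm`. -/
theorem IsZeroModH.vderiv_coeffForm_apply (hD : D.IsZeroModH) (hU : IsOpen U)
    (hP : ∀ j < l, SmoothFamilyOn E U (P j))
    (hd : ∀ j < l, (D.recForm P j).IsDifferentialOn U (P j)) (V W : VField E T)
    (f : SmoothFun F M) {σ : T} (hσ : σ ∈ U) (x : M) {p : ℕ × ℕ} (hp : p.1 + p.2 = l) :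
    vderiv E (fun τ => D.coeffForm p.1 τ (W τ) (P p.2 τ f)) σ (V σ) x
      = vderiv E (fun τ => D.coeffForm p.1 τ (W τ) (P p.2 σ f)) σ (V σ) x
        - ∑ q ∈ Finset.HasAntidiagonal.antidiagonal p.2,
          D.coeffForm p.1 σ (W σ) (D.coeffForm q.1 σ (V σ) (P q.2 σ f)) x := by
  have hsum : D.coeffForm p.1 σ (W σ) (D.recForm P p.2 σ (V σ) f) x
      = -∑ q ∈ Finset.HasAntidiagonal.antidiagonal p.2,
          D.coeffForm p.1 σ (W σ) (D.coeffForm q.1 σ (V σ) (P q.2 σ f)) x := by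
    rw [recForm_apply_fun, map_neg, map_sum, ← smoothFun_sum_apply]
    rfl
  rw [sub_eq_add_neg, ← hsum]
  -- Here `p.2 = l`, and nothing is known about `P l`; but the factor `D̃⁽⁰⁾` annihilates all terms.
  by_cases h0 : p.1 = 0
  · have hz : ∀ τ (v : TangentSpace 𝓘(ℝ, E) τ) g, D.coeffForm p.1 τ v g = 0 := fun τ v g => by
      rw [h0, hD.coeffForm_zero, map_zero]
      rfl
    simp only [hz, vderiv_zero, zero_add]
    rfl
  · exact (D.smoothFamilyOn_coeffForm U p.1 W).vderiv_apply hU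
      ((hP p.2 (by omega)).smoothOver_apply_const f) hσ (V σ)
      (hd p.2 (by omega) σ hσ (V σ) f) x

/-- By the Leibniz rule, `dα_l(V, W)` is minus the sum of `dD̃⁽ⁱ⁾(V, W) P_j` and of the terms in
which the derivative hits `P_j`. The recursive equations turn the latter into `D̃⁽ⁱ⁾(V) D̃⁽ᵃ⁾(W) P_b
- D̃⁽ⁱ⁾(W) D̃⁽ᵃ⁾(V) P_b` with `a + b = j`. Flatness gives the same terms with the other sign,
grouped differently. -/
theorem IsFlat.isClosedOn_recForm (hflat : D.IsFlat) (hD : D.IsZeroModH) (hU : IsOpen U)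
    (hP : ∀ j < l, SmoothFamilyOn E U (P j))
    (hd : ∀ j < l, (D.recForm P j).IsDifferentialOn U (P j)) : (D.recForm P l).IsClosedOn U := by
  intro V W f σ hσ x
  have hder : ∀ V W : VField E T, vderiv E (fun τ => D.recForm P l τ (W τ) f) σ (V σ) x
      = -∑ p ∈ Finset.HasAntidiagonal.antidiagonal l,
        vderiv E (fun τ => D.coeffForm p.1 τ (W τ) (P p.2 τ f)) σ (V σ) x := by
    intro V W
    have hm : ∀ p ∈ Finset.HasAntidiagonal.antidiagonal l, MDifferentiableAt 𝓘(ℝ, E) 𝓘(ℝ, ℂ)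
        (fun τ => D.coeffForm p.1 τ (W τ) (P p.2 τ f) x) σ := by
      intro p hp
      rw [Finset.HasAntidiagonal.mem_antidiagonal] at hp
      by_cases h0 : p.1 = 0
      · simp only [h0, hD.coeffForm_zero, map_zero]
        exact mdifferentiableAt_const (c := (0 : ℂ))
      · exact ((D.smoothFamilyOn_coeffForm U p.1 W).smoothOver_apply hU
          ((hP p.2 (by omega)).smoothOver_apply_const f)).mdifferentiableAt hU hσ x
    simp only [recForm_apply_fun]
    rw [vderiv_neg (mdifferentiableAt_sum_apply _ hm), vderiv_sum _ hm]
  have hval : D.recForm P l σ (VectorField.mlieBracket 𝓘(ℝ, E) V W σ) f x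
      = -∑ p ∈ Finset.HasAntidiagonal.antidiagonal l,
        D.coeffForm p.1 σ (VectorField.mlieBracket 𝓘(ℝ, E) V W σ) (P p.2 σ f) x := by
    rw [recForm_apply_fun, ← smoothFun_sum_apply]
    rfl
  have hassoc := sum_antidiagonal_assoc (fun a b j =>
    D.coeffForm a σ (W σ) (D.coeffForm b σ (V σ) (P j σ f)) x
      - D.coeffForm a σ (V σ) (D.coeffForm b σ (W σ) (P j σ f)) x) l
  simp only [← hflat.coeffForm V W _ _ σ x] at hassoc
  rw [hder, hder, hval,
    Finset.sum_congr rfl fun p hp => hD.vderiv_coeffForm_apply hU hP hd V W f hσ x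
      (Finset.HasAntidiagonal.mem_antidiagonal.1 hp),
    Finset.sum_congr rfl fun p hp => hD.vderiv_coeffForm_apply hU hP hd W V f hσ x
      (Finset.HasAntidiagonal.mem_antidiagonal.1 hp)]
  simp only [Finset.sum_sub_distrib] at hassoc ⊢
  linear_combination -hassoc

/-- The common core of the three parts, which differ only in the supply `hprim` of primitives. The
predicate `R` is a property carried through the recursion: no condition in the first two parts,
equivariance in the third. -/
theorem exists_isTrivializationOn (hflat : D.IsFlat) (hD : D.IsZeroModH) (hU : IsOpen U)
    (R : (T → DiffOp F M) → Prop) (hR : R fun _ => 1)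
    (hprim : ∀ (P : ℕ → T → DiffOp F M) (l : ℕ), (∀ j < l, R (P j)) →
      (D.recForm P l).IsSmoothOn U → (D.recForm P l).IsClosedOn U →
      ∃ A, SmoothFamilyOn E U A ∧ R A ∧ (D.recForm P l).IsDifferentialOn U A) :
    ∃ P : T → FormalDiffOp F M, D.IsTrivializationOn U P ∧ ∀ l, R fun σ => hcoeff l (P σ) := by
  obtain ⟨P, hP⟩ := exists_sequence (β := T → DiffOp F M)
    (fun l Q A => SmoothFamilyOn E U A ∧ R A ∧ (D.recForm Q l).IsDifferentialOn U A ∧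
      -- In degree `0` the equation is `dP_0 = 0`. Prescribing the identity, rather than any
      -- primitive of zero, makes `P` invertible modulo `h`.
      (l = 0 → A = fun _ => 1))
    (fun l Q Q' A h => by rw [hD.recForm_congr h]; exact id) (fun l Q h => by
      rcases Nat.eq_zero_or_pos l with rfl | hl
      · refine ⟨fun _ => 1, SmoothFamilyOn.one U, hR, fun σ _ v f x => ?_, fun _ => rfl⟩
        rw [recForm_apply_fun]
        rw [Finset.sum_eq_zero, neg_zero]
        · unfold vderiv
          rw [mfderiv_const]
          rfl
        · intro p hp
          rw [Finset.HasAntidiagonal.mem_antidiagonal] at hp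
          rw [show p.1 = 0 by omega, hD.coeffForm_zero, map_zero]
          rfl
      · obtain ⟨A, h1, h2, h3⟩ := hprim Q l (fun j hj => (h j hj).2.1)
          (hD.isSmoothOn_recForm hU fun j hj => (h j hj).1)
          (hflat.isClosedOn_recForm hD hU (fun j hj => (h j hj).1) fun j hj => (h j hj).2.2.1)
        exact ⟨A, h1, h2, h3, fun h0 => absurd h0 hl.ne'⟩)
  have hc : ∀ l, (fun σ => hcoeff l (PowerSeries.mk fun l => P l σ)) = P l := fun l =>
    funext fun σ => PowerSeries.coeff_mk _ _
  refine ⟨fun σ => PowerSeries.mk fun l => P l σ, ⟨fun l => ?_, fun σ _ => ?_,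
    fun f σ hσ v l x => covAt_app_eq_zero (fun l f x => ?_) (fun l v f x => ?_) f v l x⟩,
    fun l => ?_⟩
  · rw [hc]
    exact (hP l).1
  · have h0 : hcoeff 0 (PowerSeries.mk fun l => P l σ) = 1 :=
      (congrFun (hc 0) σ).trans (congrFun ((hP 0).2.2.2 rfl) σ)
    rw [h0, map_one]
    exact Function.bijective_id
  · have h1 := (((hP l).1.smoothOver_apply_const f)).mdifferentiableAt hU hσ x
    rw [← hc] at h1
    exact h1
  · have h1 := (hP l).2.2.1 σ hσ v f x
    have h2 : (fun l τ => hcoeff l (PowerSeries.mk fun l => P l τ)) = P := funext hc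
    rw [h2, h1, ← hc]
  · rw [hc]
    exact (hP l).2.1

end FormalConn

end Recursion

/-! ### Compatibility of the recursion with the group action -/

section Equivariant

variable {E : Type*} [NormedAddCommGroup E] [NormedSpace ℝ E]
  {T : Type*} [TopologicalSpace T] [ChartedSpace E T]
  {F : Type*} [NormedAddCommGroup F] [NormedSpace ℝ F]
  {M : Type*} [TopologicalSpace M] [ChartedSpace F M]
  {Γ : Type*} [Group Γ] [MulAction Γ T] [MulAction Γ M] [SmoothAction F M Γ]

theorem conj_one (γ : Γ) : conj γ (1 : DiffOp F M) = 1 := by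
  refine DiffOp.ext fun f x => ?_
  exact congrArg f (smul_inv_smul γ x)

theorem conj_mul (γ : Γ) (A B : DiffOp F M) : conj γ (A * B) = conj γ A * conj γ B := by
  have h : (pullback γ * pullback γ⁻¹ : Module.End ℝ (SmoothFun F M)) = 1 := by
    ext f x
    exact congrArg f (inv_smul_smul γ x)
  apply Subtype.ext
  change pullback γ⁻¹ * (A * B).toEnd * pullback γ
    = (pullback γ⁻¹ * A.toEnd * pullback γ) * (pullback γ⁻¹ * B.toEnd * pullback γ)
  simp only [map_mul, mul_assoc]
  rw [← mul_assoc (pullback γ) (pullback γ⁻¹), h, one_mul]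

variable [IsManifold 𝓘(ℝ, E) ∞ T]

theorem mem_exactInvariantOneForms (h : Subsingleton (EquivariantH1 E T F M Γ))
    {α : OpOneForm E T F M} (hα : α ∈ closedInvariantOneForms E T F M Γ) :
    α ∈ exactInvariantOneForms E T F M Γ := by
  have h1 : (⟨α, hα⟩ : closedInvariantOneForms E T F M Γ) ∈
      (exactInvariantOneForms E T F M Γ).submoduleOf (closedInvariantOneForms E T F M Γ) :=
    (Submodule.Quotient.mk_eq_zero _).1 (Subsingleton.elim _ _)
  exact h1

/-- `recForm` is invariant if `D` is, and the coefficients that enter into it are equivariant. -/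
theorem FormalConn.IsInvariant.recForm {D : FormalConn E T F M} (hD : D.IsInvariant Γ)
    (h0 : D.IsZeroModH) {P : ℕ → T → DiffOp F M} {l : ℕ} (hP : ∀ j < l, IsEquivariant Γ (P j)) :
    (D.recForm P l).IsInvariant Γ := by
  intro γ σ v
  rw [FormalConn.recForm_apply, FormalConn.recForm_apply, map_neg, map_sum]
  congr 1
  refine Finset.sum_congr rfl fun p hp => ?_
  rw [Finset.HasAntidiagonal.mem_antidiagonal] at hp
  rw [conj_mul]
  -- Equivariance is known only below degree `l`; the term with `P l` vanishes together with
  -- `D̃⁽⁰⁾`.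
  by_cases hp0 : p.1 = 0
  · rw [hp0, h0.coeffForm_zero, h0.coeffForm_zero, map_zero, zero_mul, zero_mul]
  · rw [hP p.2 (by omega) γ σ]
    exact congrArg (· * _) (hD p.1 γ σ v)

end Equivariant

end FormalConnection

end

/-! ### The proposition -/

theorem mainTheorem9
    {E : Type*} [NormedAddCommGroup E] [NormedSpace ℝ E] [FiniteDimensional ℝ E]
    {T : Type*} [TopologicalSpace T] [ChartedSpace E T] [IsManifold 𝓘(ℝ, E) ∞ T]
    [T2Space T] [SigmaCompactSpace T]
    {F : Type*} [NormedAddCommGroup F] [NormedSpace ℝ F] [FiniteDimensional ℝ F]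
    {M : Type*} [TopologicalSpace M] [ChartedSpace F M] [IsManifold 𝓘(ℝ, F) ∞ M]
    [T2Space M] [CompactSpace M]
    {Γ : Type*} [Group Γ] [MulAction Γ T] [MulAction Γ M]
    [FormalConnection.SmoothAction E T Γ] [FormalConnection.SmoothAction F M Γ]
    (D : FormalConnection.FormalConn E T F M) (hflat : D.IsFlat) (hzero : D.IsZeroModH) :
    (∀ σ₀ : T, ∃ U : Set T, IsOpen U ∧ σ₀ ∈ U ∧
      ∃ P : T → FormalConnection.FormalDiffOp F M, D.IsTrivializationOn U P) ∧
    (Subsingleton (FormalConnection.DeRhamH1 E T) →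
      ∃ P : T → FormalConnection.FormalDiffOp F M, D.IsTrivializationOn Set.univ P) ∧
    (D.IsInvariant Γ → Subsingleton (FormalConnection.EquivariantH1 E T F M Γ) →
      ∃ P : T → FormalConnection.FormalDiffOp F M, D.IsTrivializationOn Set.univ P ∧
        ∀ l : ℕ, FormalConnection.IsEquivariant Γ
          (fun σ => FormalConnection.hcoeff l (P σ))) := by
  refine ⟨fun σ₀ => ?_, fun h => ?_, fun hΓ h => ?_⟩
  · obtain ⟨r, hr, -⟩ := FormalConnection.exists_isAdapted (E := E) (σ₁ := σ₀) Filter.univ_mem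
    refine ⟨FormalConnection.chartBall E σ₀ r, FormalConnection.isOpen_chartBall σ₀ r,
      ⟨mem_chart_source E σ₀, Metric.mem_ball_self hr.pos⟩, ?_⟩
    obtain ⟨P, hP, -⟩ := FormalConnection.FormalConn.exists_isTrivializationOn hflat hzero
      (FormalConnection.isOpen_chartBall σ₀ r) (fun _ => True) trivial fun P l _ hs hc => by
        obtain ⟨A, h1, h2⟩ := hr.exists_primitive hs hc
        exact ⟨A, h1, trivial, h2⟩
    exact ⟨P, hP⟩
  · obtain ⟨P, hP, -⟩ := FormalConnection.FormalConn.exists_isTrivializationOn hflat hzero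
      isOpen_univ (fun _ => True) trivial fun P l _ hs hc => by
        obtain ⟨A, h1, h2⟩ := FormalConnection.exists_primitive_of_deRhamH1 h hs hc
        exact ⟨A, h1, trivial, h2⟩
    exact ⟨P, hP⟩
  -- No averaging over `Γ` is needed: equivariance of the lower coefficients makes the form
  -- invariant, and vanishing of the equivariant cohomology then gives a primitive that is already
  -- equivariant.
  · refine FormalConnection.FormalConn.exists_isTrivializationOn hflat hzero isOpen_univ
      (FormalConnection.IsEquivariant Γ) (fun γ _ => (FormalConnection.conj_one γ).symm)
      fun P l hP hs hc => ?_
    obtain ⟨A, h1, h2, h3⟩ := FormalConnection.mem_exactInvariantOneForms h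
      ⟨hs, fun V W f σ x => hc V W f σ trivial x, hΓ.recForm hzero hP⟩
    exact ⟨A, h1, h2, fun σ _ => h3 σ⟩
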